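/- Let \[K_G=\sup_{n\in\mathbb N}\ \sup_{0\ne A\in\mathbb R^{n\times n}}\ \frac{\max_{\|x_i\|_2=\|y_j\|_2=1}\sum_{i,j}A_{ij}\langle x_i,y_j\rangle}{\max_{x_i,y_j\in\{\pm1\}}\sum_{i,j}A_{ij}x_iy_j}\] be the real Grothendieck constant (the vectors range over the unit spheres of Euclidean spaces of arbitrary finite dimension). Let $\phi(x)=\frac1{\sqrt{2\pi}}e^{-x^2/2}$ and $\Phi(x)=\int_{-\infty}^x\phi(t)\,dt$, let $C^*\approx0.25573$ be the unique solution in $(0,1)$ of $4\phi(C)^2-4\Phi(-C)+1=0$, let $\lambda^*=2C^*\phi(C^*)\approx0.19748$, and let \[K_{DR}=\frac{1-\lambda^*}{4\phi(C^*)^2-\lambda^*(4\Phi(-C^*)-1)}\] be the Davie--Reeds lower bound. For the standard Gaussian measure $\gamma$ on $\mathbb R^n$, let $\Pi_k$ be the projection of $L^2(\gamma)$ onto the span of the Hermite polynomials of degree $k$, acting coordinatewise on functions with values in a real Hilbert space, and for $\varepsilon,\lambda\in\mathbb R$ let $A_{\varepsilon,\lambda}=\Pi_1-\lambda I-\varepsilon\Pi_3$.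 Let \[\mathrm{val}_n(A)=\sup_{f,g:\mathbb R^n\to\{\pm1\}}\mathbb E_{X\sim\gamma}\,(Af)(X)g(X),\qquad \mathrm{sdp}_n(A)=\sup_{\mathcal H}\ \sup_{f,g:\mathbb R^n\to S(\mathcal H)}\mathbb E_{X\sim\gamma}\,\langle (Af)(X),g(X)\rangle_{\mathcal H},\] where $f,g$ are measurable, $\mathcal H$ ranges over real Hilbert spaces and $S(\mathcal H)$ is the unit sphere of $\mathcal H$. Then: 1. $1.6769<K_{DR}<1.6770$, and $K_{DR}=\lim_{n\to\infty}\mathrm{sdp}_n(A_{0,\lambda^*})/\mathrm{val}_n(A_{0,\lambda^*})$ is the limiting integrality gap of the Davie--Reeds game $\Pi_1-\lambda^*I$. 2. For $\varepsilon=4\cdot10^{-11}$ and all sufficiently large $n$, $\ \mathrm{sdp}_n(A_{\varepsilon,\lambda^*})/\mathrm{val}_n(A_{\varepsilon,\lambda^*})\ge K_{DR}+10^{-12}$. 3. $K_G\ge K_{DR}+10^{-12}$. -/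

import Mathlib

open MeasureTheory ProbabilityTheory Filter Topology

/-! ### The real Grothendieck constant -/

/-- The set of all values `∑ A i j ⟨x i, y j⟩` at unit vectors `x i, y j` of some Euclidean space. -/
def vectorValueSet {n : ℕ} (A : Matrix (Fin n) (Fin n) ℝ) : Set ℝ :=
  {r | ∃ (d : ℕ) (x y : Fin n → EuclideanSpace ℝ (Fin d)),
    (∀ i, ‖x i‖ = 1) ∧ (∀ j, ‖y j‖ = 1) ∧ r = ∑ i, ∑ j, A i j * inner ℝ (x i) (y j)}

/-- The set of all values `∑ A i j * x i * y j` at signs `x i, y j ∈ {1, -1}`. -/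
def signValueSet {n : ℕ} (A : Matrix (Fin n) (Fin n) ℝ) : Set ℝ :=
  {r | ∃ x y : Fin n → ℝ, (∀ i, x i = 1 ∨ x i = -1) ∧ (∀ j, y j = 1 ∨ y j = -1) ∧
    r = ∑ i, ∑ j, A i j * x i * y j}

/-- The real Grothendieck constant, as a supremum in the extended reals, so that no finiteness
is presupposed. The denominator is nonnegative, and it vanishes only for `A = 0`, where the quotient
`0 / 0 = 0` does not contribute. -/
noncomputable def grothendieckConstant : EReal :=
  ⨆ (n : ℕ) (A : Matrix (Fin n) (Fin n) ℝ),
    ((sSup (vectorValueSet A) / sSup (signValueSet A) : ℝ) : EReal)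

/-! ### The Davie–Reeds constants -/

/-- The standard normal density `φ`. -/
noncomputable def stdNormalDensity (x : ℝ) : ℝ := gaussianPDFReal 0 1 x

/-- The standard normal distribution function `Φ`. -/
noncomputable def stdNormalCDF (x : ℝ) : ℝ := ∫ t in Set.Iic x, stdNormalDensity t

theorem stdNormalDensity_eq (x : ℝ) :
    stdNormalDensity x = (Real.sqrt (2 * Real.pi))⁻¹ * Real.exp (-x ^ 2 / 2) := by
  simp [stdNormalDensity, gaussianPDFReal]

theorem stdNormalDensity_pos (x : ℝ) : 0 < stdNormalDensity x :=
  gaussianPDFReal_pos 0 1 x one_ne_zero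

theorem stdNormalDensity_continuous : Continuous stdNormalDensity := by
  have : stdNormalDensity =
      fun x => (Real.sqrt (2 * Real.pi))⁻¹ * Real.exp (-x ^ 2 / 2) := funext stdNormalDensity_eq
  rw [this]; fun_prop

theorem stdNormalDensity_integrable : Integrable stdNormalDensity :=
  integrable_gaussianPDFReal 0 1

theorem stdNormalCDF_neg (x : ℝ) :
    stdNormalCDF (-x) = 1 / 2 - ∫ t in (0 : ℝ)..x, stdNormalDensity t := by
  have hint := stdNormalDensity_integrable
  have heven : ∀ t, stdNormalDensity (-t) = stdNormalDensity t := by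
    intro t; simp [stdNormalDensity_eq]
  have h0 : stdNormalCDF 0 = 1 / 2 := by
    have h1 : (∫ t in Set.Iic (0 : ℝ), stdNormalDensity t)
        + ∫ t in Set.Ioi (0 : ℝ), stdNormalDensity t = 1 := by
      rw [intervalIntegral.integral_Iic_add_Ioi hint.integrableOn hint.integrableOn]
      exact integral_gaussianPDFReal_eq_one 0 one_ne_zero
    have h2 : (∫ t in Set.Iic (0 : ℝ), stdNormalDensity t)
        = ∫ t in Set.Ioi (0 : ℝ), stdNormalDensity t := by
      have := integral_comp_neg_Iic (0 : ℝ) stdNormalDensity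
      simpa [heven] using this
    unfold stdNormalCDF
    linarith
  have h3 : (∫ t in Set.Iic (0 : ℝ), stdNormalDensity t)
      - (∫ t in Set.Iic (-x), stdNormalDensity t) = ∫ t in (-x)..0, stdNormalDensity t :=
    intervalIntegral.integral_Iic_sub_Iic hint.integrableOn hint.integrableOn
  have h4 : (∫ t in (-x)..0, stdNormalDensity t) = ∫ t in (0 : ℝ)..x, stdNormalDensity t := by
    have := intervalIntegral.integral_comp_neg (a := 0) (b := x) stdNormalDensity
    simpa [heven] using this.symm
  unfold stdNormalCDF at h0 ⊢
  linarith

theorem stdNormalDensity_zero_sq : stdNormalDensity 0 ^ 2 = 1 / (2 * Real.pi) := by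
  rw [stdNormalDensity_eq]
  have : (Real.sqrt (2 * Real.pi)) ^ 2 = 2 * Real.pi := Real.sq_sqrt (by positivity)
  rw [mul_pow, inv_pow, this]
  simp

theorem stdNormalDensity_hasDerivAt (x : ℝ) :
    HasDerivAt stdNormalDensity (-x * stdNormalDensity x) x := by
  have : stdNormalDensity =
      fun x => (Real.sqrt (2 * Real.pi))⁻¹ * Real.exp (-x ^ 2 / 2) := funext stdNormalDensity_eq
  rw [this]
  have h : HasDerivAt (fun x : ℝ => -x ^ 2 / 2) (-x) x := by
    have := ((hasDerivAt_pow 2 x).neg).div_const 2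
    refine this.congr_deriv ?_
    norm_num
    ring
  refine (h.exp.const_mul (Real.sqrt (2 * Real.pi))⁻¹).congr_deriv ?_
  ring

/-- The equation that defines the Davie–Reeds parameter `C*` has exactly one root in `(0, 1)`. -/
theorem existsUnique_davieReedsC :
    ∃! C : ℝ, C ∈ Set.Ioo (0 : ℝ) 1 ∧
      4 * stdNormalDensity C ^ 2 - 4 * stdNormalCDF (-C) + 1 = 0 := by
  set H : ℝ → ℝ := fun C => 4 * stdNormalDensity C ^ 2 - 4 * stdNormalCDF (-C) + 1 with hH
  have hd : ∀ x, HasDerivAt H (4 * stdNormalDensity x * (1 - 2 * x * stdNormalDensity x)) x := by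
    intro x
    have e : H = fun C => 4 * stdNormalDensity C ^ 2
        - 4 * (1 / 2 - ∫ t in (0 : ℝ)..C, stdNormalDensity t) + 1 := by
      funext C; simp only [hH, stdNormalCDF_neg]
    rw [e]
    have hi : HasDerivAt (fun C => ∫ t in (0 : ℝ)..C, stdNormalDensity t)
        (stdNormalDensity x) x :=
      intervalIntegral.integral_hasDerivAt_right
        (stdNormalDensity_continuous.intervalIntegrable _ _)
        (stdNormalDensity_continuous.stronglyMeasurableAtFilter _ _)
        stdNormalDensity_continuous.continuousAt
    refine (((((stdNormalDensity_hasDerivAt x).pow 2).const_mul 4).sub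
      ((hi.const_sub (1 / 2)).const_mul 4)).add_const 1).congr_deriv ?_
    norm_num
    ring
  have hcont : Continuous H := continuous_iff_continuousAt.2 fun x => (hd x).continuousAt
  have hφ0 : ∀ x, stdNormalDensity x < 1 / 2 := by
    intro x
    have h1 : stdNormalDensity x ≤ stdNormalDensity 0 := by
      rw [stdNormalDensity_eq, stdNormalDensity_eq]
      refine mul_le_mul_of_nonneg_left (Real.exp_le_exp.2 ?_) (by positivity)
      nlinarith [sq_nonneg x]
    have h2 : stdNormalDensity 0 ^ 2 < (1 / 2) ^ 2 := by
      rw [stdNormalDensity_zero_sq, div_lt_iff₀ (by positivity)]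
      nlinarith [Real.pi_gt_three]
    have h3 := lt_of_pow_lt_pow_left₀ 2 (by norm_num) h2
    linarith
  have hmono : StrictMonoOn H (Set.Icc 0 1) := by
    refine strictMonoOn_of_deriv_pos (convex_Icc 0 1) hcont.continuousOn ?_
    intro x hx
    rw [interior_Icc] at hx
    rw [(hd x).deriv]
    have h1 := hφ0 x
    have h2 := stdNormalDensity_pos x
    have : 0 < 1 - 2 * x * stdNormalDensity x := by nlinarith [hx.1, hx.2]
    positivity
  have hH0 : H 0 < 0 := by
    simp only [hH, stdNormalCDF_neg, stdNormalDensity_zero_sq, intervalIntegral.integral_same]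
    have : 4 * (1 / (2 * Real.pi)) < 1 := by
      rw [mul_one_div, div_lt_one (by positivity)]
      linarith [Real.pi_gt_three]
    linarith
  have hH1 : 0 < H 1 := by
    have hφ1 : 22 / 100 ≤ stdNormalDensity 1 := by
      rw [stdNormalDensity_eq]
      have a : Real.sqrt (2 * Real.pi) ≤ 27 / 10 := by
        rw [Real.sqrt_le_left (by norm_num)]
        linarith [Real.pi_lt_d2]
      have b : 10 / 27 ≤ (Real.sqrt (2 * Real.pi))⁻¹ := by
        have := inv_anti₀ (by positivity) a
        norm_num at this ⊢
        exact this
      have c : 3 / 5 ≤ Real.exp (-1 ^ 2 / 2) := by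
        have hp := Real.exp_pos (-1 ^ 2 / 2 : ℝ)
        have e2 : Real.exp (-1 ^ 2 / 2) * Real.exp (-1 ^ 2 / 2) * Real.exp 1 = 1 := by
          rw [← Real.exp_add, ← Real.exp_add]; norm_num
        have he := Real.exp_one_lt_d9
        by_contra hlt
        push Not at hlt
        nlinarith [Real.exp_pos 1, mul_pos hp hp]
      nlinarith
    have hge : (22 / 100 : ℝ) ≤ ∫ t in (0 : ℝ)..1, stdNormalDensity t := by
      have := intervalIntegral.integral_mono_on (μ := volume) (a := 0) (b := 1) (by norm_num)
        (f := fun _ => (22 / 100 : ℝ)) (g := stdNormalDensity)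
        intervalIntegrable_const (stdNormalDensity_continuous.intervalIntegrable _ _) (by
          intro t ht
          refine hφ1.trans ?_
          rw [stdNormalDensity_eq, stdNormalDensity_eq]
          refine mul_le_mul_of_nonneg_left (Real.exp_le_exp.2 ?_) (by positivity)
          nlinarith [ht.1, ht.2])
      rw [intervalIntegral.integral_const] at this
      simpa using this
    simp only [hH, stdNormalCDF_neg]
    nlinarith
  obtain ⟨c, hc, hc0⟩ := intermediate_value_Ioo (zero_le_one' ℝ) hcont.continuousOn ⟨hH0, hH1⟩
  refine ⟨c, ⟨hc, hc0⟩, ?_⟩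
  rintro y ⟨hy, hy0⟩
  exact hmono.injOn (Set.Ioo_subset_Icc_self hy) (Set.Ioo_subset_Icc_self hc)
    ((show H y = 0 from hy0).trans hc0.symm)

/-- `C* ≈ 0.25573`, the unique root of `4 φ(C)² - 4 Φ(-C) + 1` in `(0, 1)`. -/
noncomputable def davieReedsC : ℝ := existsUnique_davieReedsC.choose

/-- `λ* = 2 C* φ(C*) ≈ 0.19748`. -/
noncomputable def davieReedsLambda : ℝ := 2 * davieReedsC * stdNormalDensity davieReedsC

/-- The Davie–Reeds lower bound
`K_DR = (1 - λ*) / (4 φ(C*)² - λ* (4 Φ(-C*) - 1)) ≈ 1.6769`. -/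
noncomputable def davieReedsConstant : ℝ :=
  (1 - davieReedsLambda) /
    (4 * stdNormalDensity davieReedsC ^ 2
      - davieReedsLambda * (4 * stdNormalCDF (-davieReedsC) - 1))

/-! ### Hermite projection games -/

/-- The standard Gaussian measure on `ℝⁿ`. -/
noncomputable def stdGaussianPi (n : ℕ) : Measure (Fin n → ℝ) :=
  Measure.pi fun _ => gaussianReal 0 1

/-- The multivariate (probabilists') Hermite polynomial `He_α(x) = ∏ i, He_{α i}(x i)`. -/
noncomputable def hermiteMulti {n : ℕ} (α : Fin n → ℕ) (x : Fin n → ℝ) : ℝ :=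
  ∏ i, Polynomial.aeval (x i) (Polynomial.hermite (α i))

/-- The projection `Π_k` to the degree-`k` part of the Hermite expansion,
`(Π_k f)(x) = ∑_{|α| = k} He_α(x) / α! • 𝔼 [He_α(Y) f(Y)]`, for functions with values in a real Hilbert
space `H`. For `H = ℝ` this is the usual projection, and for general `H` it acts as the
usual projection on each coordinate. -/
noncomputable def hermiteProj {n : ℕ} {H : Type*} [NormedAddCommGroup H] [InnerProductSpace ℝ H]
    (k : ℕ) (f : (Fin n → ℝ) → H) (x : Fin n → ℝ) : H :=
  ∑ α ∈ Finset.piAntidiag (Finset.univ : Finset (Fin n)) k,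
    (hermiteMulti α x / ((∏ i, (α i).factorial : ℕ) : ℝ)) •
      ∫ y, hermiteMulti α y • f y ∂(stdGaussianPi n)

/-- The operator `A_{ε,λ} = Π_1 - λ I - ε Π_3` (the Davie–Reeds game is `ε = 0`, `λ = λ*`),
acting on functions with values in a real Hilbert space. -/
noncomputable def perturbedGame {n : ℕ} {H : Type*} [NormedAddCommGroup H]
    [InnerProductSpace ℝ H] (ε lam : ℝ) (f : (Fin n → ℝ) → H) (x : Fin n → ℝ) : H :=
  hermiteProj 1 f x - lam • f x - ε • hermiteProj 3 f x

/-- `val(A_{ε,λ})` in dimension `n`: the supremum of `𝔼 (A f)(X) g(X)` over measurable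
`f, g : ℝⁿ → {1, -1}`. -/
noncomputable def gameVal (n : ℕ) (ε lam : ℝ) : ℝ :=
  sSup {r | ∃ f g : (Fin n → ℝ) → ℝ, Measurable f ∧ Measurable g ∧
    (∀ x, f x = 1 ∨ f x = -1) ∧ (∀ x, g x = 1 ∨ g x = -1) ∧
    r = ∫ x, perturbedGame ε lam f x * g x ∂(stdGaussianPi n)}

/-- `sdp(A_{ε,λ})` in dimension `n`: the supremum of `𝔼 ⟨(A f)(X), g(X)⟩` over real Hilbert
spaces `H` and (strongly) measurable `f, g` from `ℝⁿ` to the unit sphere of `H`. -/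
noncomputable def gameSdp (n : ℕ) (ε lam : ℝ) : ℝ :=
  sSup {r | ∃ (H : Type) (_ : NormedAddCommGroup H) (_ : InnerProductSpace ℝ H)
    (_ : CompleteSpace H) (f g : (Fin n → ℝ) → H),
    StronglyMeasurable f ∧ StronglyMeasurable g ∧ (∀ x, ‖f x‖ = 1) ∧ (∀ x, ‖g x‖ = 1) ∧
    r = ∫ x, inner ℝ (perturbedGame ε lam f x) (g x) ∂(stdGaussianPi n)}

/-! ### One-dimensional Gaussian integrals -/

/-! For signs f, g put h = (f + g)/2 and k = (f - g)/2. Both take values in {0, 1, -1}, their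
supports are complementary, and polarization turns the value of the game into ‖Π_1 h‖² - ‖Π_1 k‖² -
λ(2 𝔼h² - 1) - ε(‖Π_3 h‖² - ‖Π_3 k‖²). By rotation invariance Π_1 h may be taken to be M x with x a
single coordinate and M = 𝔼[x h] ≥ 0. For ε = 0 it remains to maximize M² - λ(2 𝔼h² - 1), and the
optimum is h = sign(x) on |x| > C*, zero elsewhere. Here λ* = 2C*φ(C*) is the critical-point
condition for the threshold, and the equation for C* makes the value V = 4φ(C*)²(1 - λ*), hence K_DR
= 1/(4φ(C*)²).

On the vector side x/‖x‖ has ‖Π_1‖² → 1 as n → ∞, so Bessel's inequality forces ‖Π_3‖² → 0. The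
vector strategy therefore still has limiting value 1 - λ* when ε > 0, and a gain over K_DR follows
once the cubic term strictly lowers the sign value.

It does so by at least 0.01 ε, by a stability argument. Let B be the deficit of h in the bathtub
problem of maximizing 𝔼[x h - C* h²], and m the probability that h differs from the threshold
strategy. Then m² ≤ 6.4 B (`bathtub_bounds`), and the loss in the unperturbed value is at least 0.14
B (`davieReeds_loss_ge`). If B is large, this loss beats anything the cubic term can gain. If B is
small, then h is nearly the threshold strategy, whose cubic part has squared norm at least about
0.087 (`hermiteForm_three_ge`), while k is nearly supported in the slab |x| ≤ C*. No choice of signs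
of k there makes its cubic part exceed about 0.064 (`hermiteForm_three_le_of_slab`,
`hermiteForm_three_le_near_slab`), so the cubic term costs at least 0.01 ε. The two cases meet in
`gameForm_le_of_aligned`.

For K_G, x/‖x‖ is approximated by a simple function with values in the sphere. The game form on
functions constant on its cells is a finite matrix, whose sign values are values of the game and so
obey the same upper bound. -/

theorem integral_gaussian_eq (f : ℝ → ℝ) :
    ∫ x, f x ∂(gaussianReal 0 1) = ∫ x, stdNormalDensity x * f x := by
  rw [integral_gaussianReal_eq_integral_smul one_ne_zero]
  rfl

theorem integrable_gaussian_iff (f : ℝ → ℝ) :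
    Integrable f (gaussianReal 0 1) ↔ Integrable (fun x => stdNormalDensity x * f x) := by
  rw [gaussianReal_of_var_ne_zero 0 one_ne_zero,
    integrable_withDensity_iff_integrable_smul' (measurable_gaussianPDF 0 1)
      (ae_of_all _ fun x => ENNReal.ofReal_lt_top)]
  simp only [toReal_gaussianPDF, smul_eq_mul]
  rfl

theorem integrable_pow_gaussian (m : ℕ) : Integrable (fun x : ℝ => x ^ m) (gaussianReal 0 1) := by
  rcases Nat.eq_zero_or_pos m with rfl | hm
  · simp
  have h := (memLp_id_gaussianReal (μ := 0) (v := 1) (m : NNReal)).integrable_norm_pow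
    (by exact_mod_cast hm.ne')
  refine h.mono' (by fun_prop) (ae_of_all _ fun x => ?_)
  simp [norm_pow]

theorem hasDerivAt_pow_mul_density (m : ℕ) (x : ℝ) :
    HasDerivAt (fun x => x ^ m * stdNormalDensity x)
      (stdNormalDensity x * (m * x ^ (m - 1) - x ^ (m + 1))) x := by
  refine ((hasDerivAt_pow m x).mul (stdNormalDensity_hasDerivAt x)).congr_deriv ?_
  ring

theorem integrable_pow_mul_density (m : ℕ) :
    Integrable (fun x => x ^ m * stdNormalDensity x) := by
  simpa only [mul_comm] using (integrable_gaussian_iff _).1 (integrable_pow_gaussian m)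

theorem integrable_deriv_pow_mul_density (m : ℕ) :
    Integrable fun x => stdNormalDensity x * (m * x ^ (m - 1) - x ^ (m + 1)) :=
  (integrable_gaussian_iff _).1
    (((integrable_pow_gaussian (m - 1)).const_mul _).sub (integrable_pow_gaussian (m + 1)))

theorem integral_pow_succ_gaussian (m : ℕ) :
    ∫ x, x ^ (m + 1) ∂(gaussianReal 0 1) = m * ∫ x, x ^ (m - 1) ∂(gaussianReal 0 1) := by
  have h := integral_eq_zero_of_hasDerivAt_of_integrable (hasDerivAt_pow_mul_density m)
    (integrable_deriv_pow_mul_density m) (integrable_pow_mul_density m)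
  rw [← integral_gaussian_eq, integral_sub ((integrable_pow_gaussian _).const_mul _)
    (integrable_pow_gaussian _), integral_const_mul] at h
  linarith

/-- The integrand is minus the derivative of x^m φ(x), which vanishes at infinity. The cases m = 0
and m = 2 yield the Hermite coefficients of the threshold strategy. -/
theorem integral_Ioi_pow_density (m : ℕ) (c : ℝ) :
    ∫ x in Set.Ioi c, stdNormalDensity x * (x ^ (m + 1) - m * x ^ (m - 1)) =
      c ^ m * stdNormalDensity c := by
  have hd := fun x (_ : x ∈ Set.Ioi c) => hasDerivAt_pow_mul_density m x
  have h := integral_Ioi_of_hasDerivAt_of_tendsto'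
    (fun x (_ : x ∈ Set.Ici c) => hasDerivAt_pow_mul_density m x)
    (integrable_deriv_pow_mul_density m).integrableOn
    (tendsto_zero_of_hasDerivAt_of_integrableOn_Ioi hd
      (integrable_deriv_pow_mul_density m).integrableOn
      (integrable_pow_mul_density m).integrableOn)
  have h2 := congrArg Neg.neg h
  rw [← integral_neg] at h2
  rw [zero_sub, neg_neg] at h2
  rw [← h2]
  congr 1; ext x; ring

theorem gaussian_moments :
    (∫ _x : ℝ, (1 : ℝ) ∂(gaussianReal 0 1)) = 1 ∧ (∫ x, x ∂(gaussianReal 0 1)) = 0 ∧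
    (∫ x, x ^ 2 ∂(gaussianReal 0 1)) = 1 ∧ (∫ x, x ^ 3 ∂(gaussianReal 0 1)) = 0 ∧
    (∫ x, x ^ 4 ∂(gaussianReal 0 1)) = 3 ∧ (∫ x, x ^ 5 ∂(gaussianReal 0 1)) = 0 ∧
    (∫ x, x ^ 6 ∂(gaussianReal 0 1)) = 15 := by
  have h1 := integral_pow_succ_gaussian 1
  have h2 := integral_pow_succ_gaussian 2
  have h3 := integral_pow_succ_gaussian 3
  have h4 := integral_pow_succ_gaussian 4
  have h5 := integral_pow_succ_gaussian 5
  norm_num at h1 h2 h3 h4 h5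
  rw [h1] at h3
  rw [h2] at h4
  rw [h3] at h5
  norm_num at h3 h4 h5
  simp [h1, h2, h3, h4, h5]

/-! ### Hermite polynomials of degree at most three -/

/-- The Hermite polynomial `He_k` as a function. -/
noncomputable def hermiteFun (k : ℕ) (x : ℝ) : ℝ := Polynomial.aeval x (Polynomial.hermite k)

theorem hermiteFun_zero (x : ℝ) : hermiteFun 0 x = 1 := by simp [hermiteFun]

theorem hermiteFun_one (x : ℝ) : hermiteFun 1 x = x := by simp [hermiteFun]

theorem hermiteFun_two (x : ℝ) : hermiteFun 2 x = x ^ 2 - 1 := by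
  simp [hermiteFun, Polynomial.hermite_succ]; ring

theorem hermiteFun_three (x : ℝ) : hermiteFun 3 x = x ^ 3 - 3 * x := by
  simp [hermiteFun, Polynomial.hermite_succ]; ring

theorem hermiteFun_continuous (k : ℕ) : Continuous (hermiteFun k) := by
  unfold hermiteFun; fun_prop

theorem integrable_polynomial_gaussian (p : Polynomial ℝ) :
    Integrable (fun x => p.eval x) (gaussianReal 0 1) := by
  simp_rw [Polynomial.eval_eq_sum_range]
  exact integrable_finsetSum _ fun i _ => (integrable_pow_gaussian i).const_mul _

theorem hermiteFun_eq_eval (k : ℕ) (x : ℝ) :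
    hermiteFun k x = ((Polynomial.hermite k).map (Int.castRingHom ℝ)).eval x := by
  rw [hermiteFun, Polynomial.eval_map, Polynomial.aeval_def]; rfl

theorem integrable_hermiteFun_mul (j k : ℕ) :
    Integrable (fun x => hermiteFun j x * hermiteFun k x) (gaussianReal 0 1) := by
  simp_rw [hermiteFun_eq_eval, ← Polynomial.eval_mul]
  exact integrable_polynomial_gaussian _

theorem integral_polynomial_six (a b c d e f g : ℝ) :
    ∫ x, (a + b * x + c * x ^ 2 + d * x ^ 3 + e * x ^ 4 + f * x ^ 5 + g * x ^ 6)
      ∂(gaussianReal 0 1) = a + c + 3 * e + 15 * g := by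
  obtain ⟨m0, m1, m2, m3, m4, m5, m6⟩ := gaussian_moments
  have i := integrable_pow_gaussian
  have i1 : Integrable (fun x : ℝ => x) (gaussianReal 0 1) := by simpa using i 1
  have J0 : Integrable (fun x : ℝ => a + b * x) (gaussianReal 0 1) :=
    (integrable_const a).add (i1.const_mul b)
  have J2 := J0.fun_add ((i 2).const_mul c)
  have J3 := J2.fun_add ((i 3).const_mul d)
  have J4 := J3.fun_add ((i 4).const_mul e)
  have J5 := J4.fun_add ((i 5).const_mul f)
  rw [integral_add J5 ((i 6).const_mul g), integral_add J4 ((i 5).const_mul f),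
    integral_add J3 ((i 4).const_mul e), integral_add J2 ((i 3).const_mul d),
    integral_add J0 ((i 2).const_mul c), integral_add (integrable_const a) (i1.const_mul b)]
  have e1 : ∫ x, b * x ∂(gaussianReal 0 1) = 0 := by rw [integral_const_mul, m1, mul_zero]
  simp only [e1, integral_const_mul, m2, m3, m4, m5, m6, integral_const, probReal_univ, smul_eq_mul]
  ring

/-- Only Π_1 and Π_3 enter the game, so degrees up to three suffice and orthogonality reduces to the
moments of order at most six. -/
theorem integral_hermiteFun_mul {j k : ℕ} (hj : j ≤ 3) (hk : k ≤ 3) :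
    ∫ x, hermiteFun j x * hermiteFun k x ∂(gaussianReal 0 1) =
      if j = k then (j.factorial : ℝ) else 0 := by
  have key : ∀ a b c d e f g v : ℝ, (∀ x, hermiteFun j x * hermiteFun k x =
      a + b * x + c * x ^ 2 + d * x ^ 3 + e * x ^ 4 + f * x ^ 5 + g * x ^ 6) →
      a + c + 3 * e + 15 * g = v →
      ∫ x, hermiteFun j x * hermiteFun k x ∂(gaussianReal 0 1) = v := by
    intro a b c d e f g v h hv
    simp_rw [h]
    rw [integral_polynomial_six, hv]
  interval_cases j <;> interval_cases k <;>
    simp only [hermiteFun_zero, hermiteFun_one, hermiteFun_two, hermiteFun_three] at key ⊢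
  · exact key 1 0 0 0 0 0 0 _ (fun x => by ring) (by norm_num)
  · exact key 0 1 0 0 0 0 0 _ (fun x => by ring) (by norm_num)
  · exact key (-1) 0 1 0 0 0 0 _ (fun x => by ring) (by norm_num)
  · exact key 0 (-3) 0 1 0 0 0 _ (fun x => by ring) (by norm_num)
  · exact key 0 1 0 0 0 0 0 _ (fun x => by ring) (by norm_num)
  · exact key 0 0 1 0 0 0 0 _ (fun x => by ring) (by norm_num)
  · exact key 0 (-1) 0 1 0 0 0 _ (fun x => by ring) (by norm_num)
  · exact key 0 0 (-3) 0 1 0 0 _ (fun x => by ring) (by norm_num)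
  · exact key (-1) 0 1 0 0 0 0 _ (fun x => by ring) (by norm_num)
  · exact key 0 (-1) 0 1 0 0 0 _ (fun x => by ring) (by norm_num)
  · exact key 1 0 (-2) 0 1 0 0 _ (fun x => by ring) (by norm_num [Nat.factorial])
  · exact key 0 3 0 (-4) 0 1 0 _ (fun x => by ring) (by norm_num)
  · exact key 0 (-3) 0 1 0 0 0 _ (fun x => by ring) (by norm_num)
  · exact key 0 0 (-3) 0 1 0 0 _ (fun x => by ring) (by norm_num)
  · exact key 0 3 0 (-4) 0 1 0 _ (fun x => by ring) (by norm_num)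
  · exact key 0 0 9 0 (-6) 0 1 _ (fun x => by ring) (by norm_num [Nat.factorial])

/-! ### Numerical bounds for the Davie–Reeds constants -/

theorem inv_sqrt_two_pi_bounds :
    0.3989422 < (Real.sqrt (2 * Real.pi))⁻¹ ∧ (Real.sqrt (2 * Real.pi))⁻¹ < 0.3989423 := by
  have hp : (0 : ℝ) < Real.sqrt (2 * Real.pi) := Real.sqrt_pos.2 (by positivity)
  have h1 := Real.pi_gt_d20
  have h2 := Real.pi_lt_d20
  constructor
  · rw [lt_inv_comm₀ (by norm_num) hp, Real.sqrt_lt' (by norm_num)]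
    norm_num at h2 ⊢; linarith
  · rw [inv_lt_comm₀ hp (by norm_num), Real.lt_sqrt (by norm_num)]
    norm_num at h1 ⊢; linarith

/-- The constants 2/9 = 4/(3!·3) and 5/96 = 5/(4!·4) are those of the Taylor remainder bound
`Real.exp_bound` with three and four terms. -/
theorem exp_neg_bounds {u : ℝ} (h0 : 0 ≤ u) (h1 : u ≤ 1) :
    (1 - u + u ^ 2 / 2 - u ^ 3 * (2 / 9) ≤ Real.exp (-u) ∧
      Real.exp (-u) ≤ 1 - u + u ^ 2 / 2 + u ^ 3 * (2 / 9)) ∧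
    (1 - u + u ^ 2 / 2 - u ^ 3 / 6 - u ^ 4 * (5 / 96) ≤ Real.exp (-u) ∧
      Real.exp (-u) ≤ 1 - u + u ^ 2 / 2 - u ^ 3 / 6 + u ^ 4 * (5 / 96)) := by
  have ha : |-u| ≤ 1 := by rwa [abs_neg, abs_of_nonneg h0]
  have b3 := abs_le.1 (Real.exp_bound ha (n := 3) (by norm_num))
  have b4 := abs_le.1 (Real.exp_bound ha (n := 4) (by norm_num))
  simp only [abs_neg, abs_of_nonneg h0, Finset.sum_range_succ, Finset.sum_range_zero] at b3 b4
  norm_num [Nat.factorial] at b3 b4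
  refine ⟨⟨?_, ?_⟩, ?_, ?_⟩ <;> nlinarith [b3.1, b3.2, b4.1, b4.2]

theorem integral_density_bounds {c : ℝ} (h0 : 0 ≤ c) (h1 : c ≤ 1) :
    (Real.sqrt (2 * Real.pi))⁻¹ * (c - c ^ 3 / 6 + c ^ 5 / 40 - c ^ 7 / 252) ≤
      (∫ t in (0 : ℝ)..c, stdNormalDensity t) ∧
    (∫ t in (0 : ℝ)..c, stdNormalDensity t) ≤
      (Real.sqrt (2 * Real.pi))⁻¹ * (c - c ^ 3 / 6 + c ^ 5 / 40 + c ^ 7 / 252) := by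
  have hr : (0 : ℝ) ≤ (Real.sqrt (2 * Real.pi))⁻¹ := by positivity
  have hpoly : ∀ s : ℝ, ∫ t in (0 : ℝ)..c,
      (Real.sqrt (2 * Real.pi))⁻¹ * (1 - t ^ 2 / 2 + t ^ 4 / 8 + s * t ^ 6 / 36) =
      (Real.sqrt (2 * Real.pi))⁻¹ * (c - c ^ 3 / 6 + c ^ 5 / 40 + s * c ^ 7 / 252) := by
    intro s
    have hd : ∀ t ∈ Set.uIcc 0 c, HasDerivAt (fun t : ℝ => (Real.sqrt (2 * Real.pi))⁻¹ *
        (t - t ^ 3 / 6 + t ^ 5 / 40 + s * t ^ 7 / 252))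
        ((Real.sqrt (2 * Real.pi))⁻¹ * (1 - t ^ 2 / 2 + t ^ 4 / 8 + s * t ^ 6 / 36)) t := by
      intro t _
      refine (((((hasDerivAt_id t).sub ((hasDerivAt_pow 3 t).div_const 6)).add
        ((hasDerivAt_pow 5 t).div_const 40)).add
        (((hasDerivAt_pow 7 t).const_mul s).div_const 252)).const_mul _).congr_deriv ?_
      norm_num
      left; ring
    rw [intervalIntegral.integral_eq_sub_of_hasDerivAt hd
      (Continuous.intervalIntegrable (by fun_prop) _ _)]
    ring
  have hb : ∀ t ∈ Set.Icc 0 c, (Real.sqrt (2 * Real.pi))⁻¹ *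
      (1 - t ^ 2 / 2 + t ^ 4 / 8 + (-1) * t ^ 6 / 36) ≤ stdNormalDensity t ∧ stdNormalDensity t ≤
      (Real.sqrt (2 * Real.pi))⁻¹ * (1 - t ^ 2 / 2 + t ^ 4 / 8 + 1 * t ^ 6 / 36) := by
    intro t ht
    obtain ⟨⟨e1, e2⟩, -⟩ := exp_neg_bounds (u := t ^ 2 / 2) (by positivity)
      (by nlinarith [ht.1, ht.2])
    rw [stdNormalDensity_eq, neg_div]
    constructor <;> refine mul_le_mul_of_nonneg_left ?_ hr <;> linarith
  have hi := stdNormalDensity_continuous.intervalIntegrable (μ := volume) 0 c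
  constructor
  · have := intervalIntegral.integral_mono_on h0
      (Continuous.intervalIntegrable (by fun_prop) _ _) hi fun t ht => (hb t ht).1
    rw [hpoly] at this
    linarith
  · have := intervalIntegral.integral_mono_on h0 hi
      (Continuous.intervalIntegrable (by fun_prop) _ _) fun t ht => (hb t ht).2
    rw [hpoly] at this
    linarith

theorem stdNormalDensity_sq (c : ℝ) :
    stdNormalDensity c ^ 2 = (Real.sqrt (2 * Real.pi))⁻¹ ^ 2 * Real.exp (-c ^ 2) := by
  rw [stdNormalDensity_eq, mul_pow, ← Real.exp_nat_mul]
  congr 2; push_cast; ring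

theorem continuous_stdNormalCDF_neg : Continuous fun c => stdNormalCDF (-c) := by
  simp_rw [stdNormalCDF_neg]
  exact continuous_const.sub (intervalIntegral.continuous_primitive
    (fun a b => stdNormalDensity_continuous.intervalIntegrable a b) 0)

theorem davieReedsC_mem_and_eq : davieReedsC ∈ Set.Ioo (0 : ℝ) 1 ∧
    4 * stdNormalDensity davieReedsC ^ 2 - 4 * stdNormalCDF (-davieReedsC) + 1 = 0 :=
  existsUnique_davieReedsC.choose_spec.1

/-- The defining function changes sign between the two decimals, and uniqueness of its root
identifies the crossing with `davieReedsC`. -/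
theorem davieReedsC_bounds : 0.2557 < davieReedsC ∧ davieReedsC < 0.25575 := by
  set H : ℝ → ℝ := fun C => 4 * stdNormalDensity C ^ 2 - 4 * stdNormalCDF (-C) + 1 with hH
  have hcont : Continuous H :=
    (((stdNormalDensity_continuous.pow 2).const_mul 4).sub
      (continuous_stdNormalCDF_neg.const_mul 4)).add continuous_const
  obtain ⟨r1, r2⟩ := inv_sqrt_two_pi_bounds
  have hr0 : (0 : ℝ) < (Real.sqrt (2 * Real.pi))⁻¹ := by linarith
  have ha : H 0.2557 < 0 := by
    obtain ⟨-, -, e⟩ := exp_neg_bounds (u := (0.2557 : ℝ) ^ 2) (by norm_num) (by norm_num)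
    have i := (integral_density_bounds (c := 0.2557) (by norm_num) (by norm_num)).2
    simp only [hH, stdNormalCDF_neg, stdNormalDensity_sq]
    have hsq : (Real.sqrt (2 * Real.pi))⁻¹ ^ 2 ≤ 0.3989423 ^ 2 :=
      pow_le_pow_left₀ hr0.le r2.le 2
    have := mul_le_mul hsq e (Real.exp_pos _).le (by norm_num)
    norm_num at this i r2 ⊢
    linarith
  have hb : 0 < H 0.25575 := by
    obtain ⟨-, e, -⟩ := exp_neg_bounds (u := (0.25575 : ℝ) ^ 2) (by norm_num) (by norm_num)
    have i := (integral_density_bounds (c := 0.25575) (by norm_num) (by norm_num)).1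
    simp only [hH, stdNormalCDF_neg, stdNormalDensity_sq]
    have hsq : 0.3989422 ^ 2 ≤ (Real.sqrt (2 * Real.pi))⁻¹ ^ 2 :=
      pow_le_pow_left₀ (by norm_num) r1.le 2
    have := mul_le_mul hsq e (by norm_num) (by positivity)
    norm_num at this i r1 ⊢
    linarith
  obtain ⟨c, hc, hc0⟩ := intermediate_value_Ioo (by norm_num : (0.2557 : ℝ) ≤ 0.25575)
    hcont.continuousOn ⟨ha, hb⟩
  have : davieReedsC = c := existsUnique_davieReedsC.unique davieReedsC_mem_and_eq
    ⟨⟨by linarith [hc.1], by linarith [hc.2]⟩, hc0⟩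
  rw [this]; exact hc

theorem stdNormalDensity_davieReedsC_sq_bounds :
    0.149076 < stdNormalDensity davieReedsC ^ 2 ∧ stdNormalDensity davieReedsC ^ 2 < 0.149084 := by
  obtain ⟨c1, c2⟩ := davieReedsC_bounds
  obtain ⟨r1, r2⟩ := inv_sqrt_two_pi_bounds
  have hr0 : (0 : ℝ) < (Real.sqrt (2 * Real.pi))⁻¹ := by linarith
  rw [stdNormalDensity_sq]
  have hsq2 : (Real.sqrt (2 * Real.pi))⁻¹ ^ 2 ≤ 0.3989423 ^ 2 := pow_le_pow_left₀ hr0.le r2.le 2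
  have hsq1 : 0.3989422 ^ 2 ≤ (Real.sqrt (2 * Real.pi))⁻¹ ^ 2 :=
    pow_le_pow_left₀ (by norm_num) r1.le 2
  constructor
  · obtain ⟨-, e, -⟩ := exp_neg_bounds (u := (0.25575 : ℝ) ^ 2) (by norm_num) (by norm_num)
    have h : Real.exp (-(0.25575 : ℝ) ^ 2) ≤ Real.exp (-davieReedsC ^ 2) :=
      Real.exp_le_exp.2 (by nlinarith)
    have := mul_le_mul hsq1 (e.trans h) (by norm_num) (by positivity)
    norm_num at this ⊢
    linarith
  · obtain ⟨-, -, e⟩ := exp_neg_bounds (u := (0.2557 : ℝ) ^ 2) (by norm_num) (by norm_num)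
    have h : Real.exp (-davieReedsC ^ 2) ≤ Real.exp (-(0.2557 : ℝ) ^ 2) :=
      Real.exp_le_exp.2 (by nlinarith)
    have := mul_le_mul hsq2 (h.trans e) (Real.exp_pos _).le (by norm_num)
    norm_num at this ⊢
    linarith

theorem stdNormalDensity_davieReedsC_bounds :
    0.3861 < stdNormalDensity davieReedsC ∧ stdNormalDensity davieReedsC < 0.38612 := by
  obtain ⟨h1, h2⟩ := stdNormalDensity_davieReedsC_sq_bounds
  have := stdNormalDensity_pos davieReedsC
  constructor <;> nlinarith

/-- The root equation says 4Φ(-C*) - 1 = 4φ(C*)², so the denominator factors as 4φ(C*)²(1 - λ*). -/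
theorem davieReedsConstant_eq :
    davieReedsConstant = 1 / (4 * stdNormalDensity davieReedsC ^ 2) := by
  have h := davieReedsC_mem_and_eq.2
  obtain ⟨h1, -⟩ := stdNormalDensity_davieReedsC_sq_bounds
  obtain ⟨c1, c2⟩ := davieReedsC_bounds
  obtain ⟨d1, d2⟩ := stdNormalDensity_davieReedsC_bounds
  have hl : davieReedsLambda < 1 := by unfold davieReedsLambda; nlinarith
  have : 4 * stdNormalCDF (-davieReedsC) - 1 = 4 * stdNormalDensity davieReedsC ^ 2 := by linarith
  rw [davieReedsConstant, this, ← one_sub_mul]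
  have h0 : 1 - davieReedsLambda ≠ 0 := by linarith
  have h3 : 4 * stdNormalDensity davieReedsC ^ 2 ≠ 0 := by positivity
  field_simp

theorem davieReedsConstant_bounds :
    1.6769 < davieReedsConstant ∧ davieReedsConstant < 1.677 := by
  obtain ⟨h1, h2⟩ := stdNormalDensity_davieReedsC_sq_bounds
  have h3 : 0 < 4 * stdNormalDensity davieReedsC ^ 2 := by positivity
  rw [davieReedsConstant_eq, lt_div_iff₀ h3, div_lt_iff₀ h3]
  constructor <;> linarith

/-! ### Bessel's inequality for vector-valued functions -/

section Bessel

variable {Ω : Type*} [MeasurableSpace Ω] {μ : Measure Ω} {H : Type*} [NormedAddCommGroup H]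
  [InnerProductSpace ℝ H]

theorem MeasureTheory.MemLp.integrable_inner_two {f g : Ω → H} (hf : MemLp f 2 μ)
    (hg : MemLp g 2 μ) : Integrable (fun x => inner ℝ (f x) (g x)) μ := by
  have h1 := (memLp_two_iff_integrable_sq_norm hf.1).1 hf
  have h2 := (memLp_two_iff_integrable_sq_norm hg.1).1 hg
  refine (h1.add h2).mono' (hf.1.inner hg.1) (ae_of_all _ fun x => ?_)
  have := norm_inner_le_norm (𝕜 := ℝ) (f x) (g x)
  simp only [Pi.add_apply]
  nlinarith [sq_nonneg (‖f x‖ - ‖g x‖), sq_nonneg (‖f x‖ + ‖g x‖)]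

theorem MeasureTheory.MemLp.integrable_smul_two {ψ : Ω → ℝ} {f : Ω → H} (hψ : MemLp ψ 2 μ)
    (hf : MemLp f 2 μ) : Integrable (fun x => ψ x • f x) μ :=
  memLp_one_iff_integrable.1 (hf.smul hψ)

/-- Expand 0 ≤ 𝔼‖F - ∑ t_a ψ_a c_a‖². The choice t_a = 1/W_a is the usual Bessel inequality; leaving
t free also covers the case where only an upper bound for W_a is known, which may itself vanish. -/
theorem bessel_aux {ι : Type*} [DecidableEq ι] [CompleteSpace H] (s : Finset ι)
    {ψ : ι → Ω → ℝ} {F : Ω → H} {W : ι → ℝ} (t : ι → ℝ)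
    (hψ : ∀ a ∈ s, MemLp (ψ a) 2 μ) (hF : MemLp F 2 μ)
    (horth : ∀ a ∈ s, ∀ b ∈ s, ∫ x, ψ a x * ψ b x ∂μ = if a = b then W a else 0) :
    ∑ a ∈ s, (2 * t a - t a ^ 2 * W a) * ‖∫ x, ψ a x • F x ∂μ‖ ^ 2 ≤ ∫ x, ‖F x‖ ^ 2 ∂μ := by
  set c : ι → H := fun a => ∫ x, ψ a x • F x ∂μ with hc
  have hexp : ∀ x, ‖F x - ∑ a ∈ s, (t a * ψ a x) • c a‖ ^ 2 = ‖F x‖ ^ 2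
      - 2 * ∑ a ∈ s, t a * inner ℝ (c a) (ψ a x • F x)
      + ∑ a ∈ s, ∑ b ∈ s, (t a * t b * inner ℝ (c a) (c b)) * (ψ a x * ψ b x) := by
    intro x
    rw [norm_sub_sq_real, inner_sum, ← real_inner_self_eq_norm_sq (∑ a ∈ s, _), sum_inner]
    congr 1
    · congr 2
      refine Finset.sum_congr rfl fun a _ => ?_
      rw [inner_smul_right, inner_smul_right, real_inner_comm]; ring
    · refine Finset.sum_congr rfl fun a _ => ?_
      rw [inner_sum]
      refine Finset.sum_congr rfl fun b _ => ?_
      rw [inner_smul_left, inner_smul_right]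
      simp only [conj_trivial]
      ring
  have i1 := (memLp_two_iff_integrable_sq_norm hF.1).1 hF
  have i2 : ∀ a ∈ s, Integrable (fun x => t a * inner ℝ (c a) (ψ a x • F x)) μ := fun a ha =>
    (((hψ a ha).integrable_smul_two hF).const_inner (c a)).const_mul _
  have i3 : ∀ a ∈ s, ∀ b ∈ s, Integrable
      (fun x => (t a * t b * inner ℝ (c a) (c b)) * (ψ a x * ψ b x)) μ := fun a ha b hb =>
    (((hψ a ha).integrable_mul (hψ b hb))).const_mul _
  have h0 : 0 ≤ ∫ x, ‖F x - ∑ a ∈ s, (t a * ψ a x) • c a‖ ^ 2 ∂μ :=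
    integral_nonneg fun x => by positivity
  simp_rw [hexp] at h0
  have i12 : Integrable (fun x => ‖F x‖ ^ 2 - 2 * ∑ a ∈ s, t a * inner ℝ (c a) (ψ a x • F x)) μ :=
    i1.sub ((integrable_finsetSum _ i2).const_mul 2)
  rw [integral_add i12
      (integrable_finsetSum _ fun a ha => integrable_finsetSum _ fun b hb => i3 a ha b hb),
    integral_sub i1 ((integrable_finsetSum _ i2).const_mul 2), integral_const_mul,
    integral_finsetSum _ i2,
    integral_finsetSum _ (fun a ha => integrable_finsetSum _ fun b hb => i3 a ha b hb)] at h0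
  have e2 : ∀ a ∈ s, ∫ x, t a * inner ℝ (c a) (ψ a x • F x) ∂μ = t a * ‖c a‖ ^ 2 := by
    intro a ha
    rw [integral_const_mul, integral_inner ((hψ a ha).integrable_smul_two hF),
      ← real_inner_self_eq_norm_sq]
  have e3 : ∀ a ∈ s, ∫ x, ∑ b ∈ s, (t a * t b * inner ℝ (c a) (c b)) * (ψ a x * ψ b x) ∂μ
      = t a ^ 2 * W a * ‖c a‖ ^ 2 := by
    intro a ha
    rw [integral_finsetSum _ (i3 a ha)]
    simp_rw [integral_const_mul]
    rw [Finset.sum_eq_single a]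
    · rw [horth a ha a ha, if_pos rfl, real_inner_self_eq_norm_sq]; ring
    · intro b hb hne
      rw [horth a ha b hb, if_neg hne.symm, mul_zero]
    · exact fun h => absurd ha h
  rw [Finset.sum_congr rfl e2, Finset.sum_congr rfl e3] at h0
  have : ∑ a ∈ s, (2 * t a - t a ^ 2 * W a) * ‖c a‖ ^ 2 =
      2 * ∑ a ∈ s, t a * ‖c a‖ ^ 2 - ∑ a ∈ s, t a ^ 2 * W a * ‖c a‖ ^ 2 := by
    rw [Finset.mul_sum, ← Finset.sum_sub_distrib]
    exact Finset.sum_congr rfl fun a _ => by ring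
  linarith

end Bessel

/-! ### Hermite coefficients -/

instance stdGaussianPi_isProbabilityMeasure (n : ℕ) : IsProbabilityMeasure (stdGaussianPi n) := by
  unfold stdGaussianPi; infer_instance

theorem hermiteMulti_eq {n : ℕ} (α : Fin n → ℕ) (x : Fin n → ℝ) :
    hermiteMulti α x = ∏ i, hermiteFun (α i) (x i) := rfl

theorem hermiteMulti_continuous {n : ℕ} (α : Fin n → ℕ) : Continuous (hermiteMulti α) := by
  have : hermiteMulti α = fun x => ∏ i, hermiteFun (α i) (x i) := rfl
  rw [this]
  exact continuous_finsetProd _ fun i _ => (hermiteFun_continuous _).comp (continuous_apply i)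

theorem hermiteMulti_memLp {n : ℕ} (α : Fin n → ℕ) :
    MemLp (hermiteMulti α) 2 (stdGaussianPi n) := by
  rw [memLp_two_iff_integrable_sq (hermiteMulti_continuous α).aestronglyMeasurable]
  simp_rw [hermiteMulti_eq, ← Finset.prod_pow]
  exact Integrable.fintype_prod (f := fun i x => hermiteFun (α i) x ^ 2) fun i => by
    simpa only [sq] using integrable_hermiteFun_mul (α i) (α i)

/-- The factorial `α! = ∏ i, (α i)!` of a multi-index. -/
noncomputable def multiFactorial {n : ℕ} (α : Fin n → ℕ) : ℝ := ((∏ i, (α i).factorial : ℕ) : ℝ)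

theorem multiFactorial_pos {n : ℕ} (α : Fin n → ℕ) : 0 < multiFactorial α := by
  unfold multiFactorial
  exact_mod_cast Finset.prod_pos fun i _ => Nat.factorial_pos _

theorem integral_hermiteMulti_mul {n : ℕ} {α β : Fin n → ℕ} (hα : ∀ i, α i ≤ 3)
    (hβ : ∀ i, β i ≤ 3) :
    ∫ x, hermiteMulti α x * hermiteMulti β x ∂(stdGaussianPi n) =
      if α = β then multiFactorial α else 0 := by
  simp_rw [hermiteMulti_eq, ← Finset.prod_mul_distrib]
  rw [stdGaussianPi, integral_fintype_prod_eq_prod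
    (f := fun i x => hermiteFun (α i) x * hermiteFun (β i) x)]
  simp_rw [fun i => integral_hermiteFun_mul (hα i) (hβ i)]
  split_ifs with h
  · simp [h, multiFactorial]
  · obtain ⟨i, hi⟩ := Function.ne_iff.1 h
    exact Finset.prod_eq_zero (Finset.mem_univ i) (if_neg hi)

section HermiteForm

variable {n : ℕ} {H : Type*} [NormedAddCommGroup H] [InnerProductSpace ℝ H]

/-- The Hermite coefficient `𝔼 [He_α f]`. -/
noncomputable def hermiteCoeff (α : Fin n → ℕ) (f : (Fin n → ℝ) → H) : H :=
  ∫ y, hermiteMulti α y • f y ∂(stdGaussianPi n)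

/-- The bilinear form `𝔼 ⟨Π_k f, g⟩` in terms of Hermite coefficients. -/
noncomputable def hermiteForm (k : ℕ) (f g : (Fin n → ℝ) → H) : ℝ :=
  ∑ α ∈ Finset.piAntidiag (Finset.univ : Finset (Fin n)) k,
    (multiFactorial α)⁻¹ * inner ℝ (hermiteCoeff α f) (hermiteCoeff α g)

/-- The bilinear form `𝔼 ⟨A_{ε,λ} f, g⟩` in terms of Hermite coefficients. -/
noncomputable def gameForm (ε lam : ℝ) (f g : (Fin n → ℝ) → H) : ℝ :=
  hermiteForm 1 f g - lam * ∫ x, inner ℝ (f x) (g x) ∂(stdGaussianPi n) - ε * hermiteForm 3 f g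

theorem hermiteCoeff_integrable (α : Fin n → ℕ) {f : (Fin n → ℝ) → H}
    (hf : MemLp f 2 (stdGaussianPi n)) :
    Integrable (fun y => hermiteMulti α y • f y) (stdGaussianPi n) :=
  (hermiteMulti_memLp α).integrable_smul_two hf

theorem hermiteCoeff_add (α : Fin n → ℕ) {f g : (Fin n → ℝ) → H}
    (hf : MemLp f 2 (stdGaussianPi n)) (hg : MemLp g 2 (stdGaussianPi n)) :
    hermiteCoeff α (fun x => f x + g x) = hermiteCoeff α f + hermiteCoeff α g := by
  simp only [hermiteCoeff, smul_add]
  exact integral_add (hermiteCoeff_integrable α hf) (hermiteCoeff_integrable α hg)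

theorem hermiteCoeff_sub (α : Fin n → ℕ) {f g : (Fin n → ℝ) → H}
    (hf : MemLp f 2 (stdGaussianPi n)) (hg : MemLp g 2 (stdGaussianPi n)) :
    hermiteCoeff α (fun x => f x - g x) = hermiteCoeff α f - hermiteCoeff α g := by
  simp only [hermiteCoeff, smul_sub]
  exact integral_sub (hermiteCoeff_integrable α hf) (hermiteCoeff_integrable α hg)

theorem hermiteProj_eq (k : ℕ) (f : (Fin n → ℝ) → H) (x : Fin n → ℝ) :
    hermiteProj k f x = ∑ α ∈ Finset.piAntidiag (Finset.univ : Finset (Fin n)) k,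
      (hermiteMulti α x / multiFactorial α) • hermiteCoeff α f := rfl

theorem hermiteProj_memLp (k : ℕ) (f : (Fin n → ℝ) → H) :
    MemLp (hermiteProj k f) 2 (stdGaussianPi n) := by
  have : hermiteProj k f = fun x => ∑ α ∈ Finset.piAntidiag (Finset.univ : Finset (Fin n)) k,
      (hermiteMulti α x / multiFactorial α) • hermiteCoeff α f := rfl
  rw [this]
  refine memLp_finsetSum _ fun α _ => ?_
  have h : MemLp (fun x => hermiteMulti α x / multiFactorial α) 2 (stdGaussianPi n) := by
    simpa only [div_eq_inv_mul] using (hermiteMulti_memLp α).const_mul _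
  exact (memLp_top_const (hermiteCoeff α f)).smul h

theorem integral_inner_hermiteProj [CompleteSpace H] (k : ℕ) (f : (Fin n → ℝ) → H)
    {g : (Fin n → ℝ) → H} (hg : MemLp g 2 (stdGaussianPi n)) :
    ∫ x, inner ℝ (hermiteProj k f x) (g x) ∂(stdGaussianPi n) = hermiteForm k f g := by
  have h : ∀ x, inner ℝ (hermiteProj k f x) (g x) =
      ∑ α ∈ Finset.piAntidiag (Finset.univ : Finset (Fin n)) k,
        (multiFactorial α)⁻¹ * inner ℝ (hermiteCoeff α f) (hermiteMulti α x • g x) := by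
    intro x
    rw [hermiteProj_eq, sum_inner]
    refine Finset.sum_congr rfl fun α _ => ?_
    rw [inner_smul_left, inner_smul_right, conj_trivial]
    ring
  simp_rw [h]
  rw [integral_finsetSum _ fun α _ =>
    ((hermiteCoeff_integrable α hg).const_inner _).const_mul _]
  refine Finset.sum_congr rfl fun α _ => ?_
  rw [integral_const_mul, integral_inner (hermiteCoeff_integrable α hg)]
  rfl

theorem integral_inner_perturbedGame [CompleteSpace H] (ε lam : ℝ) {f g : (Fin n → ℝ) → H}
    (hf : MemLp f 2 (stdGaussianPi n)) (hg : MemLp g 2 (stdGaussianPi n)) :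
    ∫ x, inner ℝ (perturbedGame ε lam f x) (g x) ∂(stdGaussianPi n) = gameForm ε lam f g := by
  simp only [perturbedGame, inner_sub_left, inner_smul_left, conj_trivial]
  have i1 := (hermiteProj_memLp 1 f).integrable_inner_two hg
  have i3 := (hermiteProj_memLp 3 f).integrable_inner_two hg
  have i2 := hf.integrable_inner_two hg
  have i12 : Integrable (fun x => inner ℝ (hermiteProj 1 f x) (g x) - lam * inner ℝ (f x) (g x))
    (stdGaussianPi n) := i1.sub (i2.const_mul _)
  rw [integral_sub i12 (i3.const_mul _), integral_sub i1 (i2.const_mul _),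
    integral_const_mul, integral_const_mul, integral_inner_hermiteProj 1 f hg,
    integral_inner_hermiteProj 3 f hg]
  rfl

theorem integral_perturbedGame_mul (ε lam : ℝ) {f g : (Fin n → ℝ) → ℝ}
    (hf : MemLp f 2 (stdGaussianPi n)) (hg : MemLp g 2 (stdGaussianPi n)) :
    ∫ x, perturbedGame ε lam f x * g x ∂(stdGaussianPi n) = gameForm ε lam f g := by
  rw [← integral_inner_perturbedGame ε lam hf hg]
  congr 1; ext x
  simp [mul_comm]

theorem le_three_of_mem_piAntidiag {k : ℕ} (hk : k ≤ 3) {α : Fin n → ℕ}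
    (h : α ∈ Finset.piAntidiag (Finset.univ : Finset (Fin n)) k) (i : Fin n) : α i ≤ 3 := by
  have := (Finset.mem_piAntidiag.1 h).1
  have h2 := Finset.single_le_sum (f := α) (fun _ _ => Nat.zero_le _) (Finset.mem_univ i)
  exact h2.trans (this.trans_le hk)

theorem hermite_bessel [CompleteSpace H] (s : Finset (Fin n → ℕ)) (hs : ∀ α ∈ s, ∀ i, α i ≤ 3)
    {f : (Fin n → ℝ) → H} (hf : MemLp f 2 (stdGaussianPi n)) :
    ∑ α ∈ s, (multiFactorial α)⁻¹ * ‖hermiteCoeff α f‖ ^ 2 ≤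
      ∫ x, ‖f x‖ ^ 2 ∂(stdGaussianPi n) := by
  have h := bessel_aux s (fun α => (multiFactorial α)⁻¹) (fun α _ => hermiteMulti_memLp α) hf
    fun α ha β hb => integral_hermiteMulti_mul (hs α ha) (hs β hb)
  refine le_trans (le_of_eq (Finset.sum_congr rfl fun α _ => ?_)) h
  have := (multiFactorial_pos α).ne'
  rw [hermiteCoeff]
  field_simp
  ring

theorem hermiteForm_self_eq (k : ℕ) (f : (Fin n → ℝ) → H) :
    hermiteForm k f f = ∑ α ∈ Finset.piAntidiag (Finset.univ : Finset (Fin n)) k,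
      (multiFactorial α)⁻¹ * ‖hermiteCoeff α f‖ ^ 2 := by
  simp [hermiteForm]

theorem hermiteForm_self_nonneg (k : ℕ) (f : (Fin n → ℝ) → H) : 0 ≤ hermiteForm k f f := by
  rw [hermiteForm_self_eq]
  exact Finset.sum_nonneg fun α _ => mul_nonneg (inv_nonneg.2 (multiFactorial_pos α).le)
    (by positivity)

theorem hermiteForm_self_le [CompleteSpace H] {k : ℕ} (hk : k ≤ 3) {f : (Fin n → ℝ) → H}
    (hf : MemLp f 2 (stdGaussianPi n)) :
    hermiteForm k f f ≤ ∫ x, ‖f x‖ ^ 2 ∂(stdGaussianPi n) := by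
  rw [hermiteForm_self_eq]
  exact hermite_bessel _ (fun α h i => le_three_of_mem_piAntidiag hk h i) hf

/-- Bessel's inequality for both degrees together: a unit-sphere strategy with almost all of its
mass in degree one has almost no cubic part. -/
theorem hermiteForm_one_add_three_le [CompleteSpace H] {f : (Fin n → ℝ) → H}
    (hf : MemLp f 2 (stdGaussianPi n)) :
    hermiteForm 1 f f + hermiteForm 3 f f ≤ ∫ x, ‖f x‖ ^ 2 ∂(stdGaussianPi n) := by
  rw [hermiteForm_self_eq, hermiteForm_self_eq, ← Finset.sum_union]
  · refine hermite_bessel _ (fun α h i => ?_) hf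
    rcases Finset.mem_union.1 h with h | h
    · exact le_three_of_mem_piAntidiag (by norm_num) h i
    · exact le_three_of_mem_piAntidiag le_rfl h i
  · rw [Finset.disjoint_left]
    intro α h1 h3
    have := (Finset.mem_piAntidiag.1 h1).1
    have := (Finset.mem_piAntidiag.1 h3).1
    omega

/-- The cross terms cancel because the form is symmetric. This separates the contributions of (f +
g)/2 and (f - g)/2. -/
theorem hermiteForm_add_sub (k : ℕ) {h g : (Fin n → ℝ) → H}
    (hh : MemLp h 2 (stdGaussianPi n)) (hg : MemLp g 2 (stdGaussianPi n)) :
    hermiteForm k (fun x => h x + g x) (fun x => h x - g x) =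
      hermiteForm k h h - hermiteForm k g g := by
  simp only [hermiteForm, ← Finset.sum_sub_distrib, ← mul_sub]
  refine Finset.sum_congr rfl fun α _ => ?_
  rw [hermiteCoeff_add α hh hg, hermiteCoeff_sub α hh hg, inner_add_left, inner_sub_right,
    inner_sub_right, real_inner_comm (hermiteCoeff α h) (hermiteCoeff α g)]
  ring

theorem abs_hermiteForm_le [CompleteSpace H] {k : ℕ} (hk : k ≤ 3) {f g : (Fin n → ℝ) → H}
    (hf : MemLp f 2 (stdGaussianPi n)) (hg : MemLp g 2 (stdGaussianPi n)) :
    |hermiteForm k f g| ≤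
      ((∫ x, ‖f x‖ ^ 2 ∂(stdGaussianPi n)) + ∫ x, ‖g x‖ ^ 2 ∂(stdGaussianPi n)) / 2 := by
  have h1 := hermiteForm_self_le hk hf
  have h2 := hermiteForm_self_le hk hg
  have : |hermiteForm k f g| ≤ (hermiteForm k f f + hermiteForm k g g) / 2 := by
    rw [hermiteForm_self_eq, hermiteForm_self_eq, ← Finset.sum_add_distrib, Finset.sum_div]
    refine (Finset.abs_sum_le_sum_abs _ _).trans (Finset.sum_le_sum fun α _ => ?_)
    rw [abs_mul, abs_of_pos (inv_pos.2 (multiFactorial_pos α)), ← mul_add, mul_div_assoc]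
    refine mul_le_mul_of_nonneg_left ?_ (inv_pos.2 (multiFactorial_pos α)).le
    have := abs_real_inner_le_norm (hermiteCoeff α f) (hermiteCoeff α g)
    nlinarith [sq_nonneg (‖hermiteCoeff α f‖ - ‖hermiteCoeff α g‖)]
  linarith

end HermiteForm

theorem memLp_of_norm_eq_one {n : ℕ} {H : Type*} [NormedAddCommGroup H]
    {f : (Fin n → ℝ) → H} (hf : StronglyMeasurable f)
    (h1 : ∀ x, ‖f x‖ = 1) : MemLp f 2 (stdGaussianPi n) :=
  MemLp.of_bound hf.aestronglyMeasurable 1 (ae_of_all _ fun x => (h1 x).le)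

theorem integral_norm_sq_of_norm_eq_one {n : ℕ} {H : Type*} [NormedAddCommGroup H]
    {f : (Fin n → ℝ) → H} (h1 : ∀ x, ‖f x‖ = 1) :
    ∫ x, ‖f x‖ ^ 2 ∂(stdGaussianPi n) = 1 := by
  simp [h1]

/-! ### The kernels of `Π_1` and `Π_3` and rotation invariance -/

/-- Splitting off one coordinate turns the sum over multi-indices into a convolution in the degree,
as for a product of generating functions. -/
theorem sum_piAntidiag_cons_prod {ι R : Type*} [DecidableEq ι] [CommSemiring R] (c : ι → ℕ → R)
    {i : ι} {s : Finset ι} (hi : i ∉ s) (k : ℕ) :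
    ∑ α ∈ Finset.piAntidiag (Finset.cons i s hi) k, ∏ j ∈ Finset.cons i s hi, c j (α j) =
      ∑ p ∈ Finset.HasAntidiagonal.antidiagonal k,
        c i p.1 * ∑ α ∈ Finset.piAntidiag s p.2, ∏ j ∈ s, c j (α j) := by
  rw [Finset.piAntidiag_cons, Finset.sum_disjiUnion]
  refine Finset.sum_congr rfl fun p _ => ?_
  rw [Finset.sum_map, Finset.mul_sum]
  refine Finset.sum_congr rfl fun α hα => ?_
  have h0 : α i = 0 := by
    by_contra h
    exact hi ((Finset.mem_piAntidiag.1 hα).2 i h)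
  rw [Finset.prod_cons]
  congr 1
  · simp [h0]
  · refine Finset.prod_congr rfl fun j hj => ?_
    have : j ≠ i := fun h => hi (h ▸ hj)
    simp [this]

/-- The kernels depend on x and y only through ⟨x, y⟩, ‖x‖² and ‖y‖², which is what makes Π_1 and
Π_3 commute with rotations. Degrees 0 and 2 are carried along because the convolution recursion for
degree 3 needs them. -/
theorem hermite_kernel_finset {ι : Type*} [DecidableEq ι] (x y : ι → ℝ) (s : Finset ι) :
    let E : ℕ → ℝ := fun k => ∑ α ∈ Finset.piAntidiag s k,
      ∏ j ∈ s, (hermiteFun (α j) (x j) * hermiteFun (α j) (y j) / (α j).factorial)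
    let S := ∑ i ∈ s, x i * y i
    let X := ∑ i ∈ s, x i ^ 2
    let Y := ∑ i ∈ s, y i ^ 2
    E 0 = 1 ∧ E 1 = S ∧ E 2 = (S ^ 2 - X - Y + s.card) / 2 ∧
      E 3 = (S ^ 3 - 3 * S * X - 3 * S * Y + (3 * s.card + 6) * S) / 6 := by
  induction s using Finset.cons_induction with
  | empty => simp
  | cons i s hi ih =>
    obtain ⟨h0, h1, h2, h3⟩ := ih
    beta_reduce at h0 h1 h2 h3
    have hrec := sum_piAntidiag_cons_prod
      (fun j k => hermiteFun k (x j) * hermiteFun k (y j) / (k.factorial : ℝ)) hi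
    have a0 : Finset.HasAntidiagonal.antidiagonal 0 = {((0, 0) : ℕ × ℕ)} := rfl
    have a1 : Finset.HasAntidiagonal.antidiagonal 1 = {((0, 1) : ℕ × ℕ), (1, 0)} := rfl
    have a2 : Finset.HasAntidiagonal.antidiagonal 2 = {((0, 2) : ℕ × ℕ), (1, 1), (2, 0)} := rfl
    have a3 : Finset.HasAntidiagonal.antidiagonal 3 = {((0, 3) : ℕ × ℕ), (1, 2), (2, 1), (3, 0)} := rfl
    refine ⟨?_, ?_, ?_, ?_⟩
    · beta_reduce; rw [hrec, a0]
      simp only [Finset.sum_singleton, h0, hermiteFun_zero]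
      norm_num
    · beta_reduce; rw [hrec, a1, Finset.sum_pair (by decide)]
      simp only [h0, h1, hermiteFun_zero, hermiteFun_one, Finset.sum_cons]
      norm_num; ring
    · beta_reduce; rw [hrec, a2, Finset.sum_insert (by decide), Finset.sum_pair (by decide)]
      simp only [h0, h1, h2, hermiteFun_zero, hermiteFun_one, hermiteFun_two, Finset.sum_cons,
        Finset.card_cons]
      norm_num [Nat.factorial]; ring
    · beta_reduce; rw [hrec, a3, Finset.sum_insert (by decide), Finset.sum_insert (by decide),
        Finset.sum_pair (by decide)]
      simp only [h0, h1, h2, h3, hermiteFun_zero, hermiteFun_one, hermiteFun_two, hermiteFun_three,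
        Finset.sum_cons, Finset.card_cons]
      norm_num [Nat.factorial]; ring

theorem integral_finsetSum_smul {Ω ι G : Type*} [MeasurableSpace Ω] {μ : Measure Ω}
    [NormedAddCommGroup G] [NormedSpace ℝ G] (s : Finset ι) (c : ι → ℝ) {F : ι → Ω → G}
    (hF : ∀ i ∈ s, Integrable (F i) μ) :
    ∫ x, ∑ i ∈ s, c i • F i x ∂μ = ∑ i ∈ s, c i • ∫ x, F i x ∂μ := by
  have h : ∀ i ∈ s, Integrable (fun x => c i • F i x) μ := fun i hi => (hF i hi).smul _
  rw [integral_finsetSum s h]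
  simp_rw [integral_smul]

section Kernel

variable {n : ℕ}

/-- The reproducing kernel of the degree-`k` Hermite space. -/
noncomputable def hermiteKernel (k : ℕ) (x y : Fin n → ℝ) : ℝ :=
  ∑ α ∈ Finset.piAntidiag (Finset.univ : Finset (Fin n)) k,
    hermiteMulti α x / multiFactorial α * hermiteMulti α y

theorem hermiteKernel_eq_sum_prod (k : ℕ) (x y : Fin n → ℝ) :
    hermiteKernel k x y = ∑ α ∈ Finset.piAntidiag (Finset.univ : Finset (Fin n)) k,
      ∏ j, (hermiteFun (α j) (x j) * hermiteFun (α j) (y j) / (α j).factorial) := by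
  refine Finset.sum_congr rfl fun α _ => ?_
  rw [Finset.prod_div_distrib, Finset.prod_mul_distrib, ← hermiteMulti_eq, ← hermiteMulti_eq,
    multiFactorial]
  push_cast
  ring

theorem hermiteKernel_one (x y : Fin n → ℝ) : hermiteKernel 1 x y = ∑ i, x i * y i := by
  rw [hermiteKernel_eq_sum_prod]
  exact (hermite_kernel_finset x y Finset.univ).2.1

theorem hermiteKernel_three (x y : Fin n → ℝ) : hermiteKernel 3 x y =
    ((∑ i, x i * y i) ^ 3 - 3 * (∑ i, x i * y i) * (∑ i, x i ^ 2)
      - 3 * (∑ i, x i * y i) * (∑ i, y i ^ 2) + (3 * n + 6) * ∑ i, x i * y i) / 6 := by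
  rw [hermiteKernel_eq_sum_prod]
  simpa using (hermite_kernel_finset x y Finset.univ).2.2.2

variable {H : Type*} [NormedAddCommGroup H] [InnerProductSpace ℝ H]

theorem hermiteProj_eq_integral_kernel (k : ℕ) {f : (Fin n → ℝ) → H}
    (hf : MemLp f 2 (stdGaussianPi n)) (x : Fin n → ℝ) :
    hermiteProj k f x = ∫ y, hermiteKernel k x y • f y ∂(stdGaussianPi n) := by
  simp only [hermiteKernel, Finset.sum_smul, mul_smul]
  rw [integral_finsetSum_smul _ _ fun α _ => hermiteCoeff_integrable α hf]
  rfl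

theorem eval_memLp (i : Fin n) : MemLp (fun x : Fin n → ℝ => x i) 2 (stdGaussianPi n) := by
  rw [memLp_two_iff_integrable_sq (continuous_apply i).aestronglyMeasurable]
  exact integrable_comp_eval (X := fun _ : Fin n => ℝ) (i := i) (f := fun x : ℝ => x ^ 2)
    (integrable_pow_gaussian 2)

/-- The first moments `𝔼 [x_i f(x)]`. -/
noncomputable def coordCoeff (i : Fin n) (f : (Fin n → ℝ) → H) : H :=
  ∫ y, y i • f y ∂(stdGaussianPi n)

theorem coordCoeff_integrable (i : Fin n) {f : (Fin n → ℝ) → H}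
    (hf : MemLp f 2 (stdGaussianPi n)) : Integrable (fun y => y i • f y) (stdGaussianPi n) :=
  (eval_memLp i).integrable_smul_two hf

/-- The kernel ∑ x_i y_i of Π_1 gives the expansion in coordinates directly, without matching
multi-indices of degree one with coordinates. -/
theorem hermiteForm_one_eq [CompleteSpace H] {f g : (Fin n → ℝ) → H}
    (hf : MemLp f 2 (stdGaussianPi n)) (hg : MemLp g 2 (stdGaussianPi n)) :
    hermiteForm 1 f g = ∑ i, inner ℝ (coordCoeff i f) (coordCoeff i g) := by
  rw [← integral_inner_hermiteProj 1 f hg]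
  have h : ∀ x, inner ℝ (hermiteProj 1 f x) (g x) =
      ∑ i, inner ℝ (coordCoeff i f) (x i • g x) := by
    intro x
    rw [hermiteProj_eq_integral_kernel 1 hf]
    simp only [hermiteKernel_one, Finset.sum_smul, mul_smul]
    rw [integral_finsetSum_smul _ _ fun i _ => coordCoeff_integrable i hf, sum_inner]
    refine Finset.sum_congr rfl fun i _ => ?_
    rw [inner_smul_left, inner_smul_right]
    rfl
  simp_rw [h]
  rw [integral_finsetSum _ fun i _ => (coordCoeff_integrable i hg).const_inner _]
  refine Finset.sum_congr rfl fun i _ => ?_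
  rw [integral_inner (coordCoeff_integrable i hg)]
  rfl

/-- The action of an orthogonal transformation on `Fin n → ℝ`. -/
noncomputable def rotate (L : EuclideanSpace ℝ (Fin n) ≃ₗᵢ[ℝ] EuclideanSpace ℝ (Fin n))
    (x : Fin n → ℝ) : Fin n → ℝ := WithLp.ofLp (L (WithLp.toLp 2 x))

variable (L : EuclideanSpace ℝ (Fin n) ≃ₗᵢ[ℝ] EuclideanSpace ℝ (Fin n))

theorem rotate_continuous : Continuous (rotate L) := by
  unfold rotate
  exact (PiLp.continuous_ofLp 2 _).comp (L.continuous.comp (PiLp.continuous_toLp 2 _))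

theorem rotate_injective : Function.Injective (rotate L) := fun _ _ h =>
  WithLp.toLp_injective 2 (L.injective (WithLp.ofLp_injective 2 h))

theorem rotate_measurableEmbedding : MeasurableEmbedding (rotate L) :=
  (rotate_continuous L).measurableEmbedding (rotate_injective L)

theorem rotate_measurePreserving :
    MeasurePreserving (rotate L) (stdGaussianPi n) (stdGaussianPi n) := by
  refine ⟨(rotate_continuous L).measurable, ?_⟩
  have h1 : (stdGaussianPi n).map (WithLp.toLp 2) = stdGaussian (EuclideanSpace ℝ (Fin n)) :=
    map_pi_eq_stdGaussian
  have h2 : (stdGaussian (EuclideanSpace ℝ (Fin n))).map WithLp.ofLp = stdGaussianPi n := by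
    rw [← h1, Measure.map_map (PiLp.continuous_ofLp 2 _).measurable
      (PiLp.continuous_toLp 2 _).measurable]
    exact Measure.map_id
  have h3 : rotate L = WithLp.ofLp ∘ L ∘ WithLp.toLp 2 := rfl
  rw [h3, ← Measure.map_map (PiLp.continuous_ofLp 2 _).measurable
    (L.continuous.measurable.comp (PiLp.continuous_toLp 2 _).measurable),
    ← Measure.map_map L.continuous.measurable (PiLp.continuous_toLp 2 _).measurable, h1,
    stdGaussian_map, h2]

theorem integral_comp_rotate {G : Type*} [NormedAddCommGroup G] [NormedSpace ℝ G]
    (f : (Fin n → ℝ) → G) :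
    ∫ x, f (rotate L x) ∂(stdGaussianPi n) = ∫ x, f x ∂(stdGaussianPi n) :=
  (rotate_measurePreserving L).integral_comp (rotate_measurableEmbedding L) f

theorem sum_rotate_mul (x y : Fin n → ℝ) :
    ∑ i, rotate L x i * rotate L y i = ∑ i, x i * y i := by
  have h := L.inner_map_map (WithLp.toLp 2 y) (WithLp.toLp 2 x)
  simp only [PiLp.inner_apply, RCLike.inner_apply, conj_trivial] at h
  exact h

theorem hermiteKernel_rotate {k : ℕ} (hk : k = 1 ∨ k = 3) (x y : Fin n → ℝ) :
    hermiteKernel k (rotate L x) (rotate L y) = hermiteKernel k x y := by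
  have hsq : ∀ z : Fin n → ℝ, ∑ i, rotate L z i ^ 2 = ∑ i, z i ^ 2 := fun z => by
    simpa only [sq] using sum_rotate_mul L z z
  rcases hk with rfl | rfl
  · simp only [hermiteKernel_one, sum_rotate_mul]
  · simp only [hermiteKernel_three, sum_rotate_mul, hsq]

theorem memLp_comp_rotate {G : Type*} [NormedAddCommGroup G] {f : (Fin n → ℝ) → G} (hf : MemLp f 2 (stdGaussianPi n)) :
    MemLp (fun x => f (rotate L x)) 2 (stdGaussianPi n) :=
  hf.comp_measurePreserving (rotate_measurePreserving L)

theorem hermiteProj_comp_rotate {k : ℕ} (hk : k = 1 ∨ k = 3) {f : (Fin n → ℝ) → H}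
    (hf : MemLp f 2 (stdGaussianPi n)) (x : Fin n → ℝ) :
    hermiteProj k (fun z => f (rotate L z)) x = hermiteProj k f (rotate L x) := by
  rw [hermiteProj_eq_integral_kernel k (memLp_comp_rotate L hf),
    hermiteProj_eq_integral_kernel k hf,
    ← integral_comp_rotate L fun y => hermiteKernel k (rotate L x) y • f y]
  simp_rw [hermiteKernel_rotate L hk]

theorem hermiteForm_comp_rotate [CompleteSpace H] {k : ℕ} (hk : k = 1 ∨ k = 3)
    {f g : (Fin n → ℝ) → H} (hf : MemLp f 2 (stdGaussianPi n)) (hg : MemLp g 2 (stdGaussianPi n)) :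
    hermiteForm k (fun z => f (rotate L z)) (fun z => g (rotate L z)) = hermiteForm k f g := by
  rw [← integral_inner_hermiteProj k _ (memLp_comp_rotate L hg),
    ← integral_inner_hermiteProj k _ hg]
  simp_rw [hermiteProj_comp_rotate L hk hf]
  exact integral_comp_rotate L fun x => inner ℝ (hermiteProj k f x) (g x)

theorem gameForm_comp_rotate [CompleteSpace H] (ε lam : ℝ)
    {f g : (Fin n → ℝ) → H} (hf : MemLp f 2 (stdGaussianPi n)) (hg : MemLp g 2 (stdGaussianPi n)) :
    gameForm ε lam (fun z => f (rotate L z)) (fun z => g (rotate L z)) = gameForm ε lam f g := by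
  rw [gameForm, gameForm, hermiteForm_comp_rotate L (Or.inl rfl) hf hg,
    hermiteForm_comp_rotate L (Or.inr rfl) hf hg,
    integral_comp_rotate L fun x => inner ℝ (f x) (g x)]

theorem coordCoeff_comp_rotate {f : (Fin n → ℝ) → ℝ} (hf : MemLp f 2 (stdGaussianPi n))
    (i : Fin n) : coordCoeff i (fun z => f (rotate L z)) =
      L.symm (WithLp.toLp 2 fun j => coordCoeff j f) i := by
  have h1 : coordCoeff i (fun z => f (rotate L z)) =
      ∫ y, rotate L.symm y i • f y ∂(stdGaussianPi n) := by
    rw [← integral_comp_rotate L, coordCoeff]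
    simp [rotate]
  have h2 : ∀ y : Fin n → ℝ, L.symm (WithLp.toLp 2 y) i =
      ∑ j, L (EuclideanSpace.single i 1) j * y j := by
    intro y
    have := L.inner_map_map (EuclideanSpace.single i (1 : ℝ)) (L.symm (WithLp.toLp 2 y))
    rw [L.apply_symm_apply, EuclideanSpace.inner_single_left] at this
    simp only [conj_trivial, one_mul] at this
    rw [← this, PiLp.inner_apply]
    simp [mul_comm]
  rw [h1]
  simp only [rotate, h2, Finset.sum_smul, mul_smul]
  rw [integral_finsetSum_smul _ _ fun j _ => coordCoeff_integrable j hf]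
  rfl

theorem exists_rotate_coordCoeff (i₀ : Fin n) {f : (Fin n → ℝ) → ℝ}
    (hf : MemLp f 2 (stdGaussianPi n)) :
    ∃ L : EuclideanSpace ℝ (Fin n) ≃ₗᵢ[ℝ] EuclideanSpace ℝ (Fin n),
      0 ≤ coordCoeff i₀ (fun z => f (rotate L z)) ∧
      ∀ i ≠ i₀, coordCoeff i (fun z => f (rotate L z)) = 0 := by
  set a : EuclideanSpace ℝ (Fin n) := WithLp.toLp 2 fun j => coordCoeff j f with ha
  set b : EuclideanSpace ℝ (Fin n) := EuclideanSpace.single i₀ ‖a‖ with hb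
  have hn : ‖a‖ = ‖b‖ := by simp [hb]
  -- Since ‖a‖ = ‖b‖, the reflection in the hyperplane orthogonal to a - b exchanges a and b; for a
  -- = b it is the identity.
  set L := (ℝ ∙ (a - b))ᗮ.reflection with hL
  have h : L.symm a = b := by
    rw [hL, Submodule.reflection_symm]
    exact Submodule.reflection_sub hn
  refine ⟨L, ?_, fun i hi => ?_⟩
  · rw [coordCoeff_comp_rotate L hf, ← ha, h]; simp [hb]
  · rw [coordCoeff_comp_rotate L hf, ← ha, h]; simp [hb, hi]

end Kernel

/-! ### The optimal Davie–Reeds strategy in one dimension -/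

/-- The sign of `x` where `|x| > c`, and zero elsewhere. -/
noncomputable def tailSign (c x : ℝ) : ℝ := if c < x then 1 else if x < -c then -1 else 0

theorem tailSign_measurable (c : ℝ) : Measurable (tailSign c) :=
  Measurable.ite measurableSet_Ioi measurable_const
    (Measurable.ite measurableSet_Iio measurable_const measurable_const)

theorem abs_tailSign_le (c x : ℝ) : |tailSign c x| ≤ 1 := by
  unfold tailSign; split_ifs <;> simp

theorem tailSign_eq_indicator {c : ℝ} (hc : 0 ≤ c) (g : ℝ → ℝ) (x : ℝ) :
    g x * tailSign c x = (Set.Ioi c).indicator g x - (Set.Iio (-c)).indicator g x := by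
  unfold tailSign
  by_cases h1 : c < x
  · have h2 : ¬ x < -c := by linarith
    simp [h1, h2]
  · by_cases h2 : x < -c <;> simp [h1, h2]

theorem tailSign_sq_eq_indicator {c : ℝ} (hc : 0 ≤ c) (x : ℝ) :
    tailSign c x ^ 2 = (Set.Ioi c).indicator 1 x + (Set.Iio (-c)).indicator 1 x := by
  unfold tailSign
  by_cases h1 : c < x
  · have h2 : ¬ x < -c := by linarith
    simp [h1, h2]
  · by_cases h2 : x < -c <;> simp [h1, h2]

theorem stdNormalDensity_neg (x : ℝ) : stdNormalDensity (-x) = stdNormalDensity x := by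
  simp [stdNormalDensity_eq]

theorem integral_mul_tailSign {c : ℝ} (hc : 0 ≤ c) {g : ℝ → ℝ} (hodd : ∀ x, g (-x) = -g x)
    (hg : Integrable g (gaussianReal 0 1)) :
    ∫ x, g x * tailSign c x ∂(gaussianReal 0 1) =
      2 * ∫ x in Set.Ioi c, stdNormalDensity x * g x := by
  have hi := (integrable_gaussian_iff g).1 hg
  rw [integral_gaussian_eq]
  have h : ∀ x, stdNormalDensity x * (g x * tailSign c x) =
      (Set.Ioi c).indicator (fun x => stdNormalDensity x * g x) x -
        (Set.Iio (-c)).indicator (fun x => stdNormalDensity x * g x) x := by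
    intro x
    rw [← tailSign_eq_indicator hc]; ring
  simp_rw [h]
  rw [integral_sub (hi.indicator measurableSet_Ioi) (hi.indicator measurableSet_Iio),
    integral_indicator measurableSet_Ioi, integral_indicator measurableSet_Iio,
    ← integral_Iic_eq_integral_Iio]
  have h2 := integral_comp_neg_Iic (-c) fun x => stdNormalDensity x * g x
  simp only [stdNormalDensity_neg, hodd, mul_neg, neg_neg, integral_neg] at h2
  linarith

theorem integral_tailSign_sq {c : ℝ} (hc : 0 ≤ c) :
    ∫ x, tailSign c x ^ 2 ∂(gaussianReal 0 1) = 2 * stdNormalCDF (-c) := by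
  have hi := stdNormalDensity_integrable
  rw [integral_gaussian_eq]
  have h : ∀ x, stdNormalDensity x * tailSign c x ^ 2 =
      (Set.Ioi c).indicator stdNormalDensity x + (Set.Iio (-c)).indicator stdNormalDensity x := by
    intro x
    rw [tailSign_sq_eq_indicator hc]
    simp only [Set.indicator_apply, Pi.one_apply]
    split_ifs <;> ring
  simp_rw [h]
  rw [integral_add (hi.indicator measurableSet_Ioi) (hi.indicator measurableSet_Iio),
    integral_indicator measurableSet_Ioi, integral_indicator measurableSet_Iio,
    ← integral_Iic_eq_integral_Iio]
  have h2 := integral_comp_neg_Iic (-c) stdNormalDensity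
  simp only [stdNormalDensity_neg, neg_neg] at h2
  rw [← h2, stdNormalCDF]
  ring

theorem integrable_id_gaussian : Integrable (fun x : ℝ => x) (gaussianReal 0 1) := by
  simpa using integrable_pow_gaussian 1

theorem integral_id_mul_tailSign {c : ℝ} (hc : 0 ≤ c) :
    ∫ x, x * tailSign c x ∂(gaussianReal 0 1) = 2 * stdNormalDensity c := by
  rw [integral_mul_tailSign (g := fun x => x) hc (fun _ => rfl) integrable_id_gaussian]
  have := integral_Ioi_pow_density 0 c
  simp at this
  rw [this]

theorem integral_hermiteFun_three_mul_tailSign {c : ℝ} (hc : 0 ≤ c) :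
    ∫ x, hermiteFun 3 x * tailSign c x ∂(gaussianReal 0 1) =
      2 * stdNormalDensity c * (c ^ 2 - 1) := by
  -- Both summands have the shape integrated by `integral_Ioi_pow_density`, with m = 2 and m = 0.
  have h0 : ∀ x, hermiteFun 3 x = (x ^ 3 - 2 * x) - x := fun x => by
    rw [hermiteFun_three]; ring
  have hx := integrable_id_gaussian
  have h1 : Integrable (fun x : ℝ => x ^ 3 - 2 * x) (gaussianReal 0 1) :=
    (integrable_pow_gaussian 3).sub (hx.const_mul 2)
  rw [integral_mul_tailSign hc (fun x => by simp only [hermiteFun_three]; ring)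
    (by rw [show hermiteFun 3 = fun x => (x ^ 3 - 2 * x) - x from funext h0]; exact h1.sub hx)]
  have a := integral_Ioi_pow_density 0 c
  have b := integral_Ioi_pow_density 2 c
  simp at a b
  have j1 : Integrable fun x : ℝ => stdNormalDensity x * (x ^ 3 - 2 * x) :=
    (integrable_gaussian_iff _).1 h1
  have j2 : Integrable fun x : ℝ => stdNormalDensity x * x := (integrable_gaussian_iff _).1 hx
  have e : ∀ x : ℝ, stdNormalDensity x * hermiteFun 3 x =
      stdNormalDensity x * (x ^ 3 - 2 * x) - stdNormalDensity x * x :=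
    fun x => by rw [h0]; ring
  simp_rw [e]
  rw [integral_sub j1.integrableOn j2.integrableOn, a, b]
  ring

/-! ### Bounds for `sdp` and a strategy for `val` -/

section Strategies

variable {n : ℕ}

/-- With ρ = 𝔼⟨f, g⟩, the degree-one term is at most 𝔼‖(f + g)/2‖² = (1 + ρ)/2. The total is then at
most 1/2 + (1/2 - λ)ρ, which for λ ≤ 1/2 is largest at ρ = 1. -/
theorem gameForm_zero_le {H : Type*} [NormedAddCommGroup H] [InnerProductSpace ℝ H]
    [CompleteSpace H] {lam : ℝ} (hl : lam ≤ 1 / 2) {f g : (Fin n → ℝ) → H}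
    (hf : StronglyMeasurable f) (hg : StronglyMeasurable g) (hf1 : ∀ x, ‖f x‖ = 1)
    (hg1 : ∀ x, ‖g x‖ = 1) : gameForm 0 lam f g ≤ 1 - lam := by
  have mf := memLp_of_norm_eq_one hf hf1
  have mg := memLp_of_norm_eq_one hg hg1
  set h : (Fin n → ℝ) → H := fun x => (1 / 2 : ℝ) • (f x + g x) with hh
  set k : (Fin n → ℝ) → H := fun x => (1 / 2 : ℝ) • (f x - g x) with hk
  have mh : MemLp h 2 (stdGaussianPi n) := (mf.add mg).const_smul _
  have mk : MemLp k 2 (stdGaussianPi n) := (mf.sub mg).const_smul _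
  have ef : f = fun x => h x + k x := by ext x; simp only [hh, hk]; module
  have eg : g = fun x => h x - k x := by ext x; simp only [hh, hk]; module
  have hfg := mf.integrable_inner_two mg
  have e1 : hermiteForm 1 f g = hermiteForm 1 h h - hermiteForm 1 k k := by
    conv_lhs => rw [ef, eg]
    exact hermiteForm_add_sub 1 mh mk
  have e2 := hermiteForm_self_le (k := 1) (by norm_num) mh
  have e3 := hermiteForm_self_nonneg 1 k
  have e4 : ∫ x, ‖h x‖ ^ 2 ∂(stdGaussianPi n) =
      1 / 2 + 1 / 2 * ∫ x, inner ℝ (f x) (g x) ∂(stdGaussianPi n) := by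
    have : ∀ x, ‖h x‖ ^ 2 = 1 / 2 + 1 / 2 * inner ℝ (f x) (g x) := by
      intro x
      rw [hh, norm_smul, mul_pow, norm_add_sq_real, hf1, hg1]
      norm_num
      ring
    simp_rw [this]
    rw [integral_add (integrable_const _) (hfg.const_mul _), integral_const_mul]
    simp
  have e5 : ∫ x, inner ℝ (f x) (g x) ∂(stdGaussianPi n) ≤ 1 := by
    have := integral_mono hfg (integrable_const (1 : ℝ)) (μ := stdGaussianPi n) fun x => by
      have := real_inner_le_norm (f x) (g x)
      rwa [hf1, hg1, one_mul] at this
    simpa using this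
  rw [gameForm]
  nlinarith

/-- A crude bound, uniform in the Hilbert space; it makes the supremum `gameSdp` one over a bounded
set. -/
theorem gameForm_le_of_norm_eq_one {H : Type*} [NormedAddCommGroup H] [InnerProductSpace ℝ H]
    [CompleteSpace H] (ε lam : ℝ) {f g : (Fin n → ℝ) → H}
    (hf : StronglyMeasurable f) (hg : StronglyMeasurable g) (hf1 : ∀ x, ‖f x‖ = 1)
    (hg1 : ∀ x, ‖g x‖ = 1) : gameForm ε lam f g ≤ 1 + |lam| + |ε| := by
  have mf := memLp_of_norm_eq_one hf hf1
  have mg := memLp_of_norm_eq_one hg hg1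
  have a1 := abs_hermiteForm_le (k := 1) (by norm_num) mf mg
  have a3 := abs_hermiteForm_le (k := 3) le_rfl mf mg
  rw [integral_norm_sq_of_norm_eq_one hf1, integral_norm_sq_of_norm_eq_one hg1] at a1 a3
  have a2 : |∫ x, inner ℝ (f x) (g x) ∂(stdGaussianPi n)| ≤ 1 := by
    have := norm_integral_le_of_norm_le_const (μ := stdGaussianPi n) (C := 1)
      (f := fun x => inner ℝ (f x) (g x)) (ae_of_all _ fun x => by
        have := norm_inner_le_norm (𝕜 := ℝ) (f x) (g x)
        rwa [hf1, hg1, one_mul] at this)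
    simpa using this
  have b2 : -(lam * ∫ x, inner ℝ (f x) (g x) ∂(stdGaussianPi n)) ≤ |lam| := by
    refine (neg_le_abs _).trans ?_
    rw [abs_mul]
    exact mul_le_of_le_one_right (abs_nonneg _) a2
  have b3 : -(ε * hermiteForm 3 f g) ≤ |ε| := by
    refine (neg_le_abs _).trans ?_
    rw [abs_mul]
    exact mul_le_of_le_one_right (abs_nonneg _) (by linarith)
  have b1 := le_abs_self (hermiteForm 1 f g)
  rw [gameForm]
  linarith

theorem hermiteMulti_single (i : Fin n) (k : ℕ) (x : Fin n → ℝ) :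
    hermiteMulti (Pi.single i k) x = hermiteFun k (x i) := by
  rw [hermiteMulti_eq, Finset.prod_eq_single i]
  · simp
  · intro j _ hj
    simp [hj, hermiteFun_zero]
  · simp

theorem multiFactorial_single (i : Fin n) (k : ℕ) :
    multiFactorial (Pi.single i k : Fin n → ℕ) = k.factorial := by
  rw [multiFactorial, Finset.prod_eq_single i]
  · simp
  · intro j _ hj
    simp [hj]
  · simp

theorem single_le_three (i : Fin n) {k : ℕ} (hk : k ≤ 3) (j : Fin n) :
    (Pi.single i k : Fin n → ℕ) j ≤ 3 := by
  by_cases h : j = i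
  · subst h; simpa using hk
  · simp [h]

theorem integral_sum_sq_sub_one :
    ∫ x : Fin n → ℝ, ∑ i, (x i ^ 2 - 1 : ℝ) ∂(stdGaussianPi n) = 0 ∧
    ∫ x : Fin n → ℝ, (∑ i, (x i ^ 2 - 1)) ^ 2 ∂(stdGaussianPi n) = 2 * (n : ℝ) ∧
    MemLp (fun x : Fin n → ℝ => ∑ i, (x i ^ 2 - 1)) 2 (stdGaussianPi n) := by
  have h : ∀ (i : Fin n) (x : Fin n → ℝ), x i ^ 2 - 1 = hermiteMulti (Pi.single i 2) x :=
    fun i x => by rw [hermiteMulti_single, hermiteFun_two]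
  have hm : MemLp (fun x : Fin n → ℝ => ∑ i, (x i ^ 2 - 1)) 2 (stdGaussianPi n) := by
    simp_rw [h]
    exact memLp_finsetSum _ fun i _ => hermiteMulti_memLp _
  refine ⟨?_, ?_, hm⟩
  · simp_rw [h]
    rw [integral_finsetSum _ fun i _ => (hermiteMulti_memLp _).integrable (by norm_num)]
    refine Finset.sum_eq_zero fun i _ => ?_
    have := integral_hermiteMulti_mul (single_le_three i (k := 2) (by norm_num))
      (single_le_three i (k := 0) (by norm_num))
    rw [if_neg] at this
    · simp_rw [hermiteMulti_single i 0, hermiteFun_zero, mul_one] at this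
      exact this
    · intro h
      have := congrFun h i
      simp at this
  · simp_rw [h]
    simp only [sq, Finset.sum_mul_sum]
    have hi : ∀ i j : Fin n, Integrable (fun x : Fin n → ℝ => hermiteMulti (Pi.single i 2) x *
        hermiteMulti (Pi.single j 2) x) (stdGaussianPi n) := fun i j =>
      (hermiteMulti_memLp _).integrable_mul (hermiteMulti_memLp _)
    rw [integral_finsetSum _ fun i _ => integrable_finsetSum _ fun j _ => hi i j]
    have : ∀ i : Fin n, ∫ x : Fin n → ℝ, ∑ j, hermiteMulti (Pi.single i 2) x *
        hermiteMulti (Pi.single j 2) x ∂(stdGaussianPi n) = 2 := by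
      intro i
      rw [integral_finsetSum _ fun j _ => hi i j, Finset.sum_eq_single i]
      · rw [integral_hermiteMulti_mul (single_le_three i (by norm_num))
          (single_le_three i (by norm_num)), if_pos rfl, multiFactorial_single]
        norm_num
      · intro j _ hj
        rw [integral_hermiteMulti_mul (single_le_three i (by norm_num))
          (single_le_three j (by norm_num)), if_neg]
        intro h
        have := congrFun h i
        simp [hj.symm] at this
      · simp
    simp_rw [this]
    simp [mul_comm]

/-- The map `x ↦ x / ‖x‖` to the unit sphere, with an arbitrary value at zero. -/
noncomputable def normalizedId (i₀ : Fin n) (x : Fin n → ℝ) : EuclideanSpace ℝ (Fin n) :=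
  if x = 0 then EuclideanSpace.single i₀ 1 else ‖WithLp.toLp 2 x‖⁻¹ • WithLp.toLp 2 x

theorem norm_normalizedId (i₀ : Fin n) (x : Fin n → ℝ) : ‖normalizedId i₀ x‖ = 1 := by
  unfold normalizedId
  split_ifs with h
  · simp
  · have : ‖WithLp.toLp 2 x‖ ≠ 0 := by simpa using h
    rw [norm_smul, norm_inv, norm_norm, inv_mul_cancel₀ this]

theorem normalizedId_measurable (i₀ : Fin n) : Measurable (normalizedId i₀) := by
  refine Measurable.ite (measurableSet_singleton 0) measurable_const ?_
  have := (PiLp.continuous_toLp 2 (fun _ : Fin n => ℝ)).measurable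
  exact this.norm.inv.smul this

theorem sum_mul_normalizedId (i₀ : Fin n) (x : Fin n → ℝ) :
    ∑ i, x i * normalizedId i₀ x i = ‖WithLp.toLp 2 x‖ := by
  unfold normalizedId
  split_ifs with h
  · simp [h]
  · have h0 : ‖WithLp.toLp 2 x‖ ≠ 0 := by simpa using h
    have : ∑ i, x i * (‖WithLp.toLp 2 x‖⁻¹ • WithLp.toLp 2 x : EuclideanSpace ℝ (Fin n)) i =
        ‖WithLp.toLp 2 x‖⁻¹ * ∑ i, x i ^ 2 := by
      rw [Finset.mul_sum]
      refine Finset.sum_congr rfl fun i _ => ?_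
      simp; ring
    have h2 := EuclideanSpace.real_norm_sq_eq (WithLp.toLp 2 x)
    simp only at h2
    rw [this, ← h2]
    field_simp

/-- For u = x/‖x‖ the diagonal entries of the first moments add up to ∑ 𝔼[x_i u_i] = 𝔼‖x‖, and
Cauchy–Schwarz over the n coordinates gives ‖Π_1 u‖² ≥ (𝔼‖x‖)²/n. Concentration of ‖x‖² yields 𝔼‖x‖
≥ √n (1 - 1/n). -/
theorem hermiteForm_one_normalizedId (i₀ : Fin n) :
    (1 - 1 / (n : ℝ)) ^ 2 ≤ hermiteForm 1 (normalizedId i₀) (normalizedId i₀) := by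
  have hn : (0 : ℝ) < n := by
    have := i₀.pos
    exact_mod_cast this
  have hn1 : (1 : ℝ) ≤ n := by
    have := i₀.pos
    exact_mod_cast this
  set u := normalizedId i₀ with hu
  have mu : MemLp u 2 (stdGaussianPi n) :=
    memLp_of_norm_eq_one (normalizedId_measurable i₀).stronglyMeasurable (norm_normalizedId i₀)
  rw [hermiteForm_one_eq mu mu]
  simp_rw [real_inner_self_eq_norm_sq]
  have h1 : ∀ i, ∫ x, x i * u x i ∂(stdGaussianPi n) ≤ ‖coordCoeff i u‖ := by
    intro i
    have h := real_inner_le_norm (EuclideanSpace.single i (1 : ℝ)) (coordCoeff i u)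
    rw [coordCoeff, ← integral_inner (coordCoeff_integrable i mu)] at h
    simpa [coordCoeff, inner_smul_right, EuclideanSpace.inner_single_left] using h
  have hi : ∀ i, Integrable (fun x => x i * u x i) (stdGaussianPi n) := by
    intro i
    have := (coordCoeff_integrable i mu).const_inner (𝕜 := ℝ) (EuclideanSpace.single i (1 : ℝ))
    simpa [inner_smul_right, EuclideanSpace.inner_single_left] using this
  have h2 : ∫ x, ‖(WithLp.toLp 2 x : EuclideanSpace ℝ (Fin n))‖ ∂(stdGaussianPi n) ≤
      ∑ i, ‖coordCoeff i u‖ := by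
    refine le_trans (le_of_eq ?_) (Finset.sum_le_sum fun i _ => h1 i)
    rw [← integral_finsetSum _ fun i _ => hi i]
    simp_rw [hu, sum_mul_normalizedId]
  have hri : Integrable (fun x : Fin n → ℝ => ‖(WithLp.toLp 2 x : EuclideanSpace ℝ (Fin n))‖)
      (stdGaussianPi n) := by
    have := integrable_finsetSum Finset.univ fun i _ => hi i
    simp_rw [hu, sum_mul_normalizedId] at this
    exact this
  obtain ⟨z1, z2, zm⟩ := integral_sum_sq_sub_one (n := n)
  set Z : (Fin n → ℝ) → ℝ := fun x => ∑ i, (x i ^ 2 - 1) with hZ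
  have hs : (0 : ℝ) < √n := Real.sqrt_pos.2 hn
  have hsq : √(n : ℝ) ^ 2 = n := Real.sq_sqrt hn.le
  -- With t = ‖x‖/√n this is t ≥ 1 + (t² - 1)/2 - (t² - 1)²/2, where the difference of the two sides
  -- is (t - 1)² t (t + 2)/2. Its expectation needs only that Z has mean 0 and variance 2n.
  have hpt : ∀ x, √n * (1 + 1 / (2 * n) * Z x - 1 / (2 * n ^ 2) * Z x ^ 2) ≤
      ‖(WithLp.toLp 2 x : EuclideanSpace ℝ (Fin n))‖ := by
    intro x
    set R := ‖(WithLp.toLp 2 x : EuclideanSpace ℝ (Fin n))‖ with hR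
    have hR2 : Z x = R ^ 2 - n := by
      rw [hR, EuclideanSpace.real_norm_sq_eq]; simp [hZ]
    obtain ⟨t, ht⟩ : ∃ t, R = √n * t := ⟨R / √n, by field_simp⟩
    have ht0 : 0 ≤ t := by
      by_contra hneg
      have : √n * t < 0 := mul_neg_of_pos_of_neg hs (not_le.1 hneg)
      linarith [norm_nonneg (WithLp.toLp 2 x : EuclideanSpace ℝ (Fin n))]
    have hZt : Z x = n * (t ^ 2 - 1) := by rw [hR2, ht, mul_pow, hsq]; ring
    rw [hZt, ht]
    refine mul_le_mul_of_nonneg_left ?_ hs.le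
    have e : 1 + 1 / (2 * (n : ℝ)) * (n * (t ^ 2 - 1)) - 1 / (2 * n ^ 2) * (n * (t ^ 2 - 1)) ^ 2 =
        1 + (t ^ 2 - 1) / 2 - (t ^ 2 - 1) ^ 2 / 2 := by field_simp
    rw [e]
    nlinarith [mul_nonneg ht0 (sq_nonneg (t - 1)), mul_nonneg (mul_nonneg ht0 ht0)
      (sq_nonneg (t - 1)), sq_nonneg (t - 1)]
  have iZ := zm.integrable (by norm_num : (1 : ENNReal) ≤ 2)
  have iZ2 := zm.integrable_sq
  have i0 : Integrable (fun x => 1 + 1 / (2 * n) * Z x) (stdGaussianPi n) :=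
    (integrable_const _).add (iZ.const_mul _)
  have i1 : Integrable (fun x => 1 + 1 / (2 * n) * Z x - 1 / (2 * n ^ 2) * Z x ^ 2)
    (stdGaussianPi n) := i0.sub (iZ2.const_mul _)
  have h3 := integral_mono (i1.const_mul √n) hri hpt
  rw [integral_const_mul, integral_sub i0 (iZ2.const_mul _), integral_add (integrable_const _)
    (iZ.const_mul _), integral_const_mul, integral_const_mul, z1, z2] at h3
  have h4 : √n * (1 - 1 / (n : ℝ)) ≤ ∑ i, ‖coordCoeff i u‖ := by
    refine le_trans (le_of_eq ?_) (h3.trans h2)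
    simp
    left
    field_simp
  have h5 : (∑ i, ‖coordCoeff i u‖) ^ 2 ≤ n * ∑ i, ‖coordCoeff i u‖ ^ 2 := by
    simpa using sq_sum_le_card_mul_sum_sq (s := Finset.univ) (f := fun i => ‖coordCoeff i u‖)
  have h6 : 0 ≤ 1 - 1 / (n : ℝ) := by
    rw [sub_nonneg, div_le_one hn]; exact hn1
  have h7 := pow_le_pow_left₀ (mul_nonneg hs.le h6) h4 2
  rw [mul_pow, hsq] at h7
  exact le_of_mul_le_mul_left (h7.trans h5) hn

/-- The cubic part is at most 1 - ‖Π_1 u‖², so the form is at least (1 + ε)‖Π_1 u‖² - ε - λ. -/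
theorem gameForm_normalizedId (i₀ : Fin n) {ε : ℝ} (hε : 0 ≤ ε) (lam : ℝ) :
    (1 + ε) * (1 - 1 / (n : ℝ)) ^ 2 - ε - lam ≤
      gameForm ε lam (normalizedId i₀) (normalizedId i₀) := by
  have mu : MemLp (normalizedId i₀) 2 (stdGaussianPi n) :=
    memLp_of_norm_eq_one (normalizedId_measurable i₀).stronglyMeasurable (norm_normalizedId i₀)
  have h1 := hermiteForm_one_normalizedId i₀
  have h2 := hermiteForm_one_add_three_le mu
  rw [integral_norm_sq_of_norm_eq_one (norm_normalizedId i₀)] at h2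
  rw [gameForm]
  simp_rw [real_inner_self_eq_norm_sq]
  rw [integral_norm_sq_of_norm_eq_one (norm_normalizedId i₀)]
  nlinarith

end Strategies

/-! ### The cubic part of functions supported in a slab -/

/-- The weight `|He_j|` restricted to the slab `|x| ≤ c`. -/
noncomputable def slabWeight (c : ℝ) (j : ℕ) (x : ℝ) : ℝ := if |x| ≤ c then |hermiteFun j x| else 0

theorem slabWeight_nonneg (c : ℝ) (j : ℕ) (x : ℝ) : 0 ≤ slabWeight c j x := by
  unfold slabWeight; split_ifs <;> simp

theorem slabWeight_le (c : ℝ) (j : ℕ) (x : ℝ) : slabWeight c j x ≤ |hermiteFun j x| := by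
  unfold slabWeight; split_ifs <;> simp

theorem measurableSet_abs_le (c : ℝ) : MeasurableSet {x : ℝ | |x| ≤ c} :=
  (isClosed_le continuous_abs continuous_const).measurableSet

theorem slabWeight_measurable (c : ℝ) (j : ℕ) : Measurable (slabWeight c j) :=
  Measurable.ite (measurableSet_abs_le c) (hermiteFun_continuous j).abs.measurable measurable_const

theorem slabWeight_integrable (c : ℝ) (j : ℕ) :
    Integrable (slabWeight c j) (gaussianReal 0 1) := by
  have h := integrable_hermiteFun_mul j 0
  simp only [hermiteFun_zero, mul_one] at h
  exact h.mono (slabWeight_measurable c j).aestronglyMeasurable (ae_of_all _ fun x => by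
    rw [Real.norm_of_nonneg (slabWeight_nonneg c j x)]
    exact slabWeight_le c j x)

section Slab

variable {n : ℕ}

/-- The factors of `√|He_j(x_{i₀})| 1_{|x_{i₀}| ≤ c} ∏_{i ≠ i₀} He_{α_i}(x_i)`. -/
noncomputable def slabFactor (c : ℝ) (j : ℕ) (i₀ : Fin n) (α : Fin n → ℕ) (i : Fin n) (x : ℝ) : ℝ :=
  if i = i₀ then √(slabWeight c j x) else hermiteFun (α i) x

theorem slabFactor_measurable (c : ℝ) (j : ℕ) (i₀ : Fin n) (α : Fin n → ℕ) (i : Fin n) :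
    Measurable (slabFactor c j i₀ α i) := by
  unfold slabFactor
  split_ifs
  · exact (slabWeight_measurable c j).sqrt
  · exact (hermiteFun_continuous _).measurable

theorem slabFactor_memLp (c : ℝ) (j : ℕ) (i₀ : Fin n) (α : Fin n → ℕ) :
    MemLp (fun x => ∏ i, slabFactor c j i₀ α i (x i)) 2 (stdGaussianPi n) := by
  rw [memLp_two_iff_integrable_sq]
  · simp_rw [← Finset.prod_pow]
    refine Integrable.fintype_prod (f := fun i x => slabFactor c j i₀ α i x ^ 2) fun i => ?_
    unfold slabFactor
    split_ifs
    · simp_rw [Real.sq_sqrt (slabWeight_nonneg c j _)]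
      exact slabWeight_integrable c j
    · simpa only [sq] using integrable_hermiteFun_mul (α i) (α i)
  · exact (Finset.measurable_prod _ fun i _ =>
      (slabFactor_measurable c j i₀ α i).comp (measurable_pi_apply i)).aestronglyMeasurable

theorem integral_slabFactor_mul (c : ℝ) {j : ℕ} (i₀ : Fin n) {α β : Fin n → ℕ}
    (hα : ∀ i, α i ≤ 3) (hβ : ∀ i, β i ≤ 3) (hαj : α i₀ = j) (hβj : β i₀ = j) :
    ∫ x, (∏ i, slabFactor c j i₀ α i (x i)) * (∏ i, slabFactor c j i₀ β i (x i))
      ∂(stdGaussianPi n) = if α = β then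
        (∫ x, slabWeight c j x ∂(gaussianReal 0 1)) * (multiFactorial α / j.factorial) else 0 := by
  simp_rw [← Finset.prod_mul_distrib]
  rw [stdGaussianPi, integral_fintype_prod_eq_prod
    (f := fun i x => slabFactor c j i₀ α i x * slabFactor c j i₀ β i x)]
  have hi₀ : ∫ x, slabFactor c j i₀ α i₀ x * slabFactor c j i₀ β i₀ x ∂(gaussianReal 0 1) =
      ∫ x, slabWeight c j x ∂(gaussianReal 0 1) := by
    simp only [slabFactor, if_true, Real.mul_self_sqrt (slabWeight_nonneg c j _)]
  have hi : ∀ i ≠ i₀, ∫ x, slabFactor c j i₀ α i x * slabFactor c j i₀ β i x ∂(gaussianReal 0 1) =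
      if α i = β i then ((α i).factorial : ℝ) else 0 := by
    intro i hne
    simp only [slabFactor, if_neg hne]
    exact integral_hermiteFun_mul (hα i) (hβ i)
  split_ifs with h
  · subst h
    rw [← Finset.mul_prod_erase _ _ (Finset.mem_univ i₀), hi₀]
    congr 1
    have h1 : multiFactorial α = (j.factorial : ℝ) *
        ∏ i ∈ Finset.univ.erase i₀, ((α i).factorial : ℝ) := by
      rw [multiFactorial, ← Finset.mul_prod_erase _ _ (Finset.mem_univ i₀), hαj]
      push_cast
      rfl
    rw [h1, mul_div_cancel_left₀ _ (by exact_mod_cast Nat.factorial_ne_zero j)]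
    refine Finset.prod_congr rfl fun i hmem => ?_
    rw [hi i (Finset.ne_of_mem_erase hmem), if_pos rfl]
  · obtain ⟨i, hne⟩ := Function.ne_iff.1 h
    have : i ≠ i₀ := by
      rintro rfl
      exact hne (hαj.trans hβj.symm)
    exact Finset.prod_eq_zero (Finset.mem_univ i) (by rw [hi i this, if_neg hne])

/-- Split He_j(x_{i₀}) on the slab as sign · √w · √w with w = |He_j|. One root joins the other
Hermite factors, and these products stay orthogonal, with squared norm 𝔼[w] α!/j!. The other root,
with the sign, joins F, giving a function of squared norm at most 𝔼[w]. Bessel's inequality then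
gains 𝔼[w] twice. -/
theorem sum_hermiteCoeff_sq_le_of_slab {c : ℝ} {j : ℕ} (i₀ : Fin n) {W : ℝ} (hW : 0 < W)
    (hjW : ∫ x, slabWeight c j x ∂(gaussianReal 0 1) ≤ W) {F : (Fin n → ℝ) → ℝ}
    (hF : Measurable F) (hF1 : ∀ x, |F x| ≤ 1) (hsupp : ∀ x, c < |x i₀| → F x = 0)
    (s : Finset (Fin n → ℕ)) (hs : ∀ α ∈ s, (∀ i, α i ≤ 3) ∧ α i₀ = j) :
    ∑ α ∈ s, (multiFactorial α)⁻¹ * hermiteCoeff α F ^ 2 ≤ W ^ 2 / j.factorial := by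
  set F' : (Fin n → ℝ) → ℝ := fun x =>
    F x * (SignType.sign (hermiteFun j (x i₀)) : ℝ) * √(slabWeight c j (x i₀)) with hF'
  set w := ∫ x, slabWeight c j x ∂(gaussianReal 0 1) with hw
  have hjf : (0 : ℝ) < j.factorial := by exact_mod_cast Nat.factorial_pos j
  have hsign : ∀ y : ℝ, |(SignType.sign y : ℝ)| ≤ 1 := by
    intro y
    rcases lt_trichotomy y 0 with h | h | h <;> simp [h]
  have hsq : ∀ x, F' x ^ 2 ≤ slabWeight c j (x i₀) := by
    intro x
    rw [hF', mul_pow, Real.sq_sqrt (slabWeight_nonneg _ _ _)]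
    refine mul_le_of_le_one_left (slabWeight_nonneg _ _ _) ?_
    rw [← sq_abs, abs_mul]
    exact pow_le_one₀ (by positivity) (mul_le_one₀ (hF1 x) (abs_nonneg _) (hsign _))
  have hsm : Measurable fun y : ℝ => (SignType.sign y : ℝ) := by
    have : (fun y : ℝ => (SignType.sign y : ℝ)) =
        fun y => if 0 < y then 1 else if y < 0 then -1 else 0 := by
      ext y
      rcases lt_trichotomy y 0 with h | h | h <;> simp [h, not_lt.2 h.le]
    rw [this]
    exact Measurable.ite measurableSet_Ioi measurable_const
      (Measurable.ite measurableSet_Iio measurable_const measurable_const)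
  have hF'm : Measurable F' :=
    (hF.mul (hsm.comp ((hermiteFun_continuous j).measurable.comp (measurable_pi_apply i₀)))).mul
      ((slabWeight_measurable c j).comp (measurable_pi_apply i₀)).sqrt
  have hwi : Integrable (fun x : Fin n → ℝ => slabWeight c j (x i₀)) (stdGaussianPi n) :=
    integrable_comp_eval (X := fun _ : Fin n => ℝ) (i := i₀) (slabWeight_integrable c j)
  have hF'2 : MemLp F' 2 (stdGaussianPi n) := by
    rw [memLp_two_iff_integrable_sq hF'm.aestronglyMeasurable]
    refine hwi.mono' (hF'm.pow_const 2).aestronglyMeasurable (ae_of_all _ fun x => ?_)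
    rw [Real.norm_of_nonneg (sq_nonneg _)]
    exact hsq x
  have hF'w : ∫ x, ‖F' x‖ ^ 2 ∂(stdGaussianPi n) ≤ w := by
    simp_rw [Real.norm_eq_abs, sq_abs]
    refine (integral_mono hF'2.integrable_sq hwi hsq).trans (le_of_eq ?_)
    exact integral_comp_eval (X := fun _ : Fin n => ℝ) (i := i₀) (f := slabWeight c j)
      (slabWeight_measurable c j).aestronglyMeasurable
  have hcoeff : ∀ α ∈ s, ∫ x, (∏ i, slabFactor c j i₀ α i (x i)) • F' x ∂(stdGaussianPi n) =
      hermiteCoeff α F := by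
    intro α hα
    refine integral_congr_ae (ae_of_all _ fun x => ?_)
    simp only [smul_eq_mul]
    rw [hermiteMulti_eq, ← Finset.mul_prod_erase _ _ (Finset.mem_univ i₀),
      ← Finset.mul_prod_erase _ (fun i => hermiteFun (α i) (x i)) (Finset.mem_univ i₀)]
    have e1 : ∏ i ∈ Finset.univ.erase i₀, slabFactor c j i₀ α i (x i) =
        ∏ i ∈ Finset.univ.erase i₀, hermiteFun (α i) (x i) :=
      Finset.prod_congr rfl fun i hi => by
        rw [slabFactor, if_neg (Finset.ne_of_mem_erase hi)]
    rw [e1, (hs α hα).2, hF', slabFactor, if_pos rfl]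
    by_cases hx : c < |x i₀|
    · simp [hsupp x hx]
    · have h2 : √(slabWeight c j (x i₀)) * √(slabWeight c j (x i₀)) = |hermiteFun j (x i₀)| := by
        rw [Real.mul_self_sqrt (slabWeight_nonneg _ _ _), slabWeight, if_pos (not_lt.1 hx)]
      have h3 := sign_mul_abs (hermiteFun j (x i₀))
      rw [← h2] at h3
      linear_combination (F x * ∏ i ∈ Finset.univ.erase i₀, hermiteFun (α i) (x i)) * h3
  -- This t would be optimal if the weight had mass exactly W. With mass w ≤ W the factor 2 - w/W ≥
  -- 1 remains, which suffices.
  have hb := bessel_aux s (fun α => (j.factorial : ℝ) / (W * multiFactorial α))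
    (fun α _ => slabFactor_memLp c j i₀ α) hF'2 fun α hα β hβ =>
      integral_slabFactor_mul c i₀ (hs α hα).1 (hs β hβ).1 (hs α hα).2 (hs β hβ).2
  have hw0 : 0 ≤ w := integral_nonneg fun x => slabWeight_nonneg c j x
  have h1 : (j.factorial : ℝ) / W * ∑ α ∈ s, (multiFactorial α)⁻¹ * hermiteCoeff α F ^ 2 ≤ W := by
    refine le_trans ?_ (hb.trans (hF'w.trans hjW))
    rw [Finset.mul_sum]
    refine Finset.sum_le_sum fun α hα => ?_
    rw [hcoeff α hα, Real.norm_eq_abs, sq_abs, ← mul_assoc]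
    refine mul_le_mul_of_nonneg_right ?_ (sq_nonneg _)
    have hm := multiFactorial_pos α
    have e : 2 * ((j.factorial : ℝ) / (W * multiFactorial α)) -
        ((j.factorial : ℝ) / (W * multiFactorial α)) ^ 2 *
          (w * (multiFactorial α / j.factorial)) =
        (j.factorial : ℝ) / W * (multiFactorial α)⁻¹ * (2 - w / W) := by
      field_simp
    rw [e]
    refine le_mul_of_one_le_right (by positivity) ?_
    have : w / W ≤ 1 := (div_le_one hW).2 hjW
    linarith
  rw [div_mul_eq_mul_div, div_le_iff₀ hW] at h1
  rw [le_div_iff₀ hjf]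
  linarith

/-- Sort the multi-indices of degree three by their exponent j at i₀. On the slab |He_2| ≤ 1 and
|He_3| ≤ 3|x|, so j = 0, 1, 2, 3 contribute at most q², v², q²/2 and (3v)²/6. -/
theorem hermiteForm_three_le_of_slab {c : ℝ} (hc : c ≤ 1) (i₀ : Fin n) {q v : ℝ} (hq : 0 < q)
    (hv : 0 < v) (hqi : ∫ x, slabWeight c 0 x ∂(gaussianReal 0 1) ≤ q)
    (hvi : ∫ x, slabWeight c 1 x ∂(gaussianReal 0 1) ≤ v) {F : (Fin n → ℝ) → ℝ}
    (hF : Measurable F) (hF1 : ∀ x, |F x| ≤ 1) (hsupp : ∀ x, c < |x i₀| → F x = 0) :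
    hermiteForm 3 F F ≤ 3 / 2 * q ^ 2 + 5 / 2 * v ^ 2 := by
  have h2 : ∫ x, slabWeight c 2 x ∂(gaussianReal 0 1) ≤ q := by
    refine (integral_mono (slabWeight_integrable c 2) (slabWeight_integrable c 0) fun x => ?_).trans
      hqi
    unfold slabWeight
    split_ifs with h
    · rw [hermiteFun_two, hermiteFun_zero, abs_one, abs_le]
      obtain ⟨h1, h2⟩ := abs_le.1 h
      constructor <;> nlinarith
    · exact le_rfl
  have h3 : ∫ x, slabWeight c 3 x ∂(gaussianReal 0 1) ≤ 3 * v := by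
    refine (integral_mono (slabWeight_integrable c 3) ((slabWeight_integrable c 1).const_mul 3)
      fun x => ?_).trans ((integral_const_mul _ _).trans_le (by linarith))
    simp only [slabWeight]
    split_ifs with h
    · rw [hermiteFun_three, hermiteFun_one, show x ^ 3 - 3 * x = x * (x ^ 2 - 3) by ring, abs_mul,
        mul_comm]
      refine mul_le_mul_of_nonneg_right ?_ (abs_nonneg _)
      obtain ⟨h1, h2⟩ := abs_le.1 h
      rw [abs_le]
      constructor <;> nlinarith
    · simp
  have key := fun (j : ℕ) (W : ℝ) (hW : 0 < W)
      (hjW : ∫ x, slabWeight c j x ∂(gaussianReal 0 1) ≤ W) =>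
    sum_hermiteCoeff_sq_le_of_slab i₀ hW hjW hF hF1 hsupp
      ((Finset.piAntidiag (Finset.univ : Finset (Fin n)) 3).filter fun α => α i₀ = j)
      fun α hα => ⟨le_three_of_mem_piAntidiag le_rfl (Finset.mem_filter.1 hα).1,
        (Finset.mem_filter.1 hα).2⟩
  have k0 := key 0 q hq hqi
  have k1 := key 1 v hv hvi
  have k2 := key 2 q hq h2
  have k3 := key 3 (3 * v) (by positivity) h3
  rw [hermiteForm_self_eq, ← Finset.sum_fiberwise_of_maps_to (s := Finset.piAntidiag _ 3)
    (t := Finset.range 4) (g := fun α => α i₀) fun α hα =>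
      Finset.mem_range_succ_iff.2 (le_three_of_mem_piAntidiag le_rfl hα i₀)]
  simp only [Finset.sum_range_succ, Finset.sum_range_zero, Real.norm_eq_abs, sq_abs]
  norm_num [Nat.factorial] at k0 k1 k2 k3
  linarith

end Slab

/-! ### Gaussian mass of slabs -/

theorem stdNormalDensity_le (x : ℝ) : stdNormalDensity x ≤ 0.4 := by
  rw [stdNormalDensity_eq]
  have h1 : Real.exp (-x ^ 2 / 2) ≤ 1 := Real.exp_le_one_iff.2 (by nlinarith [sq_nonneg x])
  have h2 := inv_sqrt_two_pi_bounds
  have h3 := mul_le_mul h2.2.le h1 (Real.exp_pos _).le (by norm_num)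
  norm_num at h3 ⊢
  linarith

theorem integral_indicator_Ioo_gaussian_le {a b : ℝ} (hab : a ≤ b) :
    ∫ x, (Set.Ioo a b).indicator 1 x ∂(gaussianReal 0 1) ≤ 0.4 * (b - a) := by
  rw [integral_gaussian_eq]
  have h : ∀ x, stdNormalDensity x * (Set.Ioo a b).indicator 1 x =
      (Set.Ioo a b).indicator stdNormalDensity x := by
    intro x; simp [Set.indicator_apply]
  simp_rw [h]
  rw [integral_indicator measurableSet_Ioo]
  refine (setIntegral_mono stdNormalDensity_integrable.integrableOn
    (integrableOn_const (by simp)) stdNormalDensity_le).trans ?_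
  rw [setIntegral_const, smul_eq_mul, Measure.real, Real.volume_Ioo,
    ENNReal.toReal_ofReal (by linarith)]
  linarith

theorem measurableSet_abs_abs_sub_lt (c s : ℝ) : MeasurableSet {x : ℝ | |(|x| - c)| < s} :=
  (isOpen_lt (by fun_prop) continuous_const).measurableSet

theorem integral_near_threshold_le (c : ℝ) {s : ℝ} (hs : 0 ≤ s) :
    ∫ x, (if |(|x| - c)| < s then 1 else 0 : ℝ) ∂(gaussianReal 0 1) ≤ 1.6 * s := by
  have hi : ∀ a b : ℝ, Integrable ((Set.Ioo a b).indicator (1 : ℝ → ℝ)) (gaussianReal 0 1) :=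
    fun a b => (integrable_const (1 : ℝ)).indicator measurableSet_Ioo
  have h1 := integral_indicator_Ioo_gaussian_le (a := c - s) (b := c + s) (by linarith)
  have h2 := integral_indicator_Ioo_gaussian_le (a := -c - s) (b := -c + s) (by linarith)
  have h3 : ∫ x, (if |(|x| - c)| < s then 1 else 0 : ℝ) ∂(gaussianReal 0 1) ≤
      ∫ x, ((Set.Ioo (c - s) (c + s)).indicator 1 x + (Set.Ioo (-c - s) (-c + s)).indicator 1 x)
        ∂(gaussianReal 0 1) := by
    refine integral_mono_of_nonneg (ae_of_all _ fun x => ?_) ((hi _ _).add (hi _ _))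
      (ae_of_all _ fun x => ?_)
    · simp only [Pi.zero_apply]; split_ifs <;> norm_num
    · have n1 : (0 : ℝ) ≤ (Set.Ioo (c - s) (c + s)).indicator 1 x :=
        Set.indicator_nonneg (fun _ _ => zero_le_one) x
      have n2 : (0 : ℝ) ≤ (Set.Ioo (-c - s) (-c + s)).indicator 1 x :=
        Set.indicator_nonneg (fun _ _ => zero_le_one) x
      simp only
      split_ifs with h
      · obtain ⟨ha, hb⟩ := abs_lt.1 h
        rcases abs_cases x with ⟨hx, _⟩ | ⟨hx, _⟩
        · have : x ∈ Set.Ioo (c - s) (c + s) := ⟨by linarith, by linarith⟩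
          rw [Set.indicator_of_mem this]
          simp only [Pi.one_apply]; linarith
        · have : x ∈ Set.Ioo (-c - s) (-c + s) := ⟨by linarith, by linarith⟩
          rw [Set.indicator_of_mem this]
          simp only [Pi.one_apply]; linarith
      · linarith
  rw [integral_add (hi _ _) (hi _ _)] at h3
  linarith

theorem slabWeight_zero_eq (c x : ℝ) :
    slabWeight c 0 x = 1 - tailSign c x ^ 2 := by
  unfold slabWeight tailSign
  rw [hermiteFun_zero, abs_one]
  by_cases h1 : c < x
  · have : ¬ |x| ≤ c := by rw [abs_le]; intro h; linarith [h.2]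
    simp [h1, this]
  · by_cases h2 : x < -c
    · have : ¬ |x| ≤ c := by rw [abs_le]; intro h; linarith [h.1]
      simp [h1, h2, this]
    · have : |x| ≤ c := abs_le.2 ⟨by linarith, by linarith⟩
      simp [h1, h2, this]

theorem tailSign_sq_integrable (c : ℝ) :
    Integrable (fun x => tailSign c x ^ 2) (gaussianReal 0 1) :=
  Integrable.of_bound ((tailSign_measurable c).pow_const 2).aestronglyMeasurable 1
    (ae_of_all _ fun x => by
      rw [norm_pow]; exact pow_le_one₀ (norm_nonneg _) (abs_tailSign_le c x))

theorem integral_slabWeight_zero {c : ℝ} (hc : 0 ≤ c) :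
    ∫ x, slabWeight c 0 x ∂(gaussianReal 0 1) = 1 - 2 * stdNormalCDF (-c) := by
  simp_rw [slabWeight_zero_eq c]
  rw [integral_sub (integrable_const _) (tailSign_sq_integrable c), integral_tailSign_sq hc]
  simp

/-- The density is at most 0.4, and |x| ≤ x²/c + c/4 replaces the absolute value by a polynomial
with integral 7c²/6 over [-c, c]. -/
theorem integral_slabWeight_one_le {c : ℝ} (hc : 0 < c) :
    ∫ x, slabWeight c 1 x ∂(gaussianReal 0 1) ≤ 0.4 * (7 / 6 * c ^ 2) := by
  rw [integral_gaussian_eq]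
  have hcont : Continuous fun x : ℝ => 0.4 * (x ^ 2 / c + c / 4) := by fun_prop
  have h1 : ∫ x, stdNormalDensity x * slabWeight c 1 x ≤
      ∫ x, (Set.Icc (-c) c).indicator (fun x : ℝ => 0.4 * (x ^ 2 / c + c / 4)) x := by
    refine integral_mono_of_nonneg (ae_of_all _ fun x =>
      mul_nonneg (stdNormalDensity_pos x).le (slabWeight_nonneg c 1 x))
      ((integrable_indicator_iff measurableSet_Icc).2
        (hcont.continuousOn.integrableOn_compact isCompact_Icc)) (ae_of_all _ fun x => ?_)
    simp only [slabWeight, hermiteFun_one]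
    split_ifs with h
    · rw [Set.indicator_of_mem (Set.mem_Icc.2 (abs_le.1 h))]
      refine mul_le_mul (stdNormalDensity_le x) ?_ (abs_nonneg x) (by norm_num)
      rw [← sq_abs, div_add' _ _ _ hc.ne', le_div_iff₀ hc]
      nlinarith [sq_nonneg (|x| - c / 2)]
    · rw [mul_zero]
      exact Set.indicator_nonneg (fun x _ => by positivity) x
  refine h1.trans (le_of_eq ?_)
  rw [integral_indicator measurableSet_Icc, integral_Icc_eq_integral_Ioc,
    ← intervalIntegral.integral_of_le (by linarith)]
  have hd : ∀ t ∈ Set.uIcc (-c) c, HasDerivAt (fun x : ℝ => 0.4 * (x ^ 3 / (3 * c) + c / 4 * x))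
      (0.4 * (t ^ 2 / c + c / 4)) t := by
    intro t _
    refine ((((hasDerivAt_pow 3 t).div_const (3 * c)).add
      ((hasDerivAt_id t).const_mul (c / 4))).const_mul 0.4).congr_deriv ?_
    norm_num
    field_simp
  rw [intervalIntegral.integral_eq_sub_of_hasDerivAt hd (hcont.intervalIntegrable _ _)]
  field_simp
  ring

/-! ### Stability of the Davie–Reeds optimum -/

/-- Over h in {0, 1, -1} the quantity x h - c h² takes the values 0, x - c and -x - c. The threshold
strategy picks the largest, and the runner-up is lower by at least ||x| - c|. -/
theorem bathtub_pointwise {c x h : ℝ} (hc : 0 ≤ c) (hh : h = 0 ∨ h = 1 ∨ h = -1) :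
    |(|x| - c)| * (if h = tailSign c x then 0 else 1) ≤
      (x * tailSign c x - c * tailSign c x ^ 2) - (x * h - c * h ^ 2) := by
  unfold tailSign
  rcases lt_or_ge c x with h1 | h1
  · rw [if_pos h1, abs_of_pos (by linarith : 0 < x), abs_of_pos (by linarith : 0 < x - c)]
    rcases hh with rfl | rfl | rfl <;> (norm_num; try linarith)
  · rw [if_neg (not_lt.2 h1)]
    rcases lt_or_ge x (-c) with h2 | h2
    · rw [if_pos h2, abs_of_neg (by linarith : x < 0), abs_of_pos (by linarith : 0 < -x - c)]
      rcases hh with rfl | rfl | rfl <;> (norm_num; try linarith)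
    · rw [if_neg (not_lt.2 h2)]
      have h3 : |x| ≤ c := abs_le.2 ⟨h2, h1⟩
      have h4 := le_abs_self x
      have h5 := neg_abs_le x
      rw [abs_of_nonpos (by linarith : |x| - c ≤ 0)]
      rcases hh with rfl | rfl | rfl <;> (norm_num; try linarith)

/-- If the bathtub deficit `B` controls the square of the distance `m` to the optimal strategy, then
it is controlled by the loss in value. -/
theorem davieReeds_loss_ge {φ C p0 M p m B : ℝ} (hC1 : 0 < C) (hC2 : C < 0.25575)
    (hφ1 : 0.3861 < φ) (hp0 : p0 = 2 * φ ^ 2 + 1 / 2) (hp0' : p0 ≤ 0.8)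
    (hM : 0 ≤ M) (hp : 0 ≤ p) (hB : B = 2 * φ - C * p0 - M + C * p) (hm : m ^ 2 ≤ 6.4 * B)
    (hpm : |p - p0| ≤ m) :
    M ^ 2 - 2 * C * φ * (2 * p - 1) ≤ 4 * φ ^ 2 * (1 - 2 * C * φ) - 0.14 * B := by
  have hB0 : 0 ≤ B := by nlinarith [sq_nonneg m]
  have hδ : (p - p0) ^ 2 ≤ 6.4 * B := by
    refine le_trans ?_ hm
    rw [← sq_abs]
    exact pow_le_pow_left₀ (abs_nonneg _) hpm 2
  have hCC : C ^ 2 ≤ 0.0655 := by nlinarith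
  -- 0.4192 = 0.0655 · 6.4.
  have hCδ : C ^ 2 * (p - p0) ^ 2 ≤ 0.4192 * B :=
    (mul_le_mul hCC hδ (sq_nonneg _) (by norm_num)).trans (by linarith)
  have key : (2 * φ - M) ^ 2 ≤ (4 * φ - 0.14) * B := by
    rcases le_or_gt (2 * φ) M with h | h
    · have h1 : M - 2 * φ ≤ C * (p - p0) := by nlinarith
      have h2 : (M - 2 * φ) ^ 2 ≤ (C * (p - p0)) ^ 2 := pow_le_pow_left₀ (by linarith) h1 2
      nlinarith
    · rcases le_or_gt p0 p with h0 | h0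
      · have h1 : 2 * φ - M ≤ B := by nlinarith
        have h2 : (2 * φ - M) * (2 * φ - M) ≤ 2 * φ * B :=
          mul_le_mul (by linarith) h1 (by linarith) (by linarith)
        nlinarith
      · set e := C * (p0 - p) with he
        have ha : 2 * φ - M = B + e := by rw [hB, he]; ring
        have he0 : 0 ≤ e := mul_nonneg hC1.le (by linarith)
        have he1 : e ≤ 0.2046 := by
          have := mul_le_mul hC2.le (by linarith : p0 - p ≤ 0.8) (by linarith) (by norm_num)
          linarith
        have he2 : e ^ 2 ≤ 0.4192 * B := by
          have : e ^ 2 = C ^ 2 * (p - p0) ^ 2 := by rw [he]; ring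
          linarith
        have h3 : (2 * φ - M) ^ 2 = (2 * φ - M) * B + e * B + e ^ 2 := by rw [ha]; ring
        have h4 : (2 * φ - M) * B ≤ 2 * φ * B := mul_le_mul_of_nonneg_right (by linarith) hB0
        have h5 : e * B ≤ 0.2046 * B := mul_le_mul_of_nonneg_right he1 hB0
        nlinarith
  -- With λ = 2Cφ the terms linear in M and p are exactly those of 4φB, so only a square is left to
  -- control.
  have hid : 4 * φ ^ 2 * (1 - 2 * C * φ) - (M ^ 2 - 2 * C * φ * (2 * p - 1)) =
      4 * φ * B - (2 * φ - M) ^ 2 := by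
    rw [hB, hp0]; ring
  linarith

section Stability

variable {n : ℕ}

theorem integral_eval_gaussian (i₀ : Fin n) {g : ℝ → ℝ} (hg : Measurable g) :
    ∫ x, g (x i₀) ∂(stdGaussianPi n) = ∫ x, g x ∂(gaussianReal 0 1) :=
  integral_comp_eval (X := fun _ : Fin n => ℝ) (i := i₀) hg.aestronglyMeasurable

theorem integrable_of_abs_le_one {F : (Fin n → ℝ) → ℝ} (hF : Measurable F) (h1 : ∀ x, |F x| ≤ 1) :
    Integrable F (stdGaussianPi n) :=
  Integrable.of_bound hF.aestronglyMeasurable 1 (ae_of_all _ h1)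

theorem memLp_of_abs_le_one {F : (Fin n → ℝ) → ℝ} (hF : Measurable F) (h1 : ∀ x, |F x| ≤ 1) :
    MemLp F 2 (stdGaussianPi n) :=
  MemLp.of_bound hF.aestronglyMeasurable 1 (ae_of_all _ h1)

theorem abs_le_one_of_ternary {a : ℝ} (h : a = 0 ∨ a = 1 ∨ a = -1) : |a| ≤ 1 := by
  rcases h with rfl | rfl | rfl <;> norm_num

/-- The indicator of the points where `h` differs from the threshold strategy. -/
noncomputable def mismatch (c : ℝ) (i₀ : Fin n) (h : (Fin n → ℝ) → ℝ) (x : Fin n → ℝ) : ℝ :=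
  if h x = tailSign c (x i₀) then 0 else 1

theorem tailSign_eval_measurable (c : ℝ) (i₀ : Fin n) :
    Measurable fun x : Fin n → ℝ => tailSign c (x i₀) :=
  (tailSign_measurable c).comp (measurable_pi_apply i₀)

theorem mismatch_measurable (c : ℝ) (i₀ : Fin n) {h : (Fin n → ℝ) → ℝ} (hh : Measurable h) :
    Measurable (mismatch c i₀ h) :=
  Measurable.ite (measurableSet_eq_fun hh (tailSign_eval_measurable c i₀)) measurable_const
    measurable_const

theorem mismatch_nonneg (c : ℝ) (i₀ : Fin n) (h : (Fin n → ℝ) → ℝ) (x : Fin n → ℝ) :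
    0 ≤ mismatch c i₀ h x := by
  unfold mismatch; split_ifs <;> norm_num

theorem abs_mismatch_le (c : ℝ) (i₀ : Fin n) (h : (Fin n → ℝ) → ℝ) (x : Fin n → ℝ) :
    |mismatch c i₀ h x| ≤ 1 := by
  unfold mismatch; split_ifs <;> norm_num

/-- A mismatch is cheap only where |x_{i₀}| is close to c. Such points within distance s have mass
at most 1.6 s, so a mismatch of mass m costs at least s(m - 1.6 s). -/
theorem bathtub_bounds {c : ℝ} (hc : 0 ≤ c) (i₀ : Fin n) {h : (Fin n → ℝ) → ℝ} (hh : Measurable h)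
    (h01 : ∀ x, h x = 0 ∨ h x = 1 ∨ h x = -1) :
    (∫ x, mismatch c i₀ h x ∂(stdGaussianPi n)) ^ 2 ≤
      6.4 * (2 * stdNormalDensity c - c * (2 * stdNormalCDF (-c)) - coordCoeff i₀ h
        + c * ∫ x, h x ^ 2 ∂(stdGaussianPi n)) ∧
    |(∫ x, h x ^ 2 ∂(stdGaussianPi n)) - 2 * stdNormalCDF (-c)| ≤
      ∫ x, mismatch c i₀ h x ∂(stdGaussianPi n) := by
  set m := ∫ x, mismatch c i₀ h x ∂(stdGaussianPi n) with hm
  have hm0 : 0 ≤ m := integral_nonneg fun x => mismatch_nonneg c i₀ h x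
  have ha : ∀ x, |h x| ≤ 1 := fun x => abs_le_one_of_ternary (h01 x)
  have mh := memLp_of_abs_le_one hh ha
  have ih2 : Integrable (fun x => h x ^ 2) (stdGaussianPi n) := mh.integrable_sq
  have ixh : Integrable (fun x => x i₀ * h x) (stdGaussianPi n) := coordCoeff_integrable i₀ mh
  have imis := integrable_of_abs_le_one (mismatch_measurable c i₀ hh) (abs_mismatch_le c i₀ h)
  have mt := memLp_of_abs_le_one (tailSign_eval_measurable c i₀) fun x => abs_tailSign_le c (x i₀)
  have it2 : Integrable (fun x : Fin n → ℝ => tailSign c (x i₀) ^ 2) (stdGaussianPi n) :=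
    mt.integrable_sq
  have ixt : Integrable (fun x : Fin n → ℝ => x i₀ * tailSign c (x i₀)) (stdGaussianPi n) :=
    coordCoeff_integrable i₀ mt
  have et2 : ∫ x : Fin n → ℝ, tailSign c (x i₀) ^ 2 ∂(stdGaussianPi n) =
      2 * stdNormalCDF (-c) := by
    rw [← integral_tailSign_sq hc]
    exact integral_eval_gaussian i₀ (g := fun y => tailSign c y ^ 2)
      ((tailSign_measurable c).pow_const 2)
  have ext : ∫ x : Fin n → ℝ, x i₀ * tailSign c (x i₀) ∂(stdGaussianPi n) =
      2 * stdNormalDensity c := by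
    rw [← integral_id_mul_tailSign hc]
    exact integral_eval_gaussian i₀ (g := fun y => y * tailSign c y)
      (measurable_id.mul (tailSign_measurable c))
  constructor
  -- This s maximizes s(m - 1.6 s), with maximum m²/6.4.
  · set s := m / 3.2 with hs
    have hs0 : 0 ≤ s := by positivity
    set near : (Fin n → ℝ) → ℝ := fun x => if |(|x i₀| - c)| < s then 1 else 0 with hnear
    have nearm : Measurable near :=
      (Measurable.ite (measurableSet_abs_abs_sub_lt c s) measurable_const
        measurable_const : Measurable fun y : ℝ => if |(|y| - c)| < s then (1 : ℝ) else 0).comp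
        (measurable_pi_apply i₀)
    have inear : Integrable near (stdGaussianPi n) := integrable_of_abs_le_one nearm fun x => by
      simp only [hnear]; split_ifs <;> norm_num
    have enear : ∫ x, near x ∂(stdGaussianPi n) ≤ 1.6 * s := by
      refine le_trans (le_of_eq ?_) (integral_near_threshold_le c hs0)
      exact integral_eval_gaussian i₀ (g := fun y => if |(|y| - c)| < s then (1 : ℝ) else 0)
        (Measurable.ite (measurableSet_abs_abs_sub_lt c s) measurable_const measurable_const)
    have hpt : ∀ x, s * (mismatch c i₀ h x - near x) ≤
        (x i₀ * tailSign c (x i₀) - c * tailSign c (x i₀) ^ 2) - (x i₀ * h x - c * h x ^ 2) := by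
      intro x
      refine le_trans ?_ (bathtub_pointwise hc (h01 x))
      simp only [mismatch, hnear]
      split_ifs with h1 h2 h2 <;> norm_num
      · exact hs0
      · exact not_lt.1 h2
    have i1 : Integrable (fun x : Fin n → ℝ => x i₀ * tailSign c (x i₀) - c * tailSign c (x i₀) ^ 2)
      (stdGaussianPi n) := ixt.sub (it2.const_mul c)
    have i2 : Integrable (fun x => x i₀ * h x - c * h x ^ 2) (stdGaussianPi n) :=
      ixh.sub (ih2.const_mul c)
    have hint := integral_mono ((imis.sub inear).const_mul s) (i1.sub i2) hpt
    simp only [Pi.sub_apply] at hint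
    rw [integral_const_mul, integral_sub imis inear, integral_sub i1 i2,
      integral_sub ixt (it2.const_mul c), integral_sub ixh (ih2.const_mul c), integral_const_mul,
      integral_const_mul, et2, ext] at hint
    have e0 : coordCoeff i₀ h = ∫ x, x i₀ * h x ∂(stdGaussianPi n) := rfl
    rw [e0]
    have h5 : s * (m - 1.6 * s) ≤ s * (m - ∫ x, near x ∂(stdGaussianPi n)) :=
      mul_le_mul_of_nonneg_left (by linarith) hs0
    have h6 : s * (m - 1.6 * s) = m ^ 2 / 6.4 := by rw [hs]; ring
    rw [h6] at h5
    have h7 := h5.trans hint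
    rw [div_le_iff₀ (by norm_num)] at h7
    linarith
  · rw [← et2, ← integral_sub ih2 it2]
    refine (abs_integral_le_integral_abs).trans (integral_mono (ih2.sub it2).abs imis fun x => ?_)
    simp only [mismatch]
    split_ifs with h1
    · simp [h1]
    · have b1 : h x ^ 2 ≤ 1 := by rw [← sq_abs]; exact pow_le_one₀ (abs_nonneg _) (ha x)
      have b2 : tailSign c (x i₀) ^ 2 ≤ 1 := by
        rw [← sq_abs]; exact pow_le_one₀ (abs_nonneg _) (abs_tailSign_le c (x i₀))
      rw [abs_le]
      constructor <;> nlinarith [sq_nonneg (h x), sq_nonneg (tailSign c (x i₀))]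

/-- Keep only the He_3(x_{i₀}) coefficient. For the threshold strategy it is a = 2φ(c)(c² - 1). For
h it differs from a by some d with d²/6 ≤ 4m, by Bessel's inequality, since two functions bounded by
1 differ by at most 2 on the mismatch set. -/
theorem hermiteForm_three_ge {c : ℝ} (hc : 0 ≤ c) (i₀ : Fin n) {h : (Fin n → ℝ) → ℝ}
    (hh : Measurable h) (h01 : ∀ x, h x = 0 ∨ h x = 1 ∨ h x = -1) :
    0.95 * (4 * stdNormalDensity c ^ 2 * (1 - c ^ 2) ^ 2 / 6) -
      76 * ∫ x, mismatch c i₀ h x ∂(stdGaussianPi n) ≤ hermiteForm 3 h h := by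
  have ha : ∀ x, |h x| ≤ 1 := fun x => abs_le_one_of_ternary (h01 x)
  have mh := memLp_of_abs_le_one hh ha
  have mt := memLp_of_abs_le_one (tailSign_eval_measurable c i₀) fun x => abs_tailSign_le c (x i₀)
  have imis := integrable_of_abs_le_one (mismatch_measurable c i₀ hh) (abs_mismatch_le c i₀ h)
  set α : Fin n → ℕ := Pi.single i₀ 3 with hα
  have e1 : hermiteCoeff α (fun x => tailSign c (x i₀)) =
      2 * stdNormalDensity c * (c ^ 2 - 1) := by
    rw [← integral_hermiteFun_three_mul_tailSign hc, hermiteCoeff]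
    simp_rw [hα, hermiteMulti_single]
    exact integral_eval_gaussian i₀ (g := fun y => hermiteFun 3 y * tailSign c y)
      ((hermiteFun_continuous 3).measurable.mul (tailSign_measurable c))
  have e2 := hermiteCoeff_sub α mh mt
  have e3 := hermite_bessel {α} (fun β hβ i => by
    rw [Finset.mem_singleton.1 hβ]; exact single_le_three i₀ le_rfl i) (mh.sub mt)
  rw [Finset.sum_singleton, Real.norm_eq_abs, sq_abs, multiFactorial_single] at e3
  have e4 : ∫ x, ‖(h - fun x : Fin n → ℝ => tailSign c (x i₀)) x‖ ^ 2 ∂(stdGaussianPi n) ≤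
      4 * ∫ x, mismatch c i₀ h x ∂(stdGaussianPi n) := by
    rw [← integral_const_mul]
    have i1 := (memLp_two_iff_integrable_sq_norm (mh.sub mt).1).1 (mh.sub mt)
    refine integral_mono i1 (imis.const_mul 4) fun x => ?_
    simp only [Pi.sub_apply, Real.norm_eq_abs, sq_abs, mismatch]
    split_ifs with h1
    · simp [h1]
    · have b1 := abs_le.1 (ha x)
      have b2 := abs_le.1 (abs_tailSign_le c (x i₀))
      nlinarith
  have e5 : (6 : ℝ)⁻¹ * hermiteCoeff α h ^ 2 ≤ hermiteForm 3 h h := by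
    rw [hermiteForm_self_eq]
    have hmem : α ∈ Finset.piAntidiag (Finset.univ : Finset (Fin n)) 3 := by
      rw [Finset.mem_piAntidiag]
      refine ⟨?_, fun i _ => Finset.mem_univ i⟩
      rw [hα]
      exact (Finset.sum_pi_single' i₀ 3 Finset.univ).trans (if_pos (Finset.mem_univ _))
    have := Finset.single_le_sum (f := fun β => (multiFactorial β)⁻¹ * ‖hermiteCoeff β h‖ ^ 2)
      (fun β _ => mul_nonneg (inv_nonneg.2 (multiFactorial_pos β).le) (by positivity)) hmem
    simp only [hα, multiFactorial_single, Real.norm_eq_abs, sq_abs] at this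
    norm_num [Nat.factorial] at this ⊢
    exact this
  have e6 : hermiteCoeff α (h - fun x : Fin n → ℝ => tailSign c (x i₀)) =
      hermiteCoeff α h - 2 * stdNormalDensity c * (c ^ 2 - 1) := by rw [← e1, ← e2]; rfl
  rw [e6] at e3
  have e7 := e3.trans e4
  norm_num [Nat.factorial] at e7
  set a := 2 * stdNormalDensity c * (c ^ 2 - 1) with haa
  have e8 : 4 * stdNormalDensity c ^ 2 * (1 - c ^ 2) ^ 2 = a ^ 2 := by rw [haa]; ring
  rw [e8]
  -- From (20d + a)² ≥ 0 follows (a + d)² ≥ 0.95 a² - 19 d², and 19 d²/6 ≤ 76 m.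
  nlinarith [sq_nonneg (hermiteCoeff α h - a + 0.05 * a), sq_nonneg (hermiteCoeff α h),
    sq_nonneg (20 * (hermiteCoeff α h - a) + a)]

/-- Cut k at the slab. Outside it the threshold strategy is nonzero while h vanishes wherever k does
not, so that piece lives on the mismatch set. The pieces recombine by (a + b)² ≤ 1.05 a² + 21 b². -/
theorem hermiteForm_three_le_near_slab {c : ℝ} (hc0 : 0 < c) (hc : c ≤ 1) (i₀ : Fin n)
    {h k : (Fin n → ℝ) → ℝ} (hk : Measurable k) (hh : Measurable h) (hk1 : ∀ x, |k x| ≤ 1)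
    (hhk : ∀ x, h x ≠ 0 → k x = 0) (hq : 0 < 1 - 2 * stdNormalCDF (-c)) :
    hermiteForm 3 k k ≤
      1.05 * (3 / 2 * (1 - 2 * stdNormalCDF (-c)) ^ 2 + 5 / 2 * (0.4 * (7 / 6 * c ^ 2)) ^ 2) +
      21 * ∫ x, mismatch c i₀ h x ∂(stdGaussianPi n) := by
  set t : (Fin n → ℝ) → ℝ := fun x => tailSign c (x i₀) ^ 2 with ht
  have tm : Measurable t := (tailSign_eval_measurable c i₀).pow_const 2
  have t01 : ∀ x, t x = 0 ∨ t x = 1 := by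
    intro x; simp only [ht, tailSign]; split_ifs <;> norm_num
  set k1 : (Fin n → ℝ) → ℝ := fun x => k x * (1 - t x) with hk1d
  set k2 : (Fin n → ℝ) → ℝ := fun x => k x * t x with hk2d
  have k1m : Measurable k1 := hk.mul (measurable_const.sub tm)
  have k2m : Measurable k2 := hk.mul tm
  have k1b : ∀ x, |k1 x| ≤ 1 := fun x => by
    rcases t01 x with h | h <;> simp [hk1d, h, hk1 x]
  have k2b : ∀ x, |k2 x| ≤ 1 := fun x => by
    rcases t01 x with h | h <;> simp [hk2d, h, hk1 x]
  have m1 := memLp_of_abs_le_one k1m k1b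
  have m2 := memLp_of_abs_le_one k2m k2b
  have hs := hermiteForm_three_le_of_slab hc i₀ hq (v := 0.4 * (7 / 6 * c ^ 2)) (by positivity)
    (integral_slabWeight_zero hc0.le).le (integral_slabWeight_one_le hc0) k1m k1b (by
      intro x hx
      have : t x = 1 := by
        simp only [ht, tailSign]
        rcases lt_abs.1 hx with h1 | h1
        · simp [h1]
        · rw [if_neg (by linarith), if_pos (by linarith)]; norm_num
      simp [hk1d, this])
  have h2 : hermiteForm 3 k2 k2 ≤ ∫ x, mismatch c i₀ h x ∂(stdGaussianPi n) := by
    refine (hermiteForm_self_le le_rfl m2).trans ?_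
    refine integral_mono ((memLp_two_iff_integrable_sq_norm m2.1).1 m2)
      (integrable_of_abs_le_one (mismatch_measurable c i₀ hh) (abs_mismatch_le c i₀ h)) fun x => ?_
    simp only [mismatch]
    split_ifs with h1
    · have : k2 x = 0 := by
        rcases t01 x with h0 | h0
        · simp [hk2d, h0]
        · have : h x ≠ 0 := by
            rw [h1]; intro h3
            simp [ht, h3] at h0
          simp [hk2d, hhk x this]
      simp [this]
    · exact pow_le_one₀ (norm_nonneg _) (k2b x)
  have hk12 : k = fun x => k1 x + k2 x := by ext x; simp only [hk1d, hk2d]; ring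
  have h3 : hermiteForm 3 k k ≤ 1.05 * hermiteForm 3 k1 k1 + 21 * hermiteForm 3 k2 k2 := by
    rw [hk12]
    simp only [hermiteForm_self_eq, Finset.mul_sum, ← Finset.sum_add_distrib]
    refine Finset.sum_le_sum fun α _ => ?_
    rw [hermiteCoeff_add α m1 m2]
    have hp : 0 ≤ (multiFactorial α)⁻¹ := inv_nonneg.2 (multiFactorial_pos α).le
    simp only [Real.norm_eq_abs, sq_abs]
    have : (hermiteCoeff α k1 + hermiteCoeff α k2) ^ 2 ≤
        1.05 * hermiteCoeff α k1 ^ 2 + 21 * hermiteCoeff α k2 ^ 2 := by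
      nlinarith [sq_nonneg (hermiteCoeff α k1 - 20 * hermiteCoeff α k2)]
    have := mul_le_mul_of_nonneg_left this hp
    linarith
  linarith

end Stability

/-! ### The value of the perturbed game -/

/-- The limiting value `4 φ(C*)² (1 - λ*)` of the Davie–Reeds game. -/
noncomputable def davieReedsValue : ℝ :=
  4 * stdNormalDensity davieReedsC ^ 2 * (1 - davieReedsLambda)

section Value

variable {n : ℕ}

theorem gameForm_add_sub (ε lam : ℝ) {h k : (Fin n → ℝ) → ℝ} (mh : MemLp h 2 (stdGaussianPi n))
    (mk : MemLp k 2 (stdGaussianPi n)) (hhk : ∀ x, h x ^ 2 + k x ^ 2 = 1) :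
    gameForm ε lam (fun x => h x + k x) (fun x => h x - k x) =
      (hermiteForm 1 h h - hermiteForm 1 k k)
      - lam * (2 * (∫ x, h x ^ 2 ∂(stdGaussianPi n)) - 1)
      - ε * (hermiteForm 3 h h - hermiteForm 3 k k) := by
  rw [gameForm, hermiteForm_add_sub 1 mh mk, hermiteForm_add_sub 3 mh mk]
  have e : ∫ x, inner ℝ (h x + k x) (h x - k x) ∂(stdGaussianPi n) =
      2 * (∫ x, h x ^ 2 ∂(stdGaussianPi n)) - 1 := by
    have : ∀ x, inner ℝ (h x + k x) (h x - k x) = 2 * h x ^ 2 - 1 := by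
      intro x
      simp only [RCLike.inner_apply, conj_trivial]
      linarith [hhk x]
    simp_rw [this]
    rw [integral_sub (mh.integrable_sq.const_mul 2) (integrable_const _), integral_const_mul]
    simp
  rw [e]

/-- ‖Π_1 k‖² only lowers the value and is dropped. The rest is the dichotomy between a large bathtub
deficit and a strategy close to the threshold. -/
theorem gameForm_le_of_aligned (i₀ : Fin n) {ε : ℝ} (hε0 : 0 ≤ ε) (hε : ε ≤ 4 / 10 ^ 11)
    {h k : (Fin n → ℝ) → ℝ} (hm : Measurable h) (km : Measurable k)
    (h01 : ∀ x, h x = 0 ∨ h x = 1 ∨ h x = -1) (hhk : ∀ x, h x ^ 2 + k x ^ 2 = 1)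
    (hM : 0 ≤ coordCoeff i₀ h) (hM0 : ∀ i ≠ i₀, coordCoeff i h = 0) :
    gameForm ε davieReedsLambda (fun x => h x + k x) (fun x => h x - k x) ≤
      davieReedsValue - 0.01 * ε := by
  have kb : ∀ x, |k x| ≤ 1 := fun x => by
    rw [← sq_le_one_iff_abs_le_one]; nlinarith [hhk x, sq_nonneg (h x)]
  have k0 : ∀ x, h x ≠ 0 → k x = 0 := fun x hx => by
    have h1 : h x ^ 2 = 1 := by
      rcases h01 x with h | h | h
      · exact absurd h hx
      · rw [h]; norm_num
      · rw [h]; norm_num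
    have := hhk x
    rw [h1] at this
    exact pow_eq_zero_iff (two_ne_zero) |>.1 (by linarith)
  have mh := memLp_of_abs_le_one hm fun x => abs_le_one_of_ternary (h01 x)
  have mk := memLp_of_abs_le_one km kb
  rw [gameForm_add_sub ε davieReedsLambda mh mk hhk]
  obtain ⟨c1, c2⟩ := davieReedsC_bounds
  obtain ⟨d1, d2⟩ := stdNormalDensity_davieReedsC_bounds
  obtain ⟨s1, s2⟩ := stdNormalDensity_davieReedsC_sq_bounds
  have hroot := davieReedsC_mem_and_eq.2
  have hc0 : 0 < davieReedsC := by linarith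
  obtain ⟨b1, b2⟩ := bathtub_bounds hc0.le i₀ hm h01
  have q3h := hermiteForm_three_ge hc0.le i₀ hm h01
  have q3k := hermiteForm_three_le_near_slab hc0 (by linarith) i₀ km hm kb k0 (by linarith)
  have q3k1 : hermiteForm 3 k k ≤ 1 := by
    refine (hermiteForm_self_le le_rfl mk).trans ?_
    have := integral_mono ((memLp_two_iff_integrable_sq_norm mk.1).1 mk)
      (integrable_const (1 : ℝ)) fun x => pow_le_one₀ (norm_nonneg _) (kb x)
    simpa using this
  have q3h0 := hermiteForm_self_nonneg 3 h
  have q1k := hermiteForm_self_nonneg 1 k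
  have q1h : hermiteForm 1 h h = coordCoeff i₀ h ^ 2 := by
    rw [hermiteForm_one_eq mh mh, Finset.sum_eq_single i₀]
    · simp
    · intro i _ hi; rw [hM0 i hi, inner_zero_left]
    · simp
  have hp : 0 ≤ ∫ x, h x ^ 2 ∂(stdGaussianPi n) := integral_nonneg fun x => sq_nonneg _
  have hm0 : 0 ≤ ∫ x, mismatch davieReedsC i₀ h x ∂(stdGaussianPi n) :=
    integral_nonneg fun x => mismatch_nonneg _ i₀ h x
  rw [q1h]
  generalize hermiteForm 3 h h = A at *
  generalize hermiteForm 3 k k = A' at *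
  generalize hermiteForm 1 k k = A'' at *
  generalize (∫ x, mismatch davieReedsC i₀ h x ∂(stdGaussianPi n)) = m at *
  generalize (∫ x, h x ^ 2 ∂(stdGaussianPi n)) = p at *
  generalize coordCoeff i₀ h = M at *
  have hp0 : 2 * stdNormalCDF (-davieReedsC) =
      2 * stdNormalDensity davieReedsC ^ 2 + 1 / 2 := by linarith
  rw [hp0] at b1 b2 q3k
  rw [davieReedsValue, davieReedsLambda]
  generalize stdNormalDensity davieReedsC = φ at *
  generalize davieReedsC = C at *
  have loss := davieReeds_loss_ge hc0 c2 d1 rfl (by linarith) hM hp rfl b1 b2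
  set B := 2 * φ - C * (2 * φ ^ 2 + 1 / 2) - M + C * p with hB
  -- In the first case the loss 0.14 B exceeds by 0.01 ε the most that the cubic term can gain,
  -- namely ε‖Π_3 k‖² ≤ ε.
  rcases le_or_gt (1.01 * ε) (0.14 * B) with hD | hD
  · have : ε * (A' - A) ≤ ε * 1 := mul_le_mul_of_nonneg_left (by linarith) hε0
    linarith
  -- Now m² ≤ 6.4 B < 6.4 · 1.01 · 4·10⁻¹¹ / 0.14 < 1.849·10⁻⁹. This is where the size of ε is
  -- limited.
  · have hm2 : m ^ 2 ≤ (4.3e-5) ^ 2 := by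
      norm_num at hε ⊢
      linarith
    have hm3 : m ≤ 4.3e-5 := le_of_sq_le_sq hm2 (by norm_num)
    have hC2 : C ^ 2 ≤ 0.06541 := by nlinarith
    have hq : (1 - (2 * φ ^ 2 + 1 / 2)) ^ 2 ≤ 0.20185 ^ 2 :=
      pow_le_pow_left₀ (by linarith) (by linarith) 2
    have hv : (0.4 * (7 / 6 * C ^ 2)) ^ 2 ≤ 0.03053 ^ 2 :=
      pow_le_pow_left₀ (by positivity) (by linarith) 2
    have hh : (0.93459 : ℝ) ^ 2 ≤ (1 - C ^ 2) ^ 2 :=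
      pow_le_pow_left₀ (by norm_num) (by linarith) 2
    have hh2 : 4 * 0.149076 * (0.93459 : ℝ) ^ 2 ≤ 4 * φ ^ 2 * (1 - C ^ 2) ^ 2 :=
      mul_le_mul (by linarith) hh (by positivity) (by positivity)
    -- Roughly 0.95 · 0.0868 - 1.05 · 0.0635 - (76 + 21) · 4.3·10⁻⁵ ≈ 0.0116.
    have hdiff : 0.01 ≤ A - A' := by
      norm_num at q3h q3k hm3 hq hv hh2 ⊢
      linarith
    have h1 : ε * 0.01 ≤ ε * (A - A') := mul_le_mul_of_nonneg_left hdiff hε0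
    have hB0 : 0 ≤ B := by nlinarith [sq_nonneg m]
    linarith

theorem memLp_sign {f : (Fin n → ℝ) → ℝ} (hf : Measurable f) (hf1 : ∀ x, f x = 1 ∨ f x = -1) :
    MemLp f 2 (stdGaussianPi n) :=
  memLp_of_abs_le_one hf fun x => abs_le_one_of_ternary (Or.inr (hf1 x))

theorem gameForm_le_value (i₀ : Fin n) {ε : ℝ} (hε0 : 0 ≤ ε) (hε : ε ≤ 4 / 10 ^ 11)
    {f g : (Fin n → ℝ) → ℝ} (hf : Measurable f) (hg : Measurable g)
    (hf1 : ∀ x, f x = 1 ∨ f x = -1) (hg1 : ∀ x, g x = 1 ∨ g x = -1) :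
    gameForm ε davieReedsLambda f g ≤ davieReedsValue - 0.01 * ε := by
  have hmf := memLp_sign hf hf1
  have hmg := memLp_sign hg hg1
  have hhm : MemLp (fun x => (f x + g x) / 2) 2 (stdGaussianPi n) := by
    simpa only [div_eq_inv_mul, Pi.add_apply] using (hmf.add hmg).const_mul (2 : ℝ)⁻¹
  obtain ⟨L, hL0, hL⟩ := exists_rotate_coordCoeff i₀ hhm
  have hr := (rotate_continuous L).measurable
  have key := gameForm_le_of_aligned i₀ hε0 hε
    (h := fun x => (f (rotate L x) + g (rotate L x)) / 2)
    (k := fun x => (f (rotate L x) - g (rotate L x)) / 2)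
    (((hf.comp hr).add (hg.comp hr)).div_const 2) (((hf.comp hr).sub (hg.comp hr)).div_const 2)
    (fun x => by
      rcases hf1 (rotate L x) with h1 | h1 <;> rcases hg1 (rotate L x) with h2 | h2 <;>
        norm_num [h1, h2])
    (fun x => by
      rcases hf1 (rotate L x) with h1 | h1 <;> rcases hg1 (rotate L x) with h2 | h2 <;>
        norm_num [h1, h2])
    hL0 hL
  rw [← gameForm_comp_rotate L ε davieReedsLambda hmf hmg]
  convert key using 2
  · ext x; ring
  · ext x; ring

/-- The threshold strategy for h, with k = 1 on the slab, attains V when ε = 0. The cubic term is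
bounded crudely by ε, which is enough to keep the value positive for small ε. -/
theorem exists_gameForm_ge (i₀ : Fin n) {ε : ℝ} (hε0 : 0 ≤ ε) :
    ∃ f g : (Fin n → ℝ) → ℝ, Measurable f ∧ Measurable g ∧ (∀ x, f x = 1 ∨ f x = -1) ∧
      (∀ x, g x = 1 ∨ g x = -1) ∧ davieReedsValue - ε ≤ gameForm ε davieReedsLambda f g := by
  have hc0 : 0 ≤ davieReedsC := by linarith [davieReedsC_bounds.1]
  set h : (Fin n → ℝ) → ℝ := fun x => tailSign davieReedsC (x i₀) with hh
  set k : (Fin n → ℝ) → ℝ := fun x => 1 - tailSign davieReedsC (x i₀) ^ 2 with hk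
  have hm : Measurable h := tailSign_eval_measurable _ i₀
  have km : Measurable k := measurable_const.sub (hm.pow_const 2)
  have h01 : ∀ x, h x = 0 ∨ h x = 1 ∨ h x = -1 := by
    intro x; simp only [hh, tailSign]; split_ifs <;> simp
  have kb : ∀ x, |k x| ≤ 1 := by
    intro x
    have : k x = 1 - h x ^ 2 := rfl
    rw [this]
    rcases h01 x with h | h | h <;> rw [h] <;> norm_num
  have mh := memLp_of_abs_le_one hm fun x => abs_le_one_of_ternary (h01 x)
  have mk := memLp_of_abs_le_one km kb
  have hhk : ∀ x, h x ^ 2 + k x ^ 2 = 1 := by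
    intro x
    have : k x = 1 - h x ^ 2 := rfl
    rw [this]
    rcases h01 x with h | h | h <;> rw [h] <;> norm_num
  refine ⟨fun x => h x + k x, fun x => h x - k x, hm.add km, hm.sub km, ?_, ?_, ?_⟩
  · intro x
    have : k x = 1 - h x ^ 2 := rfl
    simp only [this]
    rcases h01 x with h | h | h <;> rw [h] <;> norm_num
  · intro x
    have : k x = 1 - h x ^ 2 := rfl
    simp only [this]
    rcases h01 x with h | h | h <;> rw [h] <;> norm_num
  rw [gameForm_add_sub ε davieReedsLambda mh mk hhk]
  have keven : ∀ x, k (-x) = k x := by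
    intro x
    simp only [hk, Pi.neg_apply, tailSign]
    have e1 : (davieReedsC < -(x i₀)) ↔ x i₀ < -davieReedsC := by constructor <;> intro <;> linarith
    have e2 : (-(x i₀) < -davieReedsC) ↔ davieReedsC < x i₀ := by constructor <;> intro <;> linarith
    simp only [e1, e2]
    split_ifs <;> norm_num
  -- k is even, so its first moments vanish; x ↦ -x is one of the rotations.
  have q1k : hermiteForm 1 k k = 0 := by
    rw [hermiteForm_one_eq mk mk]
    refine Finset.sum_eq_zero fun i _ => ?_
    have h1 := integral_comp_rotate (LinearIsometryEquiv.neg ℝ) fun y : Fin n → ℝ => y i • k y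
    have h2 : ∀ y : Fin n → ℝ, rotate (LinearIsometryEquiv.neg ℝ) y = -y := fun y => rfl
    simp only [h2, keven, Pi.neg_apply, neg_smul, integral_neg] at h1
    have h3 : coordCoeff i k = 0 := by
      rw [coordCoeff]; linarith
    rw [h3, inner_zero_left]
  have q1h : (2 * stdNormalDensity davieReedsC) ^ 2 ≤ hermiteForm 1 h h := by
    rw [hermiteForm_one_eq mh mh]
    have e : coordCoeff i₀ h = 2 * stdNormalDensity davieReedsC := by
      rw [← integral_id_mul_tailSign hc0]
      exact integral_eval_gaussian i₀ (g := fun y => y * tailSign davieReedsC y)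
        (measurable_id.mul (tailSign_measurable _))
    rw [← e]
    have := Finset.single_le_sum (f := fun i => inner ℝ (coordCoeff i h) (coordCoeff i h))
      (fun i _ => real_inner_self_nonneg) (Finset.mem_univ i₀)
    simpa [real_inner_self_eq_norm_sq] using this
  have ep : ∫ x, h x ^ 2 ∂(stdGaussianPi n) = 2 * stdNormalCDF (-davieReedsC) := by
    rw [← integral_tailSign_sq hc0]
    exact integral_eval_gaussian i₀ (g := fun y => tailSign davieReedsC y ^ 2)
      ((tailSign_measurable _).pow_const 2)
  have q3h : hermiteForm 3 h h ≤ 1 := by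
    refine (hermiteForm_self_le le_rfl mh).trans ?_
    have := integral_mono ((memLp_two_iff_integrable_sq_norm mh.1).1 mh)
      (integrable_const (1 : ℝ)) fun x =>
        pow_le_one₀ (norm_nonneg _) (abs_le_one_of_ternary (h01 x))
    simpa using this
  have q3k := hermiteForm_self_nonneg 3 k
  have hroot := davieReedsC_mem_and_eq.2
  have e4 : 2 * (2 * stdNormalCDF (-davieReedsC)) - 1 = 4 * stdNormalDensity davieReedsC ^ 2 := by
    linarith
  rw [ep, e4, q1k, davieReedsValue]
  have : ε * (hermiteForm 3 h h - hermiteForm 3 k k) ≤ ε * 1 :=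
    mul_le_mul_of_nonneg_left (by linarith) hε0
  linarith

end Value

/-! ### Bounds for `gameVal` and `gameSdp` -/

section Games

variable {n : ℕ}

theorem gameVal_le (i₀ : Fin n) {ε : ℝ} (hε0 : 0 ≤ ε) (hε : ε ≤ 4 / 10 ^ 11) :
    gameVal n ε davieReedsLambda ≤ davieReedsValue - 0.01 * ε := by
  refine csSup_le ⟨_, fun _ => 1, fun _ => 1, measurable_const, measurable_const,
    fun _ => Or.inl rfl, fun _ => Or.inl rfl, rfl⟩ ?_
  rintro r ⟨f, g, hf, hg, hf1, hg1, rfl⟩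
  rw [integral_perturbedGame_mul ε _ (memLp_sign hf hf1) (memLp_sign hg hg1)]
  exact gameForm_le_value i₀ hε0 hε hf hg hf1 hg1

theorem le_gameVal (i₀ : Fin n) {ε : ℝ} (hε0 : 0 ≤ ε) (hε : ε ≤ 4 / 10 ^ 11) :
    davieReedsValue - ε ≤ gameVal n ε davieReedsLambda := by
  obtain ⟨f, g, hf, hg, hf1, hg1, h⟩ := exists_gameForm_ge i₀ hε0
  refine h.trans (le_csSup ⟨davieReedsValue - 0.01 * ε, ?_⟩ ⟨f, g, hf, hg, hf1, hg1, ?_⟩)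
  · rintro r ⟨f, g, hf, hg, hf1, hg1, rfl⟩
    rw [integral_perturbedGame_mul ε _ (memLp_sign hf hf1) (memLp_sign hg hg1)]
    exact gameForm_le_value i₀ hε0 hε hf hg hf1 hg1
  · rw [integral_perturbedGame_mul ε _ (memLp_sign hf hf1) (memLp_sign hg hg1)]

theorem le_gameSdp (i₀ : Fin n) {ε : ℝ} (hε0 : 0 ≤ ε) (lam : ℝ) :
    (1 + ε) * (1 - 1 / (n : ℝ)) ^ 2 - ε - lam ≤ gameSdp n ε lam := by
  have hu := (normalizedId_measurable i₀).stronglyMeasurable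
  have hu1 := norm_normalizedId i₀
  have mu := memLp_of_norm_eq_one hu hu1
  refine (gameForm_normalizedId i₀ hε0 lam).trans (le_csSup ⟨1 + |lam| + |ε|, ?_⟩
    ⟨EuclideanSpace ℝ (Fin n), inferInstance, inferInstance, inferInstance, normalizedId i₀,
      normalizedId i₀, hu, hu, hu1, hu1, (integral_inner_perturbedGame ε lam mu mu).symm⟩)
  rintro r ⟨H, _, _, _, f, g, hf, hg, hf1, hg1, rfl⟩
  rw [integral_inner_perturbedGame ε lam (memLp_of_norm_eq_one hf hf1)
    (memLp_of_norm_eq_one hg hg1)]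
  exact gameForm_le_of_norm_eq_one ε lam hf hg hf1 hg1

theorem gameSdp_zero_le (n : ℕ) {lam : ℝ} (hl : lam ≤ 1 / 2) : gameSdp n 0 lam ≤ 1 - lam := by
  refine csSup_le ⟨_, ℝ, inferInstance, inferInstance, inferInstance, fun _ => 1, fun _ => 1,
    stronglyMeasurable_const, stronglyMeasurable_const, fun _ => by simp, fun _ => by simp,
    rfl⟩ ?_
  rintro r ⟨H, _, _, _, f, g, hf, hg, hf1, hg1, rfl⟩
  rw [integral_inner_perturbedGame 0 lam (memLp_of_norm_eq_one hf hf1)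
    (memLp_of_norm_eq_one hg hg1)]
  exact gameForm_zero_le hl hf hg hf1 hg1

/-- At ε = 0 the two bounds coincide, so the sign value is the same in every positive dimension;
only the vector value needs a limit. -/
theorem gameVal_zero (i₀ : Fin n) : gameVal n 0 davieReedsLambda = davieReedsValue := by
  have h1 := gameVal_le i₀ le_rfl (by norm_num)
  have h2 := le_gameVal i₀ le_rfl (by norm_num)
  linarith

end Games

/-! ### Numerical values and the integrality gap for large n -/

theorem davieReedsLambda_bounds : 0.197 < davieReedsLambda ∧ davieReedsLambda < 0.198 := by
  obtain ⟨c1, c2⟩ := davieReedsC_bounds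
  obtain ⟨d1, d2⟩ := stdNormalDensity_davieReedsC_bounds
  unfold davieReedsLambda
  constructor <;> nlinarith

theorem davieReedsValue_bounds : 0.47 < davieReedsValue ∧ davieReedsValue < 0.479 := by
  obtain ⟨l1, l2⟩ := davieReedsLambda_bounds
  obtain ⟨s1, s2⟩ := stdNormalDensity_davieReedsC_sq_bounds
  unfold davieReedsValue
  constructor <;> nlinarith

theorem davieReedsConstant_mul_value :
    davieReedsConstant * davieReedsValue = 1 - davieReedsLambda := by
  have := (stdNormalDensity_pos davieReedsC).ne'
  rw [davieReedsConstant_eq, davieReedsValue]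
  field_simp

theorem tendsto_sdp_lower_bound (ε lam : ℝ) :
    Tendsto (fun n : ℕ => (1 + ε) * (1 - 1 / (n : ℝ)) ^ 2 - ε - lam) atTop (𝓝 (1 - lam)) := by
  have h1 := tendsto_one_div_atTop_nhds_zero_nat (𝕜 := ℝ)
  have h2 := ((((h1.const_sub 1).pow 2).const_mul (1 + ε)).sub_const ε).sub_const lam
  convert h2 using 2
  ring

theorem tendsto_gap :
    Tendsto (fun n : ℕ => gameSdp n 0 davieReedsLambda / gameVal n 0 davieReedsLambda) atTop
      (𝓝 davieReedsConstant) := by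
  have hV : 0 < davieReedsValue := by linarith [davieReedsValue_bounds.1]
  have hK : davieReedsConstant = (1 - davieReedsLambda) / davieReedsValue := by
    rw [← davieReedsConstant_mul_value, mul_div_cancel_right₀ _ hV.ne']
  have hev : ∀ᶠ n : ℕ in atTop, gameVal n 0 davieReedsLambda = davieReedsValue := by
    filter_upwards [eventually_gt_atTop 0] with n hn
    exact gameVal_zero ⟨0, hn⟩
  have hs : Tendsto (fun n : ℕ => gameSdp n 0 davieReedsLambda) atTop
      (𝓝 (1 - davieReedsLambda)) := by
    refine tendsto_of_tendsto_of_tendsto_of_le_of_le' (tendsto_sdp_lower_bound 0 davieReedsLambda)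
      tendsto_const_nhds ?_ (Eventually.of_forall fun n =>
        gameSdp_zero_le n (by linarith [davieReedsLambda_bounds.2]))
    filter_upwards [eventually_gt_atTop 0] with n hn
    exact le_gameSdp ⟨0, hn⟩ le_rfl davieReedsLambda
  rw [hK]
  refine (hs.div_const davieReedsValue).congr' ?_
  filter_upwards [hev] with n hn
  rw [hn]

/-- The right side tends to 1 - λ* = K_DR V, so it suffices that (K_DR + 10⁻¹²)(V - 4·10⁻¹³) < K_DR
V. This holds because 10⁻¹² V < 0.48·10⁻¹², while 4·10⁻¹³ K_DR > 0.67·10⁻¹². -/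
theorem eventually_sdp_lower_bound :
    ∀ᶠ n : ℕ in atTop, (davieReedsConstant + 1 / 10 ^ 12) *
      (davieReedsValue - 0.01 * (4 / 10 ^ 11)) <
      (1 + 4 / 10 ^ 11) * (1 - 1 / (n : ℝ)) ^ 2 - 4 / 10 ^ 11 - davieReedsLambda := by
  refine (tendsto_sdp_lower_bound (4 / 10 ^ 11) davieReedsLambda).eventually_const_lt ?_
  have h := davieReedsConstant_mul_value
  obtain ⟨k1, k2⟩ := davieReedsConstant_bounds
  obtain ⟨v1, v2⟩ := davieReedsValue_bounds
  rw [← h]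
  norm_num at k1 k2 v1 v2 ⊢
  nlinarith

theorem eventually_gap :
    ∀ᶠ n : ℕ in atTop, davieReedsConstant + 1 / 10 ^ 12 ≤
      gameSdp n (4 / 10 ^ 11) davieReedsLambda / gameVal n (4 / 10 ^ 11) davieReedsLambda := by
  filter_upwards [eventually_sdp_lower_bound, eventually_gt_atTop 0] with n hn hpos
  have h1 := gameVal_le ⟨0, hpos⟩ (ε := 4 / 10 ^ 11) (by norm_num) le_rfl
  have h2 := le_gameVal ⟨0, hpos⟩ (ε := 4 / 10 ^ 11) (by norm_num) le_rfl
  have h3 := le_gameSdp ⟨0, hpos⟩ (ε := 4 / 10 ^ 11) (by norm_num) davieReedsLambda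
  have hV : 0 < gameVal n (4 / 10 ^ 11) davieReedsLambda := by
    have := davieReedsValue_bounds.1
    norm_num at this h2
    linarith
  rw [le_div_iff₀ hV]
  have hK : 0 ≤ davieReedsConstant + 1 / 10 ^ 12 := by
    have := davieReedsConstant_bounds.1
    positivity
  exact (mul_le_mul_of_nonneg_left h1 hK).trans (hn.le.trans h3)

/-! ### Discretization: from games to matrices -/

section Discretization

variable {n N : ℕ} {H : Type*} [NormedAddCommGroup H] [InnerProductSpace ℝ H]

/-- The indicator function of the cell `e = i`. -/
noncomputable def cellIndicator (e : (Fin n → ℝ) → Fin N) (i : Fin N) (x : Fin n → ℝ) : ℝ :=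
  if e x = i then 1 else 0

theorem cellIndicator_memLp {e : (Fin n → ℝ) → Fin N} (he : Measurable e) (i : Fin N) :
    MemLp (cellIndicator e i) 2 (stdGaussianPi n) :=
  memLp_of_abs_le_one
    (Measurable.ite (he (measurableSet_singleton i)) measurable_const measurable_const)
    fun x => by unfold cellIndicator; split_ifs <;> norm_num

theorem comp_eq_sum_cellIndicator (e : (Fin n → ℝ) → Fin N) (a : Fin N → H) (x : Fin n → ℝ) :
    a (e x) = ∑ i, cellIndicator e i x • a i := by
  simp [cellIndicator]

theorem hermiteCoeff_comp_cell [CompleteSpace H] {e : (Fin n → ℝ) → Fin N} (he : Measurable e)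
    (a : Fin N → H) (α : Fin n → ℕ) :
    hermiteCoeff α (fun x => a (e x)) = ∑ i, hermiteCoeff α (cellIndicator e i) • a i := by
  unfold hermiteCoeff
  simp_rw [comp_eq_sum_cellIndicator e a, Finset.smul_sum, ← smul_assoc]
  rw [integral_finsetSum _ fun i _ =>
    (hermiteCoeff_integrable α (cellIndicator_memLp he i)).smul_const (a i)]
  simp_rw [integral_smul_const]

theorem hermiteForm_comp_cell [CompleteSpace H] {e : (Fin n → ℝ) → Fin N} (he : Measurable e)
    (a b : Fin N → H) (k : ℕ) :
    hermiteForm k (fun x => a (e x)) (fun x => b (e x)) =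
      ∑ i, ∑ j, hermiteForm k (cellIndicator e i) (cellIndicator e j) * inner ℝ (a i) (b j) := by
  simp only [hermiteForm, hermiteCoeff_comp_cell he, Finset.sum_mul]
  rw [Finset.sum_congr rfl fun i _ => Finset.sum_comm, Finset.sum_comm]
  refine Finset.sum_congr rfl fun α _ => ?_
  rw [sum_inner, Finset.mul_sum]
  refine Finset.sum_congr rfl fun i _ => ?_
  rw [inner_sum, Finset.mul_sum]
  refine Finset.sum_congr rfl fun j _ => ?_
  rw [inner_smul_left, inner_smul_right]
  simp only [RCLike.inner_apply, conj_trivial]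
  ring

theorem integral_inner_comp_cell {e : (Fin n → ℝ) → Fin N} (he : Measurable e)
    (a b : Fin N → H) :
    ∫ x, inner ℝ (a (e x)) (b (e x)) ∂(stdGaussianPi n) =
      ∑ i, ∑ j, (∫ x, inner ℝ (cellIndicator e i x) (cellIndicator e j x) ∂(stdGaussianPi n)) *
        inner ℝ (a i) (b j) := by
  have hi := fun i j => ((cellIndicator_memLp he i).integrable_inner_two
    (cellIndicator_memLp he j)).mul_const (inner ℝ (a i) (b j))
  simp_rw [← integral_mul_const]
  simp_rw [← integral_finsetSum Finset.univ fun j _ => hi _ j]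
  rw [← integral_finsetSum Finset.univ fun i _ => integrable_finsetSum _ fun j _ => hi i j]
  congr 1
  ext x
  simp [cellIndicator]

/-- The matrix of the game form on functions that are constant on the cells of `e`. -/
noncomputable def cellMatrix (ε lam : ℝ) (e : (Fin n → ℝ) → Fin N) : Matrix (Fin N) (Fin N) ℝ :=
  fun i j => gameForm ε lam (cellIndicator e i) (cellIndicator e j)

theorem gameForm_comp_cell [CompleteSpace H] (ε lam : ℝ) {e : (Fin n → ℝ) → Fin N}
    (he : Measurable e) (a b : Fin N → H) :
    gameForm ε lam (fun x => a (e x)) (fun x => b (e x)) =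
      ∑ i, ∑ j, cellMatrix ε lam e i j * inner ℝ (a i) (b j) := by
  rw [gameForm, hermiteForm_comp_cell he, hermiteForm_comp_cell he, integral_inner_comp_cell he]
  simp only [cellMatrix, gameForm, Finset.mul_sum, ← Finset.sum_sub_distrib]
  refine Finset.sum_congr rfl fun i _ => Finset.sum_congr rfl fun j _ => ?_
  ring

theorem tendsto_hermiteCoeff {H : Type*} [NormedAddCommGroup H] [InnerProductSpace ℝ H]
    {s : ℕ → (Fin n → ℝ) → H} {u : (Fin n → ℝ) → H}
    (hs : ∀ m, MemLp (s m) 2 (stdGaussianPi n)) (hs1 : ∀ m x, ‖s m x‖ = 1)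
    (hlim : ∀ x, Tendsto (fun m => s m x) atTop (𝓝 (u x))) (α : Fin n → ℕ) :
    Tendsto (fun m => hermiteCoeff α (s m)) atTop (𝓝 (hermiteCoeff α u)) := by
  refine tendsto_integral_of_dominated_convergence (fun x => ‖hermiteMulti α x‖)
    (fun m => (hermiteCoeff_integrable α (hs m)).1)
    ((hermiteMulti_memLp α).integrable (by norm_num)).norm
    (fun m => ae_of_all _ fun x => ?_) (ae_of_all _ fun x => (hlim x).const_smul _)
  rw [norm_smul, hs1, mul_one]

/-- Only finitely many Hermite coefficients enter, each continuous by dominated convergence; the λ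
term is constant because all functions have norm one. -/
theorem tendsto_gameForm {s : ℕ → (Fin n → ℝ) → H} {u : (Fin n → ℝ) → H}
    (hs : ∀ m, MemLp (s m) 2 (stdGaussianPi n)) (hs1 : ∀ m x, ‖s m x‖ = 1)
    (hu1 : ∀ x, ‖u x‖ = 1) (hlim : ∀ x, Tendsto (fun m => s m x) atTop (𝓝 (u x))) (ε lam : ℝ) :
    Tendsto (fun m => gameForm ε lam (s m) (s m)) atTop (𝓝 (gameForm ε lam u u)) := by
  have hform : ∀ k, Tendsto (fun m => hermiteForm k (s m) (s m)) atTop (𝓝 (hermiteForm k u u)) :=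
    fun k => tendsto_finsetSum _ fun α _ =>
      ((tendsto_hermiteCoeff hs hs1 hlim α).inner (tendsto_hermiteCoeff hs hs1 hlim α)).const_mul _
  unfold gameForm
  simp only [real_inner_self_eq_norm_sq, hs1, hu1]
  exact ((hform 1).sub_const _).sub ((hform 3).const_mul ε)

theorem exists_cell_eq {G : Type*} (s : SimpleFunc (Fin n → ℝ) G) :
    ∃ (N : ℕ) (e : (Fin n → ℝ) → Fin N) (v : Fin N → G), Measurable e ∧
      (∀ x, v (e x) = s x) ∧ ∀ i, v i ∈ s.range := by
  refine ⟨s.range.card, fun x => s.range.equivFin ⟨s x, s.mem_range_self x⟩,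
    fun i => (s.range.equivFin.symm i : G), measurable_to_countable' fun i => ?_,
    fun x => by simp, fun i => (s.range.equivFin.symm i).2⟩
  have : (fun x => s.range.equivFin ⟨s x, s.mem_range_self x⟩) ⁻¹' {i} =
      s ⁻¹' {(s.range.equivFin.symm i : G)} := by
    ext x
    simp only [Set.mem_preimage, Set.mem_singleton_iff]
    rw [← Equiv.eq_symm_apply, Subtype.ext_iff]
  rw [this]
  exact s.measurableSet_preimage _

/-- Approximating inside the sphere keeps the simple functions admissible as vector strategies, so
no renormalization is needed. -/
theorem exists_cell_gameForm_gt (i₀ : Fin n) (ε lam : ℝ) {t : ℝ}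
    (ht : t < gameForm ε lam (normalizedId i₀) (normalizedId i₀)) :
    ∃ (N : ℕ) (e : (Fin n → ℝ) → Fin N) (v : Fin N → EuclideanSpace ℝ (Fin n)), Measurable e ∧
      (∀ i, ‖v i‖ = 1) ∧ t < gameForm ε lam (fun x => v (e x)) (fun x => v (e x)) := by
  set S : Set (EuclideanSpace ℝ (Fin n)) := Metric.sphere 0 1 with hS
  have hmem : ∀ x, normalizedId i₀ x ∈ S := fun x => by simp [hS, norm_normalizedId]
  set s := SimpleFunc.approxOn (normalizedId i₀) (normalizedId_measurable i₀) S
    (normalizedId i₀ 0) (hmem 0) with hs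
  have hs1 : ∀ m x, ‖s m x‖ = 1 := fun m x => by
    have := SimpleFunc.approxOn_mem (normalizedId_measurable i₀) (hmem 0) m x
    simpa [hS] using this
  have hlim : ∀ x, Tendsto (fun m => s m x) atTop (𝓝 (normalizedId i₀ x)) := fun x =>
    SimpleFunc.tendsto_approxOn (normalizedId_measurable i₀) (hmem 0) (subset_closure (hmem x))
  have hsm : ∀ m, MemLp (s m) 2 (stdGaussianPi n) := fun m =>
    memLp_of_norm_eq_one (s m).stronglyMeasurable (hs1 m)
  obtain ⟨m, hm⟩ := ((tendsto_gameForm hsm hs1 (norm_normalizedId i₀) hlim ε lam).eventually_const_lt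
    ht).exists
  obtain ⟨N, e, v, he, hve, hv⟩ := exists_cell_eq (s m)
  refine ⟨N, e, v, he, fun i => ?_, ?_⟩
  · obtain ⟨x, hx⟩ := SimpleFunc.mem_range.1 (hv i)
    rw [← hx]; exact hs1 m x
  · simpa only [hve] using hm

end Discretization

/-! ### Matrices and the Grothendieck constant -/

section Grothendieck

variable {N : ℕ}

theorem vectorValueSet_bddAbove (A : Matrix (Fin N) (Fin N) ℝ) : BddAbove (vectorValueSet A) := by
  refine ⟨∑ i, ∑ j, |A i j|, ?_⟩
  rintro r ⟨d, x, y, hx, hy, rfl⟩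
  refine Finset.sum_le_sum fun i _ => Finset.sum_le_sum fun j _ => ?_
  refine (le_abs_self _).trans ?_
  rw [abs_mul]
  refine mul_le_of_le_one_right (abs_nonneg _) ?_
  have := abs_real_inner_le_norm (x i) (y j)
  rwa [hx, hy, one_mul] at this

theorem abs_le_one_of_sign {a : ℝ} (h : a = 1 ∨ a = -1) : |a| ≤ 1 := by
  rcases h with rfl | rfl <;> norm_num

theorem signValueSet_bddAbove (A : Matrix (Fin N) (Fin N) ℝ) : BddAbove (signValueSet A) := by
  refine ⟨∑ i, ∑ j, |A i j|, ?_⟩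
  rintro r ⟨x, y, hx, hy, rfl⟩
  refine Finset.sum_le_sum fun i _ => Finset.sum_le_sum fun j _ => ?_
  refine (le_abs_self _).trans ?_
  rw [abs_mul, abs_mul]
  exact mul_le_of_le_one_right (mul_nonneg (abs_nonneg _) (abs_nonneg _))
    (abs_le_one_of_sign (hy j)) |>.trans
    (mul_le_of_le_one_right (abs_nonneg _) (abs_le_one_of_sign (hx i)))

theorem sign_update {ι : Type*} [DecidableEq ι] {s : ℝ} (hs : s = 1 ∨ s = -1) (i k : ι) :
    Function.update (fun _ : ι => (1 : ℝ)) i s k = 1 ∨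
      Function.update (fun _ : ι => (1 : ℝ)) i s k = -1 := by
  by_cases h : k = i
  · subst h; simpa using hs
  · simp [h]

/-- A matrix whose sign values are all nonpositive is zero. -/
theorem eq_zero_of_sSup_signValueSet_nonpos {A : Matrix (Fin N) (Fin N) ℝ}
    (h : sSup (signValueSet A) ≤ 0) : A = 0 := by
  -- Replacing y by -y flips the value, so nonpositive values are all zero. A double difference in
  -- the i-th and j-th signs then isolates 4 A i j.
  have hB : ∀ x y : Fin N → ℝ, (∀ i, x i = 1 ∨ x i = -1) → (∀ j, y j = 1 ∨ y j = -1) →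
      ∑ i, ∑ j, A i j * x i * y j = 0 := by
    intro x y hx hy
    have h1 := (le_csSup (signValueSet_bddAbove A) ⟨x, y, hx, hy, rfl⟩).trans h
    have h2 := (le_csSup (signValueSet_bddAbove A) ⟨x, fun j => -y j, hx, fun j => by
      rcases hy j with e | e <;> simp [e], rfl⟩).trans h
    simp only [mul_neg, Finset.sum_neg_distrib] at h2
    linarith
  ext i j
  set u : ℝ → Fin N → ℝ := fun s => Function.update (fun _ => 1) i s with hu
  set v : ℝ → Fin N → ℝ := fun s => Function.update (fun _ => 1) j s with hv
  have hsp : (1 : ℝ) = 1 ∨ (1 : ℝ) = -1 := Or.inl rfl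
  have hsm : (-1 : ℝ) = 1 ∨ (-1 : ℝ) = -1 := Or.inr rfl
  have b1 := hB (u 1) (v 1) (sign_update hsp i) (sign_update hsp j)
  have b2 := hB (u 1) (v (-1)) (sign_update hsp i) (sign_update hsm j)
  have b3 := hB (u (-1)) (v 1) (sign_update hsm i) (sign_update hsp j)
  have b4 := hB (u (-1)) (v (-1)) (sign_update hsm i) (sign_update hsm j)
  have hsum : ∑ k, ∑ l, A k l * (u 1 k - u (-1) k) * (v 1 l - v (-1) l) = 0 := by
    have : ∀ k l, A k l * (u 1 k - u (-1) k) * (v 1 l - v (-1) l) =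
        A k l * u 1 k * v 1 l - A k l * u 1 k * v (-1) l -
          (A k l * u (-1) k * v 1 l - A k l * u (-1) k * v (-1) l) := fun k l => by ring
    simp only [this, Finset.sum_sub_distrib, b1, b2, b3, b4]
    norm_num
  have hu2 : ∀ k, u 1 k - u (-1) k = if k = i then 2 else 0 := fun k => by
    by_cases h : k = i
    · subst h; simp [hu]; norm_num
    · simp [hu, h]
  have hv2 : ∀ l, v 1 l - v (-1) l = if l = j then 2 else 0 := fun l => by
    by_cases h : l = j
    · subst h; simp [hv]; norm_num
    · simp [hv, h]
  simp only [hu2, hv2, mul_ite, mul_zero, ite_mul, zero_mul, Finset.sum_ite_eq',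
    Finset.mem_univ, if_true] at hsum
  simpa using hsum

/-- The quotient is informative only if its denominator is positive. Otherwise A = 0, which
contradicts a vector value of at least K s > 0. -/
theorem le_grothendieckConstant {A : Matrix (Fin N) (Fin N) ℝ} {K s : ℝ} (hK : 0 ≤ K)
    (hsign : sSup (signValueSet A) ≤ s) (hs : 0 < K * s) {d : ℕ}
    {x y : Fin N → EuclideanSpace ℝ (Fin d)} (hx : ∀ i, ‖x i‖ = 1) (hy : ∀ j, ‖y j‖ = 1)
    (hval : K * s ≤ ∑ i, ∑ j, A i j * inner ℝ (x i) (y j)) :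
    (K : EReal) ≤ grothendieckConstant := by
  have hvec : K * s ≤ sSup (vectorValueSet A) :=
    hval.trans (le_csSup (vectorValueSet_bddAbove A) ⟨d, x, y, hx, hy, rfl⟩)
  have hpos : 0 < sSup (signValueSet A) := by
    by_contra h
    have hA := eq_zero_of_sSup_signValueSet_nonpos (not_lt.1 h)
    subst hA
    simp at hval
    linarith
  refine le_trans ?_ (le_iSup₂ (f := fun (n : ℕ) (A : Matrix (Fin n) (Fin n) ℝ) =>
    ((sSup (vectorValueSet A) / sSup (signValueSet A) : ℝ) : EReal)) N A)
  rw [EReal.coe_le_coe_iff, le_div_iff₀ hpos]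
  exact (mul_le_mul_of_nonneg_left hsign hK).trans hvec

end Grothendieck

/-- Signs on the cells are sign strategies on ℝⁿ that are constant on cells, so the bound for the
game applies whatever the partition. -/
theorem sSup_signValueSet_cellMatrix_le {n N : ℕ} (i₀ : Fin n) {ε : ℝ} (hε0 : 0 ≤ ε)
    (hε : ε ≤ 4 / 10 ^ 11) {e : (Fin n → ℝ) → Fin N} (he : Measurable e) :
    sSup (signValueSet (cellMatrix ε davieReedsLambda e)) ≤ davieReedsValue - 0.01 * ε := by
  refine csSup_le ⟨_, fun _ => 1, fun _ => 1, fun _ => Or.inl rfl, fun _ => Or.inl rfl, rfl⟩ ?_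
  rintro r ⟨x, y, hx, hy, rfl⟩
  have h := gameForm_le_value i₀ hε0 hε ((measurable_of_countable x).comp he)
    ((measurable_of_countable y).comp he) (fun z => hx (e z)) (fun z => hy (e z))
  refine le_trans (le_of_eq ?_) h
  refine Eq.trans ?_ (gameForm_comp_cell ε davieReedsLambda he x y).symm
  refine Finset.sum_congr rfl fun i _ => Finset.sum_congr rfl fun j _ => ?_
  simp only [RCLike.inner_apply, conj_trivial]
  ring

theorem davieReedsConstant_add_le_grothendieckConstant :
    ((davieReedsConstant + 1 / 10 ^ 12 : ℝ) : EReal) ≤ grothendieckConstant := by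
  obtain ⟨n, hn, hpos⟩ := (eventually_sdp_lower_bound.and (eventually_gt_atTop 0)).exists
  have hu := gameForm_normalizedId ⟨0, hpos⟩ (ε := 4 / 10 ^ 11) (by norm_num) davieReedsLambda
  obtain ⟨N, e, v, he, hv, ht⟩ := exists_cell_gameForm_gt ⟨0, hpos⟩ _ _ (hn.trans_le hu)
  rw [gameForm_comp_cell _ _ he] at ht
  have hK : 0 < davieReedsConstant + 1 / 10 ^ 12 := by
    have := davieReedsConstant_bounds.1
    positivity
  have hV : 0 < davieReedsValue - 0.01 * (4 / 10 ^ 11) := by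
    have := davieReedsValue_bounds.1
    norm_num at this ⊢
    linarith
  exact le_grothendieckConstant hK.le
    (sSup_signValueSet_cellMatrix_le ⟨0, hpos⟩ (by norm_num) le_rfl he) (mul_pos hK hV) hv hv ht.le

/-- `K_DR ≈ 1.6769` is the limiting integrality gap of the Davie–Reeds game `Π_1 - λ* I`; the gap of the
game `Π_1 - λ* I - ε Π_3` with `ε = 4·10⁻¹¹` is at least `K_DR + 10⁻¹²` in all large dimensions;
and `K_G ≥ K_DR + 10⁻¹²`. -/
theorem theorem1 :
    (1.6769 < davieReedsConstant ∧ davieReedsConstant < 1.677) ∧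
    Tendsto (fun n : ℕ => gameSdp n 0 davieReedsLambda / gameVal n 0 davieReedsLambda) atTop
      (𝓝 davieReedsConstant) ∧
    (∀ᶠ n : ℕ in atTop,
      davieReedsConstant + 1 / 10 ^ 12 ≤
        gameSdp n (4 / 10 ^ 11) davieReedsLambda / gameVal n (4 / 10 ^ 11) davieReedsLambda) ∧
    ((davieReedsConstant + 1 / 10 ^ 12 : ℝ) : EReal) ≤ grothendieckConstant :=
  ⟨davieReedsConstant_bounds, tendsto_gap, eventually_gap,
    davieReedsConstant_add_le_grothendieckConstant⟩
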